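/- Let $\Lambda$ be the ring of symmetric functions over $\mathbb{Z}$ in variables $X_1,X_2,\ldots$, with elementary and complete symmetric functions $e_r,h_r$. Put $q_n=\sum_{i=0}^{n}h_{n-i}e_i$ for $n\ge 0$ and $q_n=0$ for $n<0$, and let $\Gamma\subset\Lambda$ be the subring generated by $q_1,q_2,\ldots$. For a strict partition $\lambda=(\lambda_1>\cdots>\lambda_l>0)$ let $Q_\lambda\in\Gamma$ be the Schur $Q$-function, that is, the coefficient of $t_1^{\lambda_1}\cdots t_l^{\lambda_l}$ in $\prod_i Q(t_i)\prod_{i<j}F(t_j/t_i)$, where $Q(t)=\sum_n q_nt^n$ and $F(y)=\frac{1-y}{1+y}=1+2\sum_{a\ge1}(-1)^ay^a$. The $Q_\lambda$ form a $\mathbb{Z}$-basis of $\Gamma$; equip $\Gamma$ with the bilinear form $\langle Q_\lambda,Q_\mu\rangle=\delta_{\lambda\mu}2^{\ell(\lambda)}$, where $\ell(\lambda)=l$. For every $f\in\Gamma$ the multiplication by $f$ has an adjoint $f^\perp:\Gamma\to\Gamma$, with $\langle f^\perp g,x\rangle=\langle g,fx\rangle$ for all $g,x\in\Gamma$. For $n,i,j\in\mathbb{Z}$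 put $$\mathcal{B}_n=\sum_{i\ge0}(-1)^iq_{n+i}\,q_i^\perp,\qquad \mathcal{B}_{i,j}=\begin{cases}\mathcal{B}_i\mathcal{B}_j&(i>j)\\-\mathcal{B}_j\mathcal{B}_i&(i<j)\\0&(i=j)\end{cases}$$ as operators on $\Gamma$. Write $(f\circ p_m)(X_1,X_2,\ldots)=f(X_1^m,X_2^m,\ldots)$. **Theorem.** Let $m\ge1$ be odd. Then $q_n\circ p_m\in\Gamma$ for all $n\in\mathbb{Z}$, and with $$\Phi_n^{(m)}=\sum_{i\ge0}(-1)^i(q_{n+i}\circ p_m)(q_i\circ p_m)^\perp:\Gamma\to\Gamma\qquad(n\in\mathbb{Z})$$ one has the identity of formal series in $u^{\pm1}$ whose coefficients are operators on $\Gamma$ $$\sum_{n\in\mathbb{Z}}\Phi_n^{(m)}u^{nm}=\Bigl(1+\sum_{\substack{i\equiv-2\\ j\equiv2}}\mathcal{B}_{i,j}u^{i+j}\Bigr)\Bigl(1+\sum_{\substack{i\equiv-4\\ j\equiv4}}\mathcal{B}_{i,j}u^{i+j}\Bigr)\cdots\Bigl(1+\sum_{\substack{i\equiv-(m-1)\\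 j\equiv m-1}}\mathcal{B}_{i,j}u^{i+j}\Bigr)\Bigl(\sum_{k\equiv0}\mathcal{B}_ku^k\Bigr),$$ where $i,j,k$ run over $\mathbb{Z}$, the congruences are modulo $m$, and the product is taken in the displayed order over the residue pairs $(-2c,2c)$, $c=1,\ldots,\frac{m-1}{2}$, followed by the last factor (for $m=1$ only the last factor is present). Here all infinite sums of operators (in $\mathcal{B}_n$, in $\Phi_n^{(m)}$, in the coefficient of each $u^d$ in each factor, and in the coefficient of each $u^d$ in the product, which is formed successively from the right) have only finitely many nonzero terms when applied to any given element of $\Gamma$. -/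

import Mathlib

noncomputable section

namespace SchurQ

/-! ### The ring `Γ`

Symmetric functions in `X₀, X₁, …` are realised as formal power series of bounded degree
in these variables, with integer coefficients. -/

open Classical in
/-- The elementary symmetric function `e_r`: the sum of all squarefree monomials of degree `r`. -/
def elem (r : ℕ) : MvPowerSeries ℕ ℤ :=
  fun d => if d.degree = r ∧ ∀ i, d i ≤ 1 then 1 else 0

/-- The complete symmetric function `h_r`: the sum of all monomials of degree `r`. -/
def compl (r : ℕ) : MvPowerSeries ℕ ℤ :=
  fun d => if d.degree = r then 1 else 0

/-- `q_n = ∑_{i=0}^n h_{n-i} e_i`. -/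
def qNat (n : ℕ) : MvPowerSeries ℕ ℤ :=
  ∑ i ∈ Finset.range (n + 1), compl (n - i) * elem i

/-- The ring `Γ` generated by `q_1, q_2, …`. -/
def GammaRing : Subalgebra ℤ (MvPowerSeries ℕ ℤ) :=
  Algebra.adjoin ℤ {f | ∃ n : ℕ, 1 ≤ n ∧ f = qNat n}

abbrev Gam : Type := ↥GammaRing

/-- `q_n` for `n : ℤ`, as an element of `Γ`: here `q_0 = 1`, and `q_n = 0` for `n < 0`. -/
def q : ℤ → Gam
  | Int.ofNat 0 => 1
  | Int.ofNat (n + 1) => ⟨qNat (n + 1), Algebra.subset_adjoin ⟨n + 1, by omega, rfl⟩⟩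
  | Int.negSucc _ => 0

/-! ### Schur `Q`-functions -/

/-- The coefficients of `F(y) = (1 - y) / (1 + y) = 1 + 2 ∑_{a ≥ 1} (-1)^a y^a`. -/
def coeffF (a : ℕ) : ℤ := if a = 0 then 1 else 2 * (-1) ^ a

/-- For an integer sequence `α = (α_1, …, α_l)`, the coefficient of `t_1^{α_1} ⋯ t_l^{α_l}` in
`∏_i Q(t_i) ∏_{i<j} F(t_j / t_i)`, where `Q(t) = ∑_n q_n t^n` and `F(t_j / t_i)` is expanded in
powers of `t_j / t_i`.  The recursion expands the factors that involve the first variable: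
the `j`-th entry of `a` is the power of `t_{j+1} / t_1` that is picked.
Only finitely many `a` contribute. -/
def coeffQ : (l : ℕ) → (Fin l → ℤ) → Gam
  | 0, _ => 1
  | l + 1, α => ∑ᶠ a : Fin l → ℕ,
      (∏ j, coeffF (a j)) • (q (α 0 + ∑ j, (a j : ℤ)) * coeffQ l (fun j => α j.succ - (a j : ℤ)))

/-- Strict partitions `λ_1 > ⋯ > λ_l > 0`. -/
@[ext]
structure StrictPartition where
  parts : List ℕ
  strict : parts.Pairwise (· > ·)
  pos : ∀ x ∈ parts, 0 < x

/-- The length `ℓ(λ)`. -/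
def StrictPartition.length (lam : StrictPartition) : ℕ := lam.parts.length

/-- The Schur `Q`-function `Q_λ`. -/
def schurQ (lam : StrictPartition) : Gam :=
  coeffQ lam.parts.length (fun i => (lam.parts.get i : ℤ))

/-- The `Q_λ` form a `ℤ`-basis of `Γ`. -/
def SchurQIsBasis : Prop :=
  LinearIndependent ℤ schurQ ∧ ⊤ ≤ Submodule.span ℤ (Set.range schurQ)

open Classical in
/-- The inner product on `Γ`: the bilinear form with `⟨Q_λ, Q_μ⟩ = δ_{λμ} 2^{ℓ(λ)}`. -/
def form : Gam →ₗ[ℤ] Gam →ₗ[ℤ] ℤ :=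
  if h : SchurQIsBasis then
    (Module.Basis.mk h.1 h.2).constr ℤ
      (fun lam => (2 : ℤ) ^ lam.length • (Module.Basis.mk h.1 h.2).coord lam)
  else 0

/-- `T` is adjoint to the multiplication by `f`: `⟨T g, x⟩ = ⟨g, f x⟩` for all `g`, `x`. -/
def IsPerp (f : Gam) (T : Module.End ℤ Gam) : Prop :=
  ∀ g x : Gam, form (T g) x = form g (f * x)

open Classical in
/-- `f^⊥`, the adjoint of the multiplication by `f` on `Γ`. -/
def perp (f : Gam) : Module.End ℤ Gam :=
  if h : ∃ T : Module.End ℤ Gam, IsPerp f T then h.choose else 0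

/-! ### Infinite sums of operators -/

/-- Applied to any given element, all but finitely many operators of the family vanish. -/
def LocallyFinite {ι : Type} (T : ι → Module.End ℤ Gam) : Prop :=
  ∀ f : Gam, (Function.support fun i => T i f).Finite

open Classical in
/-- The pointwise sum of a locally finite family of operators. -/
def opSum {ι : Type} (T : ι → Module.End ℤ Gam) : Module.End ℤ Gam :=
  if h : LocallyFinite T then
    { toFun := fun f => ∑ᶠ i, T i f
      map_add' := fun f g => by
        simp only [map_add]
        exact finsum_add_distrib (h f) (h g)
      map_smul' := fun c f => by
        simp only [map_smul, RingHom.id_apply]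
        exact (smul_finsum' c (h f)).symm }
  else 0

/-! ### The operators `B_n`, `B_{i,j}` and `Φ_n^{(m)}` -/

/-- The terms `(-1)^i q_{n+i} q_i^⊥` of `B_n`. -/
def termB (n : ℤ) (i : ℕ) : Module.End ℤ Gam :=
  (-1 : ℤ) ^ i • (LinearMap.mulLeft ℤ (q (n + i)) * perp (q i))

/-- `B_n = ∑_{i ≥ 0} (-1)^i q_{n+i} q_i^⊥`. -/
def opB (n : ℤ) : Module.End ℤ Gam := opSum (termB n)

/-- `B_{i,j} = B_i B_j` for `i > j`, `-B_j B_i` for `i < j`, and `0` for `i = j`. -/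
def opBB (i j : ℤ) : Module.End ℤ Gam :=
  if j < i then opB i * opB j else if i < j then -(opB j * opB i) else 0

/-- The plethysm `f ∘ p_m`, that is `(f ∘ p_m)(X_0, X_1, …) = f(X_0^m, X_1^m, …)`. -/
def pleth (m : ℕ) (f : MvPowerSeries ℕ ℤ) : MvPowerSeries ℕ ℤ :=
  MvPowerSeries.subst (fun i : ℕ => (MvPowerSeries.X i : MvPowerSeries ℕ ℤ) ^ m) f

open Classical in
/-- `q_n ∘ p_m` as an element of `Γ` (it lies in `Γ` for odd `m`). -/
def qPleth (m : ℕ) (n : ℤ) : Gam :=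
  if h : pleth m (q n : MvPowerSeries ℕ ℤ) ∈ GammaRing then ⟨_, h⟩ else 0

/-- The terms `(-1)^i (q_{n+i} ∘ p_m) (q_i ∘ p_m)^⊥` of `Φ_n^{(m)}`. -/
def termPhi (m : ℕ) (n : ℤ) (i : ℕ) : Module.End ℤ Gam :=
  (-1 : ℤ) ^ i • (LinearMap.mulLeft ℤ (qPleth m (n + i)) * perp (qPleth m i))

/-- `Φ_n^{(m)} = ∑_{i ≥ 0} (-1)^i (q_{n+i} ∘ p_m) (q_i ∘ p_m)^⊥`. -/
def opPhi (m : ℕ) (n : ℤ) : Module.End ℤ Gam := opSum (termPhi m n)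

/-! ### Formal series in `u^{±1}` with operator coefficients -/

/-- `∑_{d ∈ ℤ} T_d u^d` is encoded by `d ↦ T_d`. -/
abbrev OpSeries : Type := ℤ → Module.End ℤ Gam

/-- The terms of the coefficient of `u^d` in the product of two series. -/
def mulTerm (S T : OpSeries) (d : ℤ) (a : ℤ) : Module.End ℤ Gam := S a * T (d - a)

/-- The product of two series. -/
def mulSeries (S T : OpSeries) : OpSeries := fun d => opSum (mulTerm S T d)

/-- The terms `B_{i,j}` with `i ≡ -l`, `j ≡ l` modulo `m` and `i + j = d`. -/
def pairTerm (m : ℕ) (l d : ℤ)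
    (p : {p : ℤ × ℤ // p.1 ≡ -l [ZMOD m] ∧ p.2 ≡ l [ZMOD m] ∧ p.1 + p.2 = d}) :
    Module.End ℤ Gam :=
  opBB p.1.1 p.1.2

/-- The series `1 + ∑_{i ≡ -l, j ≡ l (mod m)} B_{i,j} u^{i+j}`. -/
def pairFactor (m : ℕ) (l : ℤ) : OpSeries := fun d =>
  (if d = 0 then 1 else 0) + opSum (pairTerm m l d)

/-- The series `∑_{k ≡ 0 (mod m)} B_k u^k`. -/
def lastFactor (m : ℕ) : OpSeries := fun k => if k ≡ 0 [ZMOD m] then opB k else 0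

/-- For `r = (m - 1) / 2`, the product of the factors with `l = 2(t+1), 2(t+2), …, 2r`, in this
order, and of the last factor.  For `t = 0` this is the whole product. -/
def tailProduct (m t : ℕ) : OpSeries :=
  (List.range' (t + 1) ((m - 1) / 2 - t)).foldr
    (fun c S => mulSeries (pairFactor m (2 * (c : ℤ))) S) (lastFactor m)

/-- The series `∑_n Φ_n^{(m)} u^{nm}`. -/
def phiSeries (m : ℕ) : OpSeries := fun d => if (m : ℤ) ∣ d then opPhi m (d / m) else 0

end SchurQ

end

/-!
Let `Q(t) = ∑ q_n t^n`, and let `D(s)` substitute a further variable `s` into a symmetric function: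
`(D(s) f)(X_0, X_1, …) = f(s, X_0, X_1, …)`. As `D(s)` is multiplicative and
`D(s) Q(t) = (1 + s t) / (1 - s t) Q(t)`, the series `B(t) = Q(t) D(-1/t)` satisfies
`B(t) B(s) = (t - s) / (t + s) :B(t) B(s):`, where in the normally ordered product `: :` all
operators `D` stand to the right (`bOp_normal`). This gives the Clifford relations
`B_i B_j + B_j B_i = 2 (-1)^i δ_{i+j,0}` (`bOp_anticomm`).

The generating function of the Schur `Q`-functions is `B(t_1) ⋯ B(t_l) 1`, so that
`Q_λ = B_{λ_1} ⋯ B_{λ_l} 1` (`schurQ_eq_word`). The Clifford relations straighten all such words,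
and they make `(-1)^n B_{-n}` adjoint to `B_n` (`form_bOp`). Hence the `Q_λ` form a basis
(`schurQIsBasis`), and the adjoint of `q_k` is the coefficient `D_k` of `D(s)` (`perp_q`); in
particular the operators `B_n` of the theorem are the coefficients of `B(t)`.

Residues `ρ` modulo `m` serve as names of variables `x_ρ`. Up to corrections that come from the
Clifford relations, the product of the factors is obtained from the product of all `B(x_ρ)`, in the
order `-2, 2, -4, 4, …, 0`, by selecting the monomials whose exponent of `x_ρ` is congruent to `ρ`,
and setting all variables equal to `u`. The corrections disappear after multiplication by
`∏ (x_i^m + x_j^m)` over all pairs, which respects the selection of residues and becomes a power of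
`2 u^m` (`pairC_step`, `isClearing`). The same multiplication turns `∏ B(x_ρ)` into `:∏ B(x_ρ):`,
multiplied by the polynomial `∏ (x_i^m + x_j^m) (x_i - x_j) / (x_i + x_j)` (`act_clear_prodB`).

The residues are now selected by Fourier inversion, that is, by averaging over all substitutions
`x_ρ = χ(a_ρ) u`, where `χ` is a primitive additive character of `ℤ/m`. The polynomial vanishes
there unless `a` is a permutation, and the normally ordered product is symmetric, so that only a
multiple of its value at `x_ρ = χ(ρ) u` remains (`exists_diagSum_vander`). The multiple is found by
comparing constant terms at `1 ∈ Γ` (`diagSum_vander`). Thus the product of the factors is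
`T(u) = :∏ B(χ(ρ) u):`.

Finally `T(u) 1 = ∏ Q(χ(ρ) u)` is `∑ (q_n ∘ p_m) u^{nm}`: both series are multiplied by
`(1 + s^m u^m) / (1 - s^m u^m)` under `D(s)` and have constant term `1` (`coe_tailProduct_one`).
Expanding the normally ordered product gives `T_d = ∑_b (-1)^b T_{d+b}(1) T_b(1)^⊥`
(`tailProduct_apply`), which is the definition of the operators `Φ_n` (`opPhi_eq`).
-/

noncomputable section

namespace SchurQ

open Finset Filter

set_option linter.unusedSectionVars false

/-! ### Splitting off the first variable -/

section HeadCoeff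

/-- The exponent `X_0^n X_1^{d_0} X_2^{d_1} ⋯`. -/
def consExp (n : ℕ) (d : ℕ →₀ ℕ) : ℕ →₀ ℕ :=
  Finsupp.single 0 n + d.embDomain ⟨Nat.succ, Nat.succ_injective⟩

/-- The exponent of a monomial after removal of its first variable. -/
def tailExp (d : ℕ →₀ ℕ) : ℕ →₀ ℕ := d.comapDomain Nat.succ Nat.succ_injective.injOn

@[simp] lemma consExp_zero (n : ℕ) (d : ℕ →₀ ℕ) : consExp n d 0 = n := by
  have : d.embDomain ⟨Nat.succ, Nat.succ_injective⟩ 0 = 0 :=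
    Finsupp.embDomain_of_notMem_range _ _ _ (by rintro ⟨a, ha⟩; exact Nat.succ_ne_zero a ha)
  simp [consExp, this]

@[simp] lemma consExp_succ (n : ℕ) (d : ℕ →₀ ℕ) (i : ℕ) : consExp n d (i + 1) = d i := by
  have : d.embDomain ⟨Nat.succ, Nat.succ_injective⟩ (i + 1) = d i :=
    Finsupp.embDomain_apply_self ⟨Nat.succ, Nat.succ_injective⟩ d i
  simp [consExp, this]

@[simp] lemma tailExp_apply (d : ℕ →₀ ℕ) (i : ℕ) : tailExp d i = d (i + 1) := rfl

@[simp] lemma tailExp_consExp (n : ℕ) (d : ℕ →₀ ℕ) : tailExp (consExp n d) = d := by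
  ext i; simp

@[simp] lemma consExp_tailExp (d : ℕ →₀ ℕ) : consExp (d 0) (tailExp d) = d := by
  ext i; cases i <;> simp

lemma consExp_add (n k : ℕ) (d e : ℕ →₀ ℕ) :
    consExp n d + consExp k e = consExp (n + k) (d + e) := by
  ext i; cases i <;> simp

@[simp] lemma degree_consExp (n : ℕ) (d : ℕ →₀ ℕ) : (consExp n d).degree = n + d.degree := by
  simp only [consExp, map_add, Finsupp.degree_single]
  congr 1
  rw [Finsupp.degree_apply, Finsupp.degree_apply, Finsupp.support_embDomain, Finset.sum_map]
  exact Finset.sum_congr rfl fun i _ => Finsupp.embDomain_apply_self _ _ _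

@[simp] lemma consExp_zero_zero : consExp 0 0 = 0 := by
  ext i; cases i <;> simp

variable {A : Type*} [CommRing A]

/-- The coefficient of `X_0^n` in a power series, with the remaining variables renumbered. -/
def headCoeff (n : ℕ) : MvPowerSeries ℕ A →ₗ[A] MvPowerSeries ℕ A where
  toFun f := fun d => f (consExp n d)
  map_add' _ _ := rfl
  map_smul' _ _ := rfl

lemma coeff_headCoeff (n : ℕ) (f : MvPowerSeries ℕ A) (d : ℕ →₀ ℕ) :
    MvPowerSeries.coeff d (headCoeff n f) = MvPowerSeries.coeff (consExp n d) f := rfl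

lemma headCoeff_apply (n : ℕ) (f : MvPowerSeries ℕ A) (d : ℕ →₀ ℕ) :
    headCoeff n f d = f (consExp n d) := rfl

lemma headCoeff_mul (n : ℕ) (f g : MvPowerSeries ℕ A) :
    headCoeff n (f * g) = ∑ p ∈ antidiagonal n, headCoeff p.1 f * headCoeff p.2 g := by
  ext d
  simp only [map_sum, coeff_headCoeff, MvPowerSeries.coeff_mul]
  rw [← Finset.sum_product']
  refine Finset.sum_nbij' (fun p => ((p.1 0, p.2 0), (tailExp p.1, tailExp p.2)))
    (fun x => (consExp x.1.1 x.2.1, consExp x.1.2 x.2.2)) ?_ ?_ ?_ ?_ ?_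
  · rintro ⟨a, b⟩ h
    simp only [HasAntidiagonal.mem_antidiagonal, mem_product] at h ⊢
    constructor
    · simpa using congrArg (fun e => e 0) h
    · ext i
      simpa using congrArg (fun e => e (i + 1)) h
  · rintro ⟨⟨a, b⟩, c, e⟩ h
    simp only [HasAntidiagonal.mem_antidiagonal, mem_product] at h ⊢
    rw [consExp_add, h.1, h.2]
  · rintro ⟨a, b⟩ _
    simp
  · rintro ⟨⟨a, b⟩, c, e⟩ _
    simp
  · rintro ⟨a, b⟩ _
    simp

lemma headCoeff_one (n : ℕ) :
    headCoeff n (1 : MvPowerSeries ℕ A) = if n = 0 then 1 else 0 := by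
  ext d
  have h : consExp n d = 0 ↔ n = 0 ∧ d = 0 := by
    constructor
    · intro h
      refine ⟨by simpa using congrArg (fun e => e 0) h, ?_⟩
      ext i
      simpa using congrArg (fun e => e (i + 1)) h
    · rintro ⟨rfl, rfl⟩; simp
  rw [coeff_headCoeff, MvPowerSeries.coeff_one]
  split_ifs with h1 h2 h2
  · rw [MvPowerSeries.coeff_one, if_pos (h.1 h1).2]
  · exact absurd (h.1 h1).1 h2
  · rw [MvPowerSeries.coeff_one, if_neg (fun h3 => h1 (h.2 ⟨h2, h3⟩))]
  · simp

/-- A space of power series without constant terms that is stable under all `headCoeff n`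
vanishes: stripping off the variables one by one turns every coefficient into a constant term. -/
lemma eq_zero_of_mem_of_headCoeff_mem (W : AddSubgroup (MvPowerSeries ℕ A))
    (h0 : ∀ f ∈ W, MvPowerSeries.constantCoeff f = 0)
    (hW : ∀ f ∈ W, ∀ n, headCoeff n f ∈ W) (f : MvPowerSeries ℕ A) (hf : f ∈ W) : f = 0 := by
  have key : ∀ N : ℕ, ∀ d : ℕ →₀ ℕ, (∀ i, N ≤ i → d i = 0) → ∀ f ∈ W,
      MvPowerSeries.coeff d f = 0 := by
    intro N
    induction N with
    | zero =>
      intro d hd f hf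
      have : d = 0 := by ext i; exact hd i (Nat.zero_le i)
      subst this
      simpa using h0 f hf
    | succ N ih =>
      intro d hd f hf
      rw [← consExp_tailExp d, ← coeff_headCoeff]
      exact ih _ (fun i hi => hd (i + 1) (by omega)) _ (hW f hf _)
  ext d
  refine key (d.support.sup id + 1) d (fun i hi => ?_) f hf
  by_contra hne
  have := Finset.le_sup (f := id) (Finsupp.mem_support_iff.2 hne)
  simp only [id] at this
  omega

end HeadCoeff

/-! ### The series `q_n` -/

lemma headCoeff_compl (n r : ℕ) : headCoeff n (compl r) = if n ≤ r then compl (r - n) else 0 := by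
  ext d
  change compl r (consExp n d) = _
  split_ifs with h
  · change _ = compl (r - n) d
    simp only [compl, degree_consExp]
    congr 1
    rw [eq_iff_iff]; omega
  · simp only [compl, degree_consExp]
    rw [if_neg (by omega)]; rfl

lemma headCoeff_elem (n r : ℕ) :
    headCoeff n (elem r) = if n ≤ 1 ∧ n ≤ r then elem (r - n) else 0 := by
  classical
  ext d
  change elem r (consExp n d) = _
  have key : (∀ i, consExp n d i ≤ 1) ↔ n ≤ 1 ∧ ∀ i, d i ≤ 1 := by
    constructor
    · intro h
      exact ⟨by simpa using h 0, fun i => by simpa using h (i + 1)⟩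
    · rintro ⟨h1, h2⟩ i
      cases i <;> simp [h1, h2]
  split_ifs with h
  · change elem r (consExp n d) = elem (r - n) d
    refine if_congr ?_ rfl rfl
    rw [degree_consExp, key]
    constructor
    · rintro ⟨h1, h2, h3⟩; exact ⟨by omega, h3⟩
    · rintro ⟨h1, h2⟩; exact ⟨by omega, h.1, h2⟩
  · refine if_neg ?_
    rw [degree_consExp, key]
    rintro ⟨h1, h2, h3⟩
    exact h ⟨h2, by omega⟩

lemma compl_zero : compl 0 = 1 := by
  ext d
  rw [MvPowerSeries.coeff_one]
  change compl 0 d = _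
  simp [compl, Finsupp.degree_eq_zero_iff]

lemma elem_zero : elem 0 = 1 := by
  ext d
  rw [MvPowerSeries.coeff_one]
  change elem 0 d = _
  by_cases h : d = 0
  · subst h; simp [elem]
  · simp [elem, Finsupp.degree_eq_zero_iff, h]

lemma qNat_zero : qNat 0 = 1 := by simp [qNat, compl_zero, elem_zero]

/-- `D(s) Q(t) = (1 + s t) / (1 - s t) Q(t)`, coefficientwise. -/
lemma headCoeff_qNat (n r : ℕ) :
    headCoeff n (qNat r) =
      if n = 0 then qNat r else if n ≤ r then 2 * qNat (r - n) else 0 := by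
  have h1 : ∀ a b : ℕ, headCoeff n (compl a * elem b) =
      headCoeff n (compl a) * elem b +
        (if 1 ≤ n ∧ 1 ≤ b then headCoeff (n - 1) (compl a) * elem (b - 1) else 0) := by
    intro a b
    rw [headCoeff_mul, Finset.Nat.sum_antidiagonal_eq_sum_range_succ
      (fun i j => headCoeff i (compl a) * headCoeff j (elem b)), Finset.sum_range_succ]
    rw [show n - n = 0 by omega, headCoeff_elem 0 b]
    simp only [Nat.zero_le, and_self, if_true, Nat.sub_zero]
    rw [add_comm]
    congr 1
    cases n with
    | zero => simp
    | succ n =>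
      rw [Finset.sum_range_succ, Finset.sum_eq_zero]
      · rw [show n + 1 - n = 1 by omega, headCoeff_elem 1 b]
        by_cases hb : 1 ≤ b <;> simp [hb]
      · intro i hi
        rw [headCoeff_elem, if_neg, mul_zero]
        rw [mem_range] at hi
        omega
  have h2 : ∀ k s : ℕ, ∑ i ∈ range (s + 1), headCoeff k (compl (s - i)) * elem i =
      if k ≤ s then qNat (s - k) else 0 := by
    intro k s
    simp only [headCoeff_compl]
    split_ifs with h
    · rw [qNat]
      have : range (s - k + 1) ⊆ range (s + 1) := by
        intro x; simp only [mem_range]; omega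
      rw [← Finset.sum_subset this]
      · refine Finset.sum_congr rfl fun i hi => ?_
        rw [mem_range] at hi
        rw [if_pos (by omega), show s - i - k = s - k - i by omega]
      · intro i hi hi2
        rw [mem_range] at hi hi2
        rw [if_neg (by omega : ¬ k ≤ s - i), zero_mul]
    · refine Finset.sum_eq_zero fun i hi => ?_
      rw [if_neg (by omega : ¬ k ≤ s - i), zero_mul]
  rw [qNat, map_sum]
  simp only [h1]
  rw [Finset.sum_add_distrib, h2, Finset.sum_range_succ']
  simp only [Nat.le_add_left, and_true, Nat.add_sub_cancel, nonpos_iff_eq_zero, one_ne_zero,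
    and_false, if_false, add_zero]
  rcases Nat.eq_zero_or_pos n with rfl | hn
  · simp [qNat]
  · rw [if_neg (by omega : n ≠ 0)]
    simp only [show 1 ≤ n from hn, if_true]
    cases r with
    | zero => simp [show ¬ n ≤ 0 by omega]
    | succ r =>
      simp only [show ∀ i, r + 1 - (i + 1) = r - i by intro i; omega]
      rw [h2]
      by_cases h : n ≤ r + 1
      · rw [if_pos h, if_pos h, if_pos (by omega), show r - (n - 1) = r + 1 - n by omega]
        ring
      · rw [if_neg h, if_neg h, if_neg (by omega), add_zero]

lemma constantCoeff_qNat (n : ℕ) :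
    MvPowerSeries.constantCoeff (qNat n) = if n = 0 then 1 else 0 := by
  have h1 : ∀ r, MvPowerSeries.constantCoeff (compl r) = if r = 0 then 1 else 0 := by
    intro r
    change compl r 0 = _
    simp [compl, eq_comm]
  have h2 : ∀ r, MvPowerSeries.constantCoeff (elem r) = if r = 0 then 1 else 0 := by
    intro r
    change elem r 0 = _
    simp [elem, eq_comm]
  rw [qNat, map_sum]
  simp only [map_mul, h1, h2]
  split_ifs with h
  · subst h; simp
  · refine Finset.sum_eq_zero fun i hi => ?_
    by_cases hi0 : i = 0
    · subst hi0; simp [h]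
    · simp [hi0]

/-! ### The operators `D_k` on `Γ` -/

lemma q_zero : q 0 = 1 := rfl

lemma q_neg {n : ℤ} (hn : n < 0) : q n = 0 := by
  cases n with
  | ofNat n => exact absurd hn (by simp)
  | negSucc n => rfl

lemma coe_q_natCast (n : ℕ) : (q (n : ℤ) : MvPowerSeries ℕ ℤ) = qNat n := by
  cases n with
  | zero => rw [qNat_zero]; rfl
  | succ n => rfl

/-- Multiplications by the `q_n` generate `Γ` from `1`. -/
lemma submodule_eq_top {W : Submodule ℤ Gam} (h1 : (1 : Gam) ∈ W)
    (hq : ∀ n f, f ∈ W → q n * f ∈ W) : W = ⊤ := by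
  have key : ∀ x (hx : x ∈ GammaRing), ∀ g ∈ W, (⟨x, hx⟩ : Gam) * g ∈ W := by
    intro x hx
    induction hx using Algebra.adjoin_induction with
    | mem x hx =>
      obtain ⟨n, hn, rfl⟩ := hx
      intro g hg
      have : (⟨qNat n, Algebra.subset_adjoin ⟨n, hn, rfl⟩⟩ : Gam) = q n :=
        Subtype.ext (coe_q_natCast n).symm
      rw [this]
      exact hq _ _ hg
    | algebraMap r =>
      intro g hg
      have : (⟨algebraMap ℤ _ r, Subalgebra.algebraMap_mem _ r⟩ : Gam) * g = r • g := by
        refine Subtype.ext ?_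
        change algebraMap ℤ _ r * (g : MvPowerSeries ℕ ℤ) = r • (g : MvPowerSeries ℕ ℤ)
        rw [zsmul_eq_mul, eq_intCast]
      rw [this]
      exact W.smul_mem r hg
    | add x y hx hy ihx ihy =>
      intro g hg
      have : (⟨x + y, add_mem hx hy⟩ : Gam) * g = ⟨x, hx⟩ * g + ⟨y, hy⟩ * g := by
        rw [← add_mul]; rfl
      rw [this]
      exact W.add_mem (ihx g hg) (ihy g hg)
    | mul x y hx hy ihx ihy =>
      intro g hg
      have : (⟨x * y, mul_mem hx hy⟩ : Gam) * g = ⟨x, hx⟩ * (⟨y, hy⟩ * g) := by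
        rw [← mul_assoc]; rfl
      rw [this]
      exact ihx _ (ihy g hg)
  rw [eq_top_iff]
  rintro ⟨x, hx⟩ -
  simpa using key x hx 1 h1

/-- An operator on `Γ` is determined by its behaviour under multiplication by the `q_n`. -/
lemma end_ext {S T : Module.End ℤ Gam} (h1 : S 1 = T 1)
    (hq : ∀ n f, S f = T f → S (q n * f) = T (q n * f)) : S = T := by
  have : LinearMap.eqLocus S T = ⊤ := submodule_eq_top h1 hq
  exact LinearMap.ext fun f => by
    have hf : f ∈ LinearMap.eqLocus S T := by rw [this]; trivial
    exact hf

lemma headCoeff_mem (n : ℕ) {f : MvPowerSeries ℕ ℤ} (hf : f ∈ GammaRing) :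
    headCoeff n f ∈ GammaRing := by
  induction hf using Algebra.adjoin_induction generalizing n with
  | mem x hx =>
    obtain ⟨r, hr, rfl⟩ := hx
    have hq : ∀ r, qNat r ∈ GammaRing := fun r => by
      rw [← coe_q_natCast]; exact (q r).2
    rw [headCoeff_qNat]
    split_ifs
    · exact hq r
    · exact mul_mem (ofNat_mem _ 2) (hq _)
    · exact zero_mem _
  | algebraMap r =>
    rw [Algebra.algebraMap_eq_smul_one, map_smul, headCoeff_one]
    split_ifs
    · exact Subalgebra.smul_mem _ (one_mem _) r
    · rw [smul_zero]; exact zero_mem _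
  | add x y hx hy ihx ihy => rw [map_add]; exact add_mem (ihx n) (ihy n)
  | mul x y hx hy ihx ihy =>
    rw [headCoeff_mul]
    exact sum_mem fun p _ => mul_mem (ihx _) (ihy _)

/-- The coefficient of `s^k` in `f(s, X_0, X_1, …)`, for `f` in `Γ`.  It will turn out to be
`q_k^⊥ f`. -/
def del (k : ℤ) : Module.End ℤ Gam :=
  if 0 ≤ k then
    { toFun := fun f => ⟨headCoeff k.toNat f, headCoeff_mem _ f.2⟩
      map_add' := fun _ _ => Subtype.ext (map_add _ _ _)
      map_smul' := fun c f => Subtype.ext (map_smul (headCoeff k.toNat) c (f : MvPowerSeries ℕ ℤ)) }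
  else 0

lemma del_neg {k : ℤ} (hk : k < 0) : del k = 0 := if_neg (by omega)

lemma coe_del (k : ℕ) (f : Gam) : (del (k : ℤ) f : MvPowerSeries ℕ ℤ) = headCoeff k f := by
  rw [del, if_pos (by positivity)]
  rfl

lemma del_one (k : ℤ) : del k 1 = if k = 0 then 1 else 0 := by
  rcases lt_or_ge k 0 with h | h
  · rw [del_neg h, if_neg (by omega)]; rfl
  · lift k to ℕ using h
    refine Subtype.ext ?_
    rw [coe_del]
    change headCoeff k 1 = _
    rw [headCoeff_one]
    by_cases hk : k = 0 <;> simp [hk]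

lemma del_q_of_pos {k : ℤ} (hk : 0 < k) (n : ℤ) : del k (q n) = 2 * q (n - k) := by
  rcases lt_or_ge n 0 with h | h
  · rw [q_neg h, q_neg (by omega : n - k < 0), map_zero, mul_zero]
  · lift n to ℕ using h
    lift k to ℕ using hk.le
    refine Subtype.ext ?_
    rw [coe_del, coe_q_natCast, headCoeff_qNat, if_neg (by omega)]
    split_ifs with hkn
    · rw [← Int.ofNat_sub hkn]
      change _ = 2 * ((q ((n - k : ℕ) : ℤ) : Gam) : MvPowerSeries ℕ ℤ)
      rw [coe_q_natCast]
    · rw [q_neg (by omega : (n : ℤ) - k < 0), mul_zero]; rfl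

lemma del_zero_q (n : ℤ) : del 0 (q n) = q n := by
  rcases lt_or_ge n 0 with h | h
  · rw [q_neg h, map_zero]
  · lift n to ℕ using h
    refine Subtype.ext ?_
    rw [← Nat.cast_zero, coe_del, coe_q_natCast, headCoeff_qNat, if_pos rfl]

lemma del_mul (k : ℕ) (f g : Gam) :
    del k (f * g) = ∑ i ∈ range (k + 1), del i f * del (k - i) g := by
  refine Subtype.ext ?_
  rw [coe_del]
  change headCoeff k ((f : MvPowerSeries ℕ ℤ) * (g : MvPowerSeries ℕ ℤ)) = _
  rw [headCoeff_mul, Finset.Nat.sum_antidiagonal_eq_sum_range_succ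
    (fun i j => headCoeff i (f : MvPowerSeries ℕ ℤ) * headCoeff j (g : MvPowerSeries ℕ ℤ))]
  rw [AddSubmonoidClass.coe_finsetSum]
  refine Finset.sum_congr rfl fun i hi => ?_
  rw [mem_range] at hi
  rw [← Int.ofNat_sub (by omega)]
  change _ = ((del (i : ℤ) f : Gam) : MvPowerSeries ℕ ℤ) *
    ((del ((k - i : ℕ) : ℤ) g : Gam) : MvPowerSeries ℕ ℤ)
  rw [coe_del, coe_del]

/-- `(1 - s t) D(s) (Q(t) g) = (1 + s t) Q(t) D(s) g`, coefficientwise. -/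
lemma del_q_mul (k n : ℤ) (g : Gam) :
    del k (q n * g) - del (k - 1) (q (n - 1) * g) =
      q n * del k g + q (n - 1) * del (k - 1) g := by
  have key : ∀ (k : ℕ) (n : ℤ), del k (q n * g) + q n * del k g =
      2 * ∑ i ∈ range (k + 1), q (n - i) * del (k - i) g := by
    intro k n
    rw [del_mul, Finset.sum_range_succ', Finset.sum_range_succ']
    simp only [Nat.cast_zero, sub_zero, del_zero_q, mul_add, Finset.mul_sum]
    have : ∀ i ∈ range k, del ((i + 1 : ℕ) : ℤ) (q n) * del (k - (i + 1 : ℕ)) g =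
        2 * (q (n - (i + 1 : ℕ)) * del (k - (i + 1 : ℕ)) g) := by
      intro i _
      rw [del_q_of_pos (by positivity), mul_assoc]
    rw [Finset.sum_congr rfl this]
    ring
  rcases lt_or_ge k 0 with h | h
  · rw [del_neg h, del_neg (by omega : k - 1 < 0)]; simp
  · lift k to ℕ using h
    cases k with
    | zero =>
      have := key 0 n
      simp only [zero_add, range_one, sum_singleton, Nat.cast_zero, sub_zero] at this
      rw [Nat.cast_zero, del_neg (by omega : (0 : ℤ) - 1 < 0)]
      simp only [LinearMap.zero_apply, mul_zero, add_zero, sub_zero]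
      linear_combination this
    | succ k =>
      have h1 := key (k + 1) n
      have h2 := key k (n - 1)
      rw [Finset.sum_range_succ'] at h1
      have h3 : ∀ i ∈ range (k + 1), q (n - (i + 1 : ℕ)) * del ((k + 1 : ℕ) - (i + 1 : ℕ)) g =
          q (n - 1 - i) * del (k - i) g := by
        intro i _
        rw [show n - ((i + 1 : ℕ) : ℤ) = n - 1 - i by push_cast; ring,
          show ((k + 1 : ℕ) : ℤ) - ((i + 1 : ℕ) : ℤ) = k - i by push_cast; ring]
      rw [Finset.sum_congr rfl h3] at h1
      have h4 : ((k + 1 : ℕ) : ℤ) - 1 = k := by push_cast; ring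
      rw [h4]
      simp only [Nat.cast_zero, sub_zero] at h1
      linear_combination h1 - h2

lemma del_comm (i j : ℤ) : del i * del j = del j * del i := by
  have key : ∀ g : Gam, (∀ i j, del i (del j g) = del j (del i g)) →
      ∀ N : ℕ, ∀ n : ℤ, n < N → ∀ i j, del i (del j (q n * g)) = del j (del i (q n * g)) := by
    intro g hg N
    induction N using Nat.strong_induction_on with
    | _ N ih =>
    intro n hn i j
    rcases lt_or_ge n 0 with h | h
    · rw [q_neg h]; simp
    have ih1 : ∀ n' < n, ∀ i j, del i (del j (q n' * g)) = del j (del i (q n' * g)) :=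
      fun n' hn' => ih n.toNat (by omega) n' (by omega)
    have e : ∀ i j, del i (del j (q n * g)) = del i (del (j - 1) (q (n - 1) * g)) +
        del (i - 1) (del j (q (n - 1) * g)) - del (i - 1) (del (j - 1) (q (n - 1 - 1) * g)) +
        (q n * del i (del j g) + q (n - 1) * del (i - 1) (del j g) +
          q (n - 1) * del i (del (j - 1) g) +
            q (n - 1 - 1) * del (i - 1) (del (j - 1) g)) := by
      intro i j
      have a1 := congrArg (del i) (del_q_mul j n g)
      have a2 := congrArg (del (i - 1)) (del_q_mul j (n - 1) g)
      have a3 := del_q_mul i n (del j g)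
      have a4 := del_q_mul i (n - 1) (del (j - 1) g)
      simp only [map_add, map_sub] at a1 a2
      linear_combination a1 - a2 + a3 + a4
    rw [e i j, e j i, ih1 (n - 1) (by omega) i (j - 1), ih1 (n - 1) (by omega) (i - 1) j,
      ih1 (n - 1 - 1) (by omega) (i - 1) (j - 1), hg i j, hg (i - 1) j, hg i (j - 1),
      hg (i - 1) (j - 1)]
    ring
  have key2 : ∀ f : Gam, ∀ i j, del i (del j f) = del j (del i f) := by
    let W : Submodule ℤ Gam :=
      { carrier := {f | ∀ i j, del i (del j f) = del j (del i f)}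
        zero_mem' := fun i j => by simp
        add_mem' := fun {a b} ha hb i j => by simp only [map_add, ha i j, hb i j]
        smul_mem' := fun c a ha i j => by simp only [map_smul, ha i j] }
    have hW : W = ⊤ := by
      refine submodule_eq_top ?_ fun n f hf => ?_
      · intro i j
        rw [del_one, del_one]
        by_cases hi : i = 0 <;> by_cases hj : j = 0 <;> simp [hi, hj, del_one]
      · exact key f hf (n.toNat + 1) n (by omega)
    intro f
    have : f ∈ W := by rw [hW]; trivial
    exact this
  exact LinearMap.ext fun f => key2 f i j

lemma del_zero : del 0 = 1 := by
  refine end_ext (by simp [del_one]) fun n f hf => ?_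
  have := del_q_mul 0 n f
  rw [del_neg (by omega : (0 : ℤ) - 1 < 0)] at this
  simp only [LinearMap.zero_apply, mul_zero, add_zero, sub_zero] at this
  rw [this, hf]; rfl

/-! ### Degrees -/

/-- The elements of `Γ` of degree at most `N`. -/
def degLE (N : ℕ) : Submodule ℤ Gam where
  carrier := {f | ∀ d : ℕ →₀ ℕ, N < d.degree → (f : MvPowerSeries ℕ ℤ) d = 0}
  zero_mem' := fun _ _ => rfl
  add_mem' := fun {a b} ha hb d hd => by
    change (a : MvPowerSeries ℕ ℤ) d + (b : MvPowerSeries ℕ ℤ) d = 0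
    rw [ha d hd, hb d hd, add_zero]
  smul_mem' := fun c a ha d hd => by
    change c • (a : MvPowerSeries ℕ ℤ) d = 0
    rw [ha d hd, smul_zero]

lemma degLE_mono {M N : ℕ} (h : M ≤ N) : degLE M ≤ degLE N :=
  fun _ hf d hd => hf d (lt_of_le_of_lt h hd)

lemma exists_mem_degLE (f : Gam) : ∃ N, f ∈ degLE N := by
  have hmul : ∀ (x y : MvPowerSeries ℕ ℤ) (M N : ℕ), (∀ d, M < d.degree → x d = 0) →
      (∀ d, N < d.degree → y d = 0) → ∀ d, M + N < d.degree → (x * y) d = 0 := by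
    intro x y M N hx hy d hd
    change MvPowerSeries.coeff d (x * y) = 0
    rw [MvPowerSeries.coeff_mul]
    refine Finset.sum_eq_zero fun p hp => ?_
    rw [HasAntidiagonal.mem_antidiagonal] at hp
    rw [← hp, map_add] at hd
    rcases lt_or_ge M p.1.degree with h | h
    · rw [show MvPowerSeries.coeff p.1 x = 0 from hx _ h, zero_mul]
    · rw [show MvPowerSeries.coeff p.2 y = 0 from hy _ (by omega), mul_zero]
  have hq : ∀ n : ℕ, ∀ d : ℕ →₀ ℕ, n < d.degree → qNat n d = 0 := by
    classical
    intro n d hd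
    change MvPowerSeries.coeff d (qNat n) = 0
    rw [qNat, map_sum]
    refine Finset.sum_eq_zero fun i hi => ?_
    rw [mem_range] at hi
    refine hmul (compl (n - i)) (elem i) (n - i) i (fun e he => ?_) (fun e he => ?_) d (by omega)
    · exact if_neg (by omega)
    · exact if_neg (by omega)
  let W : Submodule ℤ Gam :=
    { carrier := {f | ∃ N, f ∈ degLE N}
      zero_mem' := ⟨0, zero_mem _⟩
      add_mem' := fun {a b} ⟨M, ha⟩ ⟨N, hb⟩ => ⟨max M N,
        add_mem (degLE_mono (le_max_left _ _) ha) (degLE_mono (le_max_right _ _) hb)⟩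
      smul_mem' := fun c a ⟨M, ha⟩ => ⟨M, Submodule.smul_mem _ c ha⟩ }
  have hW : W = ⊤ := by
    refine submodule_eq_top ⟨0, fun d hd => ?_⟩ ?_
    · change MvPowerSeries.coeff d (1 : MvPowerSeries ℕ ℤ) = 0
      rw [MvPowerSeries.coeff_one, if_neg]
      rintro rfl
      simp at hd
    · rintro n f ⟨N, hf⟩
      rcases lt_or_ge n 0 with h | h
      · exact ⟨0, by rw [q_neg h, zero_mul]; exact zero_mem _⟩
      · lift n to ℕ using h
        refine ⟨n + N, hmul _ _ n N (fun d hd => ?_) hf⟩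
        rw [coe_q_natCast]
        exact hq n d hd
  have : f ∈ W := by rw [hW]; trivial
  exact this

lemma del_mem_degLE {N : ℕ} {f : Gam} (hf : f ∈ degLE N) (k : ℤ) : del k f ∈ degLE N := by
  rcases lt_or_ge k 0 with h | h
  · rw [del_neg h]; exact zero_mem _
  · lift k to ℕ using h
    intro d hd
    rw [coe_del, headCoeff_apply]
    exact hf _ (by rw [degree_consExp]; omega)

lemma del_eq_zero_of_lt {N : ℕ} {f : Gam} (hf : f ∈ degLE N) {k : ℤ} (hk : N < k) :
    del k f = 0 := by
  lift k to ℕ using by omega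
  refine Subtype.ext ?_
  rw [coe_del]
  ext d
  rw [coeff_headCoeff]
  exact hf _ (by rw [degree_consExp]; omega)

/-! ### Normally ordered products -/

lemma opSum_apply {ι : Type} {T : ι → Module.End ℤ Gam} (h : LocallyFinite T) (f : Gam) :
    opSum T f = ∑ᶠ i, T i f := by
  rw [opSum, dif_pos h]; rfl

/-- The terms `(-1)^i q_{n+i} T D_i` of `normal n T`. -/
def normTerm (n : ℤ) (T : Module.End ℤ Gam) (i : ℕ) : Module.End ℤ Gam :=
  (-1 : ℤ) ^ i • (LinearMap.mulLeft ℤ (q (n + i)) * T * del i)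

/-- The coefficient of `t^n` in the normally ordered product `Q(t) T D(-1/t)`. -/
def normal (n : ℤ) (T : Module.End ℤ Gam) : Module.End ℤ Gam := opSum (normTerm n T)

/-- The coefficient of `t^n` in the vertex operator `B(t) = Q(t) D(-1/t)`. -/
def bOp (n : ℤ) : Module.End ℤ Gam := normal n 1

lemma map_neg_one_pow_mul (T : Module.End ℤ Gam) (i : ℕ) (f : Gam) :
    T ((-1) ^ i * f) = (-1) ^ i * T f := by
  rcases neg_one_pow_eq_or Gam i with h | h <;> simp [h]

lemma normTerm_apply (n : ℤ) (T : Module.End ℤ Gam) (i : ℕ) (f : Gam) :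
    normTerm n T i f = (-1) ^ i * (q (n + i) * T (del i f)) := by
  change (-1 : ℤ) ^ i • (q (n + i) * T (del i f)) = _
  rw [zsmul_eq_mul]
  push_cast
  rfl

lemma support_normTerm_subset (n : ℤ) (T : Module.End ℤ Gam) {N : ℕ} {f : Gam}
    (hf : f ∈ degLE N) : (Function.support fun i => normTerm n T i f) ⊆ range (N + 1) := by
  intro i hi
  rw [Function.mem_support, normTerm_apply] at hi
  by_contra h
  rw [mem_coe, mem_range] at h
  rw [del_eq_zero_of_lt hf (by omega : (N : ℤ) < i)] at hi
  simp at hi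

lemma locallyFinite_normTerm (n : ℤ) (T : Module.End ℤ Gam) : LocallyFinite (normTerm n T) := by
  intro f
  obtain ⟨N, hN⟩ := exists_mem_degLE f
  exact (finite_toSet _).subset (support_normTerm_subset n T hN)

lemma normal_apply_of_le (n : ℤ) (T : Module.End ℤ Gam) {N K : ℕ} {f : Gam} (hf : f ∈ degLE N)
    (hK : N < K) :
    normal n T f = ∑ i ∈ range K, (-1) ^ i * (q (n + i) * T (del i f)) := by
  rw [normal, opSum_apply (locallyFinite_normTerm n T)]
  have hs : (range (N + 1) : Set ℕ) ⊆ range K := by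
    intro i hi
    rw [mem_coe, mem_range] at *
    omega
  rw [finsum_eq_sum_of_support_subset _ ((support_normTerm_subset n T hf).trans hs)]
  exact Finset.sum_congr rfl fun i _ => normTerm_apply n T i f

lemma normal_apply (n : ℤ) (T : Module.End ℤ Gam) {N : ℕ} {f : Gam} (hf : f ∈ degLE N) :
    normal n T f = ∑ i ∈ range (N + 1), (-1) ^ i * (q (n + i) * T (del i f)) :=
  normal_apply_of_le n T hf (Nat.lt_succ_self N)

lemma eventually_sum_eq_bOp (n : ℤ) (f : Gam) : ∀ᶠ K in atTop,
    ∑ i ∈ range K, (-1) ^ i * (q (n + i) * del i f) = bOp n f := by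
  obtain ⟨N, hN⟩ := exists_mem_degLE f
  filter_upwards [eventually_gt_atTop N] with K hK
  exact (normal_apply_of_le n 1 hN hK).symm

lemma eventually_sum_eq_neg_bOp (n : ℤ) (f : Gam) : ∀ᶠ K in atTop,
    ∑ i ∈ range K, (-1) ^ i * (q (n + i) * del (i - 1) f) = -bOp (n + 1) f := by
  obtain ⟨N, hN⟩ := exists_mem_degLE f
  filter_upwards [eventually_gt_atTop (N + 1)] with K hK
  obtain ⟨K, rfl⟩ : ∃ K', K = K' + 1 := ⟨K - 1, by omega⟩
  rw [Finset.sum_range_succ', Nat.cast_zero, del_neg (by omega : (0 : ℤ) - 1 < 0)]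
  rw [bOp, normal_apply_of_le (n + 1) 1 hN (by omega : N < K), ← Finset.sum_neg_distrib]
  simp only [LinearMap.zero_apply, mul_zero, add_zero]
  refine Finset.sum_congr rfl fun i _ => ?_
  rw [pow_succ, show n + ((i + 1 : ℕ) : ℤ) = n + 1 + i by push_cast; ring,
    show ((i + 1 : ℕ) : ℤ) - 1 = i by push_cast; ring, Module.End.one_apply]
  ring

lemma eventually_sum_pair (i : ℤ) (g g' : Gam) : ∀ᶠ K in atTop,
    ∑ a ∈ range K, (-1) ^ a * (q (i - 1 + a) * (del a g - del (a - 1) g')) =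
      bOp (i - 1) g + bOp i g' := by
  filter_upwards [eventually_sum_eq_bOp (i - 1) g, eventually_sum_eq_neg_bOp (i - 1) g']
    with K h1 h2
  rw [sub_add_cancel] at h2
  rw [← h1, ← sub_neg_eq_add, ← h2, ← Finset.sum_sub_distrib]
  refine Finset.sum_congr rfl fun a _ => ?_
  ring

/-- `(t + s) B(t) Q(s) = (t - s) Q(s) B(t)`, coefficientwise. -/
lemma bOp_q_mul (i j : ℤ) (f : Gam) :
    bOp (i - 1) (q j * f) + bOp i (q (j - 1) * f) =
      q j * bOp (i - 1) f - q (j - 1) * bOp i f := by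
  obtain ⟨K, h1, h2, h3⟩ := ((eventually_sum_pair i (q j * f) (q (j - 1) * f)).and
    ((eventually_sum_eq_bOp (i - 1) f).and (eventually_sum_eq_neg_bOp (i - 1) f))).exists
  rw [sub_add_cancel] at h3
  have e : q j * bOp (i - 1) f - q (j - 1) * bOp i f =
      q j * bOp (i - 1) f + q (j - 1) * -bOp i f := by ring
  rw [← h1, e, ← h2, ← h3, Finset.mul_sum, Finset.mul_sum,
    ← Finset.sum_add_distrib]
  refine Finset.sum_congr rfl fun a _ => ?_
  rw [del_q_mul]
  ring

/-- `(1 - s t) D(s) (Q(t) T D(-1/t)) = (1 + s t) Q(t) D(s) T D(-1/t)`, coefficientwise. -/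
lemma del_normal (k j : ℤ) (T : Module.End ℤ Gam) (f : Gam) :
    del k (normal j T f) - del (k - 1) (normal (j - 1) T f) =
      normal j (del k * T) f + normal (j - 1) (del (k - 1) * T) f := by
  obtain ⟨N, hN⟩ := exists_mem_degLE f
  simp only [normal_apply _ _ hN, map_sum, map_neg_one_pow_mul, ← Finset.sum_sub_distrib,
    ← Finset.sum_add_distrib, ← mul_sub, ← mul_add]
  refine Finset.sum_congr rfl fun a _ => ?_
  rw [show j - 1 + (a : ℤ) = j + a - 1 by ring, del_q_mul]
  rfl

lemma normal_del (j k : ℤ) (f : Gam) : normal j (del k) f = bOp j (del k f) := by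
  obtain ⟨N, hN⟩ := exists_mem_degLE f
  rw [bOp, normal_apply _ _ hN, normal_apply _ _ (del_mem_degLE hN k)]
  refine Finset.sum_congr rfl fun a _ => ?_
  have := LinearMap.congr_fun (del_comm k a) f
  simp only [Module.End.mul_apply] at this
  rw [this]; rfl

/-- `(1 - s t) D(s) B(t) = (1 + s t) B(t) D(s)`, coefficientwise. -/
lemma del_bOp (k j : ℤ) (f : Gam) :
    del k (bOp j f) - del (k - 1) (bOp (j - 1) f) =
      bOp j (del k f) + bOp (j - 1) (del (k - 1) f) := by
  have := del_normal k j 1 f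
  rwa [mul_one, mul_one, normal_del, normal_del] at this

/-- The factors of a normally ordered product may be permuted. -/
lemma normal_comm (i j : ℤ) (T : Module.End ℤ Gam) :
    normal i (normal j T) = normal j (normal i T) := by
  refine LinearMap.ext fun f => ?_
  obtain ⟨N, hN⟩ := exists_mem_degLE f
  have key : ∀ i j, normal i (normal j T) f = ∑ a ∈ range (N + 1), ∑ b ∈ range (N + 1),
      (-1) ^ (a + b) * (q (i + a) * q (j + b) * T (del a (del b f))) := by
    intro i j
    rw [normal_apply _ _ hN]
    refine Finset.sum_congr rfl fun a _ => ?_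
    rw [normal_apply _ _ (del_mem_degLE hN a), Finset.mul_sum, Finset.mul_sum]
    refine Finset.sum_congr rfl fun b _ => ?_
    have := LinearMap.congr_fun (del_comm a b) f
    simp only [Module.End.mul_apply] at this
    rw [this]; ring
  rw [key, key, Finset.sum_comm]
  refine Finset.sum_congr rfl fun a _ => Finset.sum_congr rfl fun b _ => ?_
  have := LinearMap.congr_fun (del_comm a b) f
  simp only [Module.End.mul_apply] at this
  rw [this, add_comm a b, mul_comm (q (i + b))]

/-- `(t + s) B(t) Q(s) T D(-1/s) = (t - s) Q(s) B(t) T D(-1/s)`, coefficientwise: moving `B(t)`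
under the normal ordering costs the factor `(t - s) / (t + s)`. -/
lemma bOp_normal (i j : ℤ) (T : Module.End ℤ Gam) :
    bOp (i - 1) * normal j T + bOp i * normal (j - 1) T =
      normal j (bOp (i - 1) * T) - normal (j - 1) (bOp i * T) := by
  refine LinearMap.ext fun f => ?_
  obtain ⟨N, hN⟩ := exists_mem_degLE f
  have ev : ∀ᶠ K in atTop, ∀ b ∈ range (N + 1),
      ∑ a ∈ range K, (-1) ^ a * (q (i - 1 + a) * del a (T (del b f))) =
        bOp (i - 1) (T (del b f)) ∧
      ∑ a ∈ range K, (-1) ^ a * (q (i - 1 + a) * del (a - 1) (T (del b f))) =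
        -bOp (i - 1 + 1) (T (del b f)) := by
    rw [Filter.eventually_all_finset]
    intro b _
    exact (eventually_sum_eq_bOp _ _).and (eventually_sum_eq_neg_bOp _ _)
  obtain ⟨K, h1, h2⟩ := ((eventually_sum_pair i (normal j T f) (normal (j - 1) T f)).and ev).exists
  change bOp (i - 1) (normal j T f) + bOp i (normal (j - 1) T f) =
    normal j (bOp (i - 1) * T) f - normal (j - 1) (bOp i * T) f
  rw [← h1]
  simp only [del_normal]
  simp only [normal_apply _ _ hN, Module.End.mul_apply]
  rw [← Finset.sum_sub_distrib]
  have : ∀ b ∈ range (N + 1), (-1) ^ b * (q (j + b) * bOp (i - 1) (T (del b f))) -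
      (-1) ^ b * (q (j - 1 + b) * bOp i (T (del b f))) =
      ∑ a ∈ range K, ((-1) ^ b * (q (j + b) *
        ((-1) ^ a * (q (i - 1 + a) * del a (T (del b f))))) +
        (-1) ^ b * (q (j - 1 + b) *
        ((-1) ^ a * (q (i - 1 + a) * del (a - 1) (T (del b f)))))) := by
    intro b hb
    obtain ⟨e1, e2⟩ := h2 b hb
    rw [sub_add_cancel] at e2
    rw [Finset.sum_add_distrib, ← Finset.mul_sum, ← Finset.mul_sum, ← Finset.mul_sum,
      ← Finset.mul_sum, e1, e2]
    ring
  rw [Finset.sum_congr rfl this, Finset.sum_comm]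
  refine Finset.sum_congr rfl fun a _ => ?_
  rw [← Finset.sum_add_distrib, Finset.mul_sum, Finset.mul_sum]
  refine Finset.sum_congr rfl fun b _ => ?_
  ring

/-! ### The Clifford relations -/

lemma one_mem_degLE : (1 : Gam) ∈ degLE 0 := fun d hd => by
  change MvPowerSeries.coeff d (1 : MvPowerSeries ℕ ℤ) = 0
  rw [MvPowerSeries.coeff_one, if_neg]
  rintro rfl
  simp at hd

lemma bOp_one (n : ℤ) : bOp n 1 = q n := by
  rw [bOp, normal_apply _ _ one_mem_degLE]
  simp [del_one]

lemma bOp_eq_zero_of_lt {N : ℕ} {f : Gam} (hf : f ∈ degLE N) {n : ℤ} (hn : n < -N) :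
    bOp n f = 0 := by
  rw [bOp, normal_apply _ _ hf]
  refine Finset.sum_eq_zero fun i hi => ?_
  rw [mem_range] at hi
  rw [q_neg (by omega), zero_mul, mul_zero]

/-- The coefficient of `t^d` in `Q(-t) Q(t)`. -/
def qAlt (d : ℤ) : Gam := ∑ i ∈ range (d.toNat + 1), (-1) ^ i * (q i * q (d - i))

lemma qAlt_eq_of_lt {d : ℤ} {K : ℕ} (hK : d < K) :
    qAlt d = ∑ i ∈ range K, (-1) ^ i * (q i * q (d - i)) := by
  rw [qAlt]
  rcases lt_or_ge d 0 with h | h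
  · rw [Finset.sum_eq_zero, Finset.sum_eq_zero] <;>
    · intro i _
      rw [q_neg (by omega : d - i < 0)]; simp
  · refine Finset.sum_subset (by intro i; simp only [mem_range]; omega) fun i _ hi => ?_
    rw [mem_range] at hi
    rw [q_neg (by omega : d - i < 0)]; simp

lemma qAlt_shift {d : ℤ} {k K : ℕ} (hK : d < K) :
    ∑ i ∈ range K, (-1) ^ i * (q (i - k) * q (d - i)) = (-1) ^ k * qAlt (d - k) := by
  have h1 : ∑ i ∈ range K, (-1) ^ i * (q (i - k) * q (d - i)) =
      ∑ i ∈ range (k + K), (-1) ^ i * (q (i - k) * q (d - i)) := by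
    refine Finset.sum_subset (by intro i; simp only [mem_range]; omega) fun i _ hi => ?_
    rw [mem_range] at hi
    rw [q_neg (by omega : d - i < 0)]; simp
  rw [h1, Finset.sum_range_add, Finset.sum_eq_zero, zero_add,
    qAlt_eq_of_lt (by omega : d - k < K), Finset.mul_sum]
  · refine Finset.sum_congr rfl fun i _ => ?_
    rw [pow_add, show ((k + i : ℕ) : ℤ) - k = i by push_cast; ring,
      show d - ((k + i : ℕ) : ℤ) = d - k - i by push_cast; ring]
    ring
  · intro i hi
    rw [mem_range] at hi
    rw [q_neg (by omega : (i : ℤ) - k < 0)]; simp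

lemma qAlt_neg {d : ℤ} (hd : d < 0) : qAlt d = 0 := by
  rw [qAlt_eq_of_lt (K := 0) (by simpa using hd)]; simp

lemma del_qAlt (k : ℕ) (d : ℤ) : del (k + 1 : ℕ) (qAlt d) = 0 := by
  have hE : ∀ (k : ℕ) (d : ℤ) (K : ℕ), d < K →
      ∑ i ∈ range K, (-1) ^ i * (q (d - i) * del (k + 1 : ℕ) (q i)) =
        2 * ((-1) ^ (k + 1) * qAlt (d - (k + 1 : ℕ))) := by
    intro k d K hK
    rw [← qAlt_shift hK, Finset.mul_sum]
    refine Finset.sum_congr rfl fun i _ => ?_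
    rw [del_q_of_pos (by positivity)]
    ring
  have hE0 : ∀ (d : ℤ) (K : ℕ), d < K →
      ∑ i ∈ range K, (-1) ^ i * (q (d - i) * del 0 (q i)) = qAlt d := by
    intro d K hK
    rw [qAlt_eq_of_lt hK]
    refine Finset.sum_congr rfl fun i _ => ?_
    rw [del_zero_q]; ring
  have hrec : ∀ (k d : ℤ) (K : ℕ), d < K → del k (qAlt d) - del (k - 1) (qAlt (d - 1)) =
      ∑ i ∈ range K, (-1) ^ i * (q (d - i) * del k (q i)) +
        ∑ i ∈ range K, (-1) ^ i * (q (d - 1 - i) * del (k - 1) (q i)) := by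
    intro k d K hK
    rw [qAlt_eq_of_lt hK, qAlt_eq_of_lt (by omega : d - 1 < K), map_sum, map_sum,
      ← Finset.sum_sub_distrib, ← Finset.sum_add_distrib]
    refine Finset.sum_congr rfl fun i _ => ?_
    have := del_q_mul k (d - i) (q i)
    rw [show d - 1 - (i : ℤ) = d - i - 1 by ring, map_neg_one_pow_mul, map_neg_one_pow_mul,
      mul_comm (q i), mul_comm (q i)]
    linear_combination (-1) ^ i * this
  induction k generalizing d with
  | zero =>
    have h := hrec 1 d (d.toNat + 1) (by omega)
    have h1 := hE 0 d (d.toNat + 1) (by omega)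
    rw [sub_self, hE0 (d - 1) (d.toNat + 1) (by omega), del_zero, Module.End.one_apply] at h
    simp only [zero_add, Nat.cast_one, pow_one] at h1 ⊢
    linear_combination h + h1
  | succ k ih =>
    have h := hrec (k + 1 + 1 : ℕ) d (d.toNat + 1) (by omega)
    have h1 := hE (k + 1) d (d.toNat + 1) (by omega)
    have h2 := hE k (d - 1) (d.toNat + 1) (by omega)
    rw [show ((k + 1 + 1 : ℕ) : ℤ) - 1 = (k + 1 : ℕ) by push_cast; ring, ih, h1, h2,
      show d - 1 - ((k + 1 : ℕ) : ℤ) = d - (k + 1 + 1 : ℕ) by push_cast; ring] at h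
    linear_combination h

/-- The constant term of an element of `Γ`. -/
def constTerm : Gam →+* ℤ := (MvPowerSeries.constantCoeff (σ := ℕ) (R := ℤ)).comp
  (GammaRing.val : Gam →+* MvPowerSeries ℕ ℤ)

lemma constTerm_q (n : ℤ) : constTerm (q n) = if n = 0 then 1 else 0 := by
  rcases lt_or_ge n 0 with h | h
  · rw [q_neg h, map_zero, if_neg (by omega)]
  · lift n to ℕ using h
    change MvPowerSeries.constantCoeff (q n : MvPowerSeries ℕ ℤ) = _
    rw [coe_q_natCast, constantCoeff_qNat]
    simp

/-- `Q(-t) Q(t) = 1`: the map `D(s)` fixes the coefficients of this series. -/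
lemma qAlt_eq (d : ℤ) : qAlt d = if d = 0 then 1 else 0 := by
  rcases lt_trichotomy d 0 with h | h | h
  · rw [qAlt_neg h, if_neg h.ne]
  · subst h; simp [qAlt, q_zero]
  rw [if_neg h.ne']
  refine Subtype.ext (eq_zero_of_mem_of_headCoeff_mem
    (AddSubgroup.zmultiples ((qAlt d : Gam) : MvPowerSeries ℕ ℤ)) ?_ ?_ _
    (AddSubgroup.mem_zmultiples _))
  · have : constTerm (qAlt d) = 0 := by
      rw [qAlt, map_sum]
      refine Finset.sum_eq_zero fun i _ => ?_
      simp only [map_mul, constTerm_q]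
      by_cases hi : i = 0
      · subst hi; simp [h.ne']
      · simp [hi]
    rintro f ⟨c, rfl⟩
    change MvPowerSeries.constantCoeff (c • ((qAlt d : Gam) : MvPowerSeries ℕ ℤ)) = 0
    rw [map_zsmul]
    exact (congrArg (c • ·) this).trans (smul_zero c)
  · rintro f ⟨c, rfl⟩ n
    change headCoeff n (c • ((qAlt d : Gam) : MvPowerSeries ℕ ℤ)) ∈ _
    rw [map_zsmul, ← coe_del]
    cases n with
    | zero => rw [Nat.cast_zero, del_zero]; exact ⟨c, rfl⟩
    | succ n =>
      rw [del_qAlt]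
      exact (AddSubgroup.zmultiples _).zsmul_mem (zero_mem _) c

/-- For `i < 0` only the terms `(-1)^a q_{i+a} D_a q_k` with `a > 0` survive, and
`D_a q_k = 2 q_{k-a}` turns them into the terms of twice a coefficient of `Q(-t) Q(t) = 1`. -/
lemma bOp_neg_q {i : ℤ} (hi : i < 0) (k : ℤ) :
    bOp i (q k) = if i + k = 0 then 2 * (-1) ^ i.natAbs else 0 := by
  obtain ⟨K, h1, h2⟩ := ((eventually_sum_eq_bOp i (q k)).and
    (eventually_gt_atTop k.toNat)).exists
  have e : ∀ a ∈ range K, (-1) ^ a * (q (i + a) * del a (q k)) =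
      2 * ((-1 : Gam) ^ a * (q (a - i.natAbs) * q (k - a))) := by
    intro a _
    rw [show i + (a : ℤ) = a - i.natAbs by omega]
    cases a with
    | zero => rw [q_neg (by omega : ((0 : ℕ) : ℤ) - i.natAbs < 0)]; simp
    | succ a => rw [del_q_of_pos (by positivity)]; ring
  rw [← h1, Finset.sum_congr rfl e, ← Finset.mul_sum, qAlt_shift (by omega), qAlt_eq]
  by_cases h : i + k = 0
  · rw [if_pos h, if_pos (by omega), mul_one]
  · rw [if_neg h, if_neg (by omega), mul_zero, mul_zero]

/-- The anticommutator of `B_i` and `B_j`. -/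
def anti (i j : ℤ) : Module.End ℤ Gam := bOp i * bOp j + bOp j * bOp i

/-- The relation `(t + s) (B(t) B(s) + B(s) B(t)) = 0`, coefficientwise: it holds because
`(t + s) B(t) B(s)` and `(t + s) B(s) B(t)` are `± (t - s) :B(t) B(s):`. -/
lemma anti_shift (i j : ℤ) : anti (i + 1) j = -anti i (j + 1) := by
  have h1 := bOp_normal (i + 1) (j + 1) 1
  have h2 := bOp_normal (j + 1) (i + 1) 1
  simp only [add_sub_cancel_right, mul_one] at h1 h2
  have e1 : normal (j + 1) (bOp i) = normal i (bOp (j + 1)) := normal_comm _ _ _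
  have e2 : normal (i + 1) (bOp j) = normal j (bOp (i + 1)) := normal_comm _ _ _
  change bOp i * bOp (j + 1) + bOp (i + 1) * bOp j = _ at h1
  change bOp j * bOp (i + 1) + bOp (j + 1) * bOp i = _ at h2
  rw [e1] at h1
  rw [e2] at h2
  rw [anti, anti, eq_neg_iff_add_eq_zero]
  calc _ = (bOp i * bOp (j + 1) + bOp (i + 1) * bOp j) +
        (bOp j * bOp (i + 1) + bOp (j + 1) * bOp i) := by abel
    _ = 0 := by rw [h1, h2]; abel

/-- `(t t' + s²)` annihilates the commutator of `B(t) B(t') + B(t') B(t)` with `Q(s)`. -/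
lemma anti_q_mul_step (i j k : ℤ) (f : Gam) :
    anti i j (q k * f) - q k * anti i j f =
      -(anti (i + 1) (j + 1) (q (k - 2) * f) - q (k - 2) * anti (i + 1) (j + 1) f) := by
  have R : ∀ i k f, bOp i (q k * f) + bOp (i + 1) (q (k - 1) * f) =
      q k * bOp i f - q (k - 1) * bOp (i + 1) f := by
    intro i k f
    have := bOp_q_mul (i + 1) k f
    rwa [add_sub_cancel_right] at this
  have D : ∀ i j, bOp i (bOp j (q k * f)) + bOp i (bOp (j + 1) (q (k - 1) * f)) +
      bOp (i + 1) (bOp j (q (k - 1) * f)) + bOp (i + 1) (bOp (j + 1) (q (k - 2) * f)) =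
      q k * bOp i (bOp j f) - q (k - 1) * bOp (i + 1) (bOp j f) -
        q (k - 1) * bOp i (bOp (j + 1) f) + q (k - 2) * bOp (i + 1) (bOp (j + 1) f) := by
    intro i j
    have a1 := congrArg (bOp i) (R j k f)
    have a2 := congrArg (bOp (i + 1)) (R j (k - 1) f)
    have a3 := R i k (bOp j f)
    have a4 := R i (k - 1) (bOp (j + 1) f)
    simp only [map_add, map_sub] at a1 a2
    rw [show k - 1 - 1 = k - 2 by ring] at a2 a4
    linear_combination a1 + a2 + a3 - a4
  have s1 := LinearMap.congr_fun (anti_shift i j) f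
  have s2 := LinearMap.congr_fun (anti_shift i j) (q (k - 1) * f)
  have d1 := D i j
  have d2 := D j i
  simp only [anti, LinearMap.add_apply, LinearMap.neg_apply, Module.End.mul_apply] at s1 s2 ⊢
  linear_combination d1 + d2 - s2 - q (k - 1) * s1

lemma anti_q_mul (i j k : ℤ) (f : Gam) : anti i j (q k * f) = q k * anti i j f := by
  have key : ∀ N : ℕ, ∀ k : ℤ, k < N → ∀ i j, anti i j (q k * f) = q k * anti i j f := by
    intro N
    induction N using Nat.strong_induction_on with
    | _ N ih =>
    intro k hk i j
    rcases lt_or_ge k 0 with h | h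
    · rw [q_neg h]; simp
    · have := anti_q_mul_step i j k f
      rw [ih (N - 1) (by omega) (k - 2) (by omega), sub_self, neg_zero, sub_eq_zero] at this
      exact this
  exact key (k.toNat + 1) k (by omega) i j

/-- Since it commutes with all `q_k`, the anticommutator is multiplication by an element of `Γ`. -/
lemma anti_apply (i j : ℤ) (f : Gam) : anti i j f = anti i j 1 * f := by
  have : anti i j = LinearMap.mulLeft ℤ (anti i j 1) := by
    refine end_ext (by simp) fun n f hf => ?_
    rw [anti_q_mul, hf]
    simp only [LinearMap.mulLeft_apply]
    ring
  exact LinearMap.congr_fun this f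

lemma anti_shift_nat (i j : ℤ) (k : ℕ) (f : Gam) :
    anti i j f = (-1) ^ k * anti (i - k) (j + k) f := by
  induction k with
  | zero => simp
  | succ k ih =>
    have := LinearMap.congr_fun (anti_shift (i - (k + 1 : ℕ)) (j + k)) f
    rw [show i - ((k + 1 : ℕ) : ℤ) + 1 = i - k by push_cast; ring,
      show j + (k : ℤ) + 1 = j + (k + 1 : ℕ) by push_cast; ring, LinearMap.neg_apply] at this
    rw [ih, this]
    ring

/-- The Clifford relation `B_i B_j + B_j B_i = 2 (-1)^i δ_{i+j,0}`. -/
lemma bOp_anticomm (i j : ℤ) (f : Gam) :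
    bOp i (bOp j f) + bOp j (bOp i f) = if i + j = 0 then 2 * (-1) ^ i.natAbs * f else 0 := by
  have h0 : bOp i (bOp j f) + bOp j (bOp i f) = anti i j f := rfl
  -- the anticommutator is a scalar; shift `i` to the far left to compute it
  set k : ℕ := i.toNat + j.natAbs + 1 with hk
  have h1 := anti_shift_nat i j k 1
  have h2 : anti (i - k) (j + k) 1 = bOp (i - k) (q (j + k)) := by
    change bOp (i - k) (bOp (j + k) 1) + bOp (j + k) (bOp (i - k) 1) = _
    rw [bOp_one, bOp_one, q_neg (by omega : i - k < 0), map_zero, add_zero]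
  rw [h0, anti_apply, h1, h2, bOp_neg_q (by omega),
    show i - (k : ℤ) + (j + k) = i + j by ring]
  split_ifs with h
  · have e : ((-1) ^ k * (2 * (-1) ^ (i - k).natAbs) : Gam) = 2 * (-1) ^ i.natAbs := by
      have : (-1 : Gam) ^ k * (-1) ^ (i - k).natAbs = (-1) ^ i.natAbs := by
        rw [← pow_add]
        have hp : Even (k + (i - (k : ℤ)).natAbs) ↔ Even i.natAbs := by
          simp only [Nat.even_iff]; omega
        exact neg_one_pow_congr (R := Gam) hp
      linear_combination 2 * this
    rw [e]
  · simp

/-! ### Schur `Q`-functions as words in the operators `B_n` -/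

/-- `B_{α_1} ⋯ B_{α_l} 1`. -/
def vertexWord : (l : ℕ) → (Fin l → ℤ) → Gam
  | 0, _ => 1
  | l + 1, α => bOp (α 0) (vertexWord l fun j => α j.succ)

/-- The coefficients of `(1 + y) / (1 - y)`. -/
def coeffAbsF (a : ℕ) : ℤ := if a = 0 then 1 else 2

lemma coeffF_eq (a : ℕ) : coeffF a = (-1) ^ a * coeffAbsF a := by
  rw [coeffF, coeffAbsF]
  split_ifs with h
  · simp [h]
  · ring

/-- `D(s) B(t) = (1 + s t) / (1 - s t) B(t) D(s)`, coefficientwise. -/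
lemma del_bOp_eq_sum (k : ℕ) (n : ℤ) (f : Gam) :
    del k (bOp n f) = ∑ j ∈ range (k + 1), (coeffAbsF j : Gam) * bOp (n - j) (del (k - j) f) := by
  have key : ∀ (k : ℕ) (n : ℤ), del k (bOp n f) + bOp n (del k f) =
      2 * ∑ j ∈ range (k + 1), bOp (n - j) (del (k - j) f) := by
    intro k
    induction k with
    | zero => intro n; simp [del_zero]; ring
    | succ k ih =>
      intro n
      have h := del_bOp (k + 1 : ℕ) n f
      rw [show ((k + 1 : ℕ) : ℤ) - 1 = k by push_cast; ring] at h
      rw [Finset.sum_range_succ']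
      have e : ∀ i ∈ range (k + 1), bOp (n - (i + 1 : ℕ)) (del ((k + 1 : ℕ) - (i + 1 : ℕ)) f) =
          bOp (n - 1 - i) (del (k - i) f) := by
        intro i _
        rw [show n - ((i + 1 : ℕ) : ℤ) = n - 1 - i by push_cast; ring,
          show ((k + 1 : ℕ) : ℤ) - ((i + 1 : ℕ) : ℤ) = k - i by push_cast; ring]
      rw [Finset.sum_congr rfl e, mul_add, ← ih (n - 1)]
      simp only [Nat.cast_zero, sub_zero]
      linear_combination h
  have h := key k n
  rw [Finset.sum_range_succ'] at h ⊢
  have e : ∀ i ∈ range k, ((coeffAbsF (i + 1) : ℤ) : Gam) *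
      bOp (n - (i + 1 : ℕ)) (del (k - (i + 1 : ℕ)) f) =
      2 * bOp (n - (i + 1 : ℕ)) (del (k - (i + 1 : ℕ)) f) := by
    intro i _
    rw [coeffAbsF, if_neg (Nat.succ_ne_zero i)]
    push_cast; rfl
  rw [Finset.sum_congr rfl e, ← Finset.mul_sum]
  simp only [coeffAbsF, if_true, Nat.cast_zero, sub_zero,
    Int.cast_one, one_mul] at h ⊢
  linear_combination h

lemma finite_vertexWord_sub (l : ℕ) (α : Fin l → ℤ) :
    {a : Fin l → ℕ | vertexWord l (fun j => α j - a j) ≠ 0}.Finite := by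
  induction l with
  | zero => exact Set.toFinite _
  | succ l ih =>
    have hN : ∀ a' : Fin l → ℕ, ∃ N, vertexWord l (fun j => α j.succ - a' j) ∈ degLE N :=
      fun _ => exists_mem_degLE _
    choose N hN using hN
    refine (((ih fun j => α j.succ).biUnion (t := fun a' =>
      (fun a0 : ℕ => (Fin.cons a0 a' : Fin (l + 1) → ℕ)) '' Set.Iic (α 0 + N a').toNat)
      fun a' _ => (Set.finite_Iic _).image _)).subset fun a ha => ?_
    rw [Set.mem_ofPred_eq, vertexWord] at ha
    refine Set.mem_iUnion₂.2 ⟨fun j => a j.succ, ?_, a 0, ?_, Fin.cons_self_tail a⟩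
    · intro h0
      rw [h0, map_zero] at ha
      exact ha rfl
    · by_contra hlt
      rw [Set.mem_Iic] at hlt
      exact ha (bOp_eq_zero_of_lt (hN fun j => a j.succ) (by omega))

lemma finsum_fin_succ {M : Type*} [AddCommMonoid M] {l : ℕ} (F : (Fin (l + 1) → ℕ) → M)
    (hF : (Function.support F).Finite) :
    ∑ᶠ a, F a = ∑ᶠ a0 : ℕ, ∑ᶠ a' : Fin l → ℕ, F (Fin.cons a0 a') := by
  rw [← finsum_comp_equiv (Fin.consEquiv fun _ : Fin (l + 1) => ℕ)]
  exact finsum_curry (fun p : ℕ × (Fin l → ℕ) => F (Fin.cons p.1 p.2))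
    (hF.preimage (Fin.consEquiv fun _ : Fin (l + 1) => ℕ).injective.injOn)

open Classical in
/-- `D(s) ∏ B(t_i) 1 = ∏ (1 + s t_i) / (1 - s t_i) ∏ B(t_i) 1`, coefficientwise. -/
lemma del_vertexWord (l : ℕ) (α : Fin l → ℤ) (k : ℕ) :
    del k (vertexWord l α) = ∑ᶠ a : Fin l → ℕ, if ∑ j, a j = k then
      ((∏ j, coeffAbsF (a j) : ℤ) : Gam) * vertexWord l (fun j => α j - a j) else 0 := by
  induction l generalizing k with
  | zero =>
    rw [finsum_unique]
    simp only [vertexWord, Finset.univ_eq_empty, Finset.sum_empty, Finset.prod_empty, del_one]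
    by_cases h : k = 0
    · simp [h]
    · simp [h, Ne.symm h]
  | succ l ih =>
    have hfin : ∀ (α' : Fin l → ℤ) (k : ℕ), (Function.support fun a' : Fin l → ℕ =>
        if ∑ j, a' j = k then ((∏ j, coeffAbsF (a' j) : ℤ) : Gam) *
          vertexWord l (fun j => α' j - a' j) else 0).Finite := by
      intro α' k
      refine (finite_vertexWord_sub l α').subset fun a' ha' h0 => ?_
      rw [Function.mem_support] at ha'
      rw [h0, mul_zero, ite_self] at ha'
      exact ha' rfl
    rw [finsum_fin_succ, vertexWord, del_bOp_eq_sum]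
    · rw [finsum_eq_sum_of_support_subset (s := range (k + 1))]
      · refine Finset.sum_congr rfl fun j hj => ?_
        rw [mem_range] at hj
        rw [show (k : ℤ) - j = (k - j : ℕ) by omega, ih]
        have hm : ∀ x : Gam, (coeffAbsF j : Gam) * bOp (α 0 - j) x =
            ((LinearMap.mulLeft ℤ (coeffAbsF j : Gam)) * bOp (α 0 - j)).toAddMonoidHom x :=
          fun _ => rfl
        rw [hm, AddMonoidHom.map_finsum _ (hfin _ _)]
        refine finsum_congr fun a' => ?_
        rw [← hm]
        simp only [Fin.sum_univ_succ, Fin.prod_univ_succ, Fin.cons_zero, Fin.cons_succ, vertexWord]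
        by_cases h : ∑ i, a' i = k - j
        · rw [if_pos h, if_pos (by omega)]
          have hc : ∀ (c : ℤ) (x : Gam), bOp (α 0 - j) ((c : Gam) * x) =
              (c : Gam) * bOp (α 0 - j) x := by
            intro c x
            rw [← zsmul_eq_mul, map_zsmul, zsmul_eq_mul]
          rw [hc]
          push_cast
          ring
        · rw [if_neg h, if_neg (by omega), map_zero, mul_zero]
      · intro j hj
        by_contra hlt
        rw [mem_coe, mem_range] at hlt
        refine hj (finsum_eq_zero_of_forall_eq_zero fun a' => if_neg ?_)
        rw [Fin.sum_univ_succ, Fin.cons_zero]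
        omega
    · refine (finite_vertexWord_sub (l + 1) α).subset fun a ha h0 => ?_
      rw [Function.mem_support] at ha
      rw [h0, mul_zero, ite_self] at ha
      exact ha rfl

/-- `B(t_0) B(t_1) ⋯ B(t_l) 1 = Q(t_0) ∏_j F(t_j / t_0) B(t_1) ⋯ B(t_l) 1`, coefficientwise. -/
lemma bOp_vertexWord (l : ℕ) (k : ℤ) (α : Fin l → ℤ) :
    bOp k (vertexWord l α) = ∑ᶠ a : Fin l → ℕ, (∏ j, coeffF (a j)) •
      (q (k + ∑ j, (a j : ℤ)) * vertexWord l (fun j => α j - (a j : ℤ))) := by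
  classical
  have hfin := finite_vertexWord_sub l α
  obtain ⟨K, hK, hB⟩ := ((eventually_gt_atTop (hfin.toFinset.sup fun a => ∑ j, a j)).and
    (eventually_sum_eq_bOp k (vertexWord l α))).exists
  have e : ∀ i ∈ range K, (-1) ^ i * (q (k + i) * del i (vertexWord l α)) =
      ∑ a ∈ hfin.toFinset, if ∑ j, a j = i then (∏ j, coeffF (a j)) •
      (q (k + ∑ j, (a j : ℤ)) * vertexWord l (fun j => α j - (a j : ℤ))) else 0 := by
    intro i _
    rw [del_vertexWord, finsum_eq_sum_of_support_subset (s := hfin.toFinset), Finset.mul_sum,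
      Finset.mul_sum]
    · refine Finset.sum_congr rfl fun a _ => ?_
      split_ifs with h
      · have h' : ∑ j, (a j : ℤ) = i := by exact_mod_cast h
        rw [h', zsmul_eq_mul]
        simp only [coeffF_eq, Finset.prod_mul_distrib, Finset.prod_pow_eq_pow_sum, h]
        push_cast
        ring
      · rw [mul_zero, mul_zero]
    · intro a ha
      rw [Set.Finite.coe_toFinset]
      intro h0
      rw [Function.mem_support] at ha
      rw [h0, mul_zero, ite_self] at ha
      exact ha rfl
  rw [← hB, Finset.sum_congr rfl e, Finset.sum_comm,
    finsum_eq_sum_of_support_subset (s := hfin.toFinset)]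
  · refine Finset.sum_congr rfl fun a ha => ?_
    rw [Finset.sum_ite_eq, if_pos]
    rw [mem_range]
    exact lt_of_le_of_lt (Finset.le_sup (f := fun a : Fin l → ℕ => ∑ j, a j) ha) hK
  · intro a ha
    rw [Set.Finite.coe_toFinset]
    intro h0
    rw [Function.mem_support] at ha
    rw [h0, mul_zero, zsmul_zero] at ha
    exact ha rfl

/-- The generating function of the Schur `Q`-functions is `B(t_1) ⋯ B(t_l) 1`, since moving
`D(-1/t_i)` to the right past `Q(t_j)` produces the factor `F(t_j / t_i)`. -/
lemma coeffQ_eq_vertexWord (l : ℕ) (α : Fin l → ℤ) : coeffQ l α = vertexWord l α := by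
  induction l with
  | zero => rfl
  | succ l ih =>
    rw [coeffQ, vertexWord, bOp_vertexWord]
    refine finsum_congr fun a => ?_
    rw [ih]

/-- `B_{λ_1} ⋯ B_{λ_l} 1` for a list of natural numbers. -/
def word (L : List ℕ) : Gam := L.foldr (fun n f => bOp n f) 1

lemma schurQ_eq_word (lam : StrictPartition) : schurQ lam = word lam.parts := by
  rw [schurQ, coeffQ_eq_vertexWord]
  generalize lam.parts = L
  induction L with
  | nil => rfl
  | cons n L ih =>
    change bOp n (vertexWord L.length fun i => (L.get i : ℤ)) = bOp n (word L)
    rw [ih]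

/-! ### The basis of Schur `Q`-functions -/

lemma zsmul_eq_zero_gam {c : ℤ} (hc : c ≠ 0) {f : Gam} (h : c • f = 0) : f = 0 := by
  refine Subtype.ext ?_
  ext d
  have h1 : c • (f : MvPowerSeries ℕ ℤ) = 0 := congrArg Subtype.val h
  have h2 : MvPowerSeries.coeff d (c • (f : MvPowerSeries ℕ ℤ)) = 0 := by rw [h1]; rfl
  rw [map_zsmul, smul_eq_mul] at h2
  exact (mul_eq_zero.1 h2).resolve_left hc

lemma bOp_sq {n : ℤ} (hn : n ≠ 0) (f : Gam) : bOp n (bOp n f) = 0 := by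
  have h := bOp_anticomm n n f
  rw [if_neg (by omega)] at h
  refine zsmul_eq_zero_gam (two_ne_zero) ?_
  rw [two_zsmul, h]

lemma bOp_swap {i j : ℤ} (h : i + j ≠ 0) (f : Gam) : bOp i (bOp j f) = -bOp j (bOp i f) := by
  have := bOp_anticomm i j f
  rw [if_neg h] at this
  exact eq_neg_of_add_eq_zero_left this

lemma bOp_neg_one {n : ℤ} (hn : n < 0) : bOp n 1 = 0 := by rw [bOp_one, q_neg hn]

/-- The lists of parts of strict partitions with all parts less than `M`. -/
def IsStrictBelow (M : ℤ) (L : List ℕ) : Prop :=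
  L.Pairwise (· > ·) ∧ ∀ x ∈ L, 0 < x ∧ (x : ℤ) < M

/-- The span of the words of strict partitions with all parts less than `M`. -/
def strictSpan (M : ℤ) : Submodule ℤ Gam := Submodule.span ℤ (word '' {L | IsStrictBelow M L})

lemma isStrictBelow_cons {M : ℤ} {n : ℕ} {L : List ℕ} :
    IsStrictBelow M (n :: L) ↔ 0 < n ∧ (n : ℤ) < M ∧ IsStrictBelow n L := by
  simp only [IsStrictBelow, List.pairwise_cons, List.mem_cons, forall_eq_or_imp]
  constructor
  · rintro ⟨⟨h1, h2⟩, ⟨h3, h4⟩, h5⟩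
    exact ⟨h3, h4, h2, fun x hx => ⟨(h5 x hx).1, by exact_mod_cast h1 x hx⟩⟩
  · rintro ⟨h1, h2, h3, h4⟩
    exact ⟨⟨fun x hx => by exact_mod_cast (h4 x hx).2, h3⟩, ⟨h1, h2⟩,
      fun x hx => ⟨(h4 x hx).1, (h4 x hx).2.trans h2⟩⟩

lemma word_mem_strictSpan {M : ℤ} {L : List ℕ} (h : IsStrictBelow M L) : word L ∈ strictSpan M :=
  Submodule.subset_span ⟨L, h, rfl⟩

lemma bOp_mem_strictSpan_of_gt {M : ℤ} {n : ℕ} (hn : 0 < n) (hM : (n : ℤ) < M) {f : Gam}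
    (hf : f ∈ strictSpan n) : bOp n f ∈ strictSpan M := by
  induction hf using Submodule.span_induction with
  | mem x hx =>
    obtain ⟨L, hL, rfl⟩ := hx
    exact word_mem_strictSpan (L := n :: L) (isStrictBelow_cons.2 ⟨hn, hM, hL⟩)
  | zero => rw [map_zero]; exact zero_mem _
  | add x y _ _ hx hy => rw [map_add]; exact add_mem hx hy
  | smul c x _ hx => rw [map_smul]; exact Submodule.smul_mem _ c hx

lemma strictSpan_mono {M N : ℤ} (h : M ≤ N) : strictSpan M ≤ strictSpan N :=
  Submodule.span_mono (Set.image_mono fun _ hL =>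
    ⟨hL.1, fun x hx => ⟨(hL.2 x hx).1, (hL.2 x hx).2.trans_le h⟩⟩)

/-- Straightening of words by the Clifford relations. -/
lemma bOp_word_mem_strictSpan {M : ℤ} {L : List ℕ} (hL : IsStrictBelow M L) {n : ℤ} (hn : n < M) :
    bOp n (word L) ∈ strictSpan M := by
  induction L generalizing M with
  | nil =>
    rcases lt_trichotomy n 0 with h | rfl | h
    · rw [show word [] = 1 from rfl, bOp_neg_one h]; exact zero_mem _
    · rw [show word [] = 1 from rfl, bOp_one, q_zero]
      exact word_mem_strictSpan (L := []) ⟨List.Pairwise.nil, by simp⟩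
    · lift n to ℕ using h.le
      exact word_mem_strictSpan (L := [n]) (isStrictBelow_cons.2
        ⟨by exact_mod_cast h, hn, List.Pairwise.nil, by simp⟩)
  | cons a L ih =>
    obtain ⟨ha, haM, hL'⟩ := isStrictBelow_cons.1 hL
    change bOp n (bOp a (word L)) ∈ _
    rcases lt_trichotomy n a with h | rfl | h
    · have hmem := bOp_mem_strictSpan_of_gt ha haM (ih hL' h)
      have hc := bOp_anticomm n a (word L)
      rw [eq_sub_of_add_eq hc]
      refine sub_mem ?_ hmem
      split_ifs with h0
      · have e : (2 * (-1) ^ n.natAbs * word L : Gam) =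
            (2 * (-1) ^ n.natAbs : ℤ) • word L := by
          rw [zsmul_eq_mul]; push_cast; rfl
        rw [e]
        exact Submodule.smul_mem _ _ (strictSpan_mono haM.le (word_mem_strictSpan hL'))
      · exact zero_mem _
    · rw [bOp_sq (by omega)]; exact zero_mem _
    · lift n to ℕ using by omega
      exact word_mem_strictSpan (L := n :: a :: L) (isStrictBelow_cons.2
        ⟨by omega, hn, isStrictBelow_cons.2 ⟨ha, h, hL'⟩⟩)

lemma q_mul_bOp (k n : ℤ) (f : Gam) : q k * bOp n f =
    bOp n (q k * f) + bOp (n + 1) (q (k - 1) * f) + q (k - 1) * bOp (n + 1) f := by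
  have := bOp_q_mul (n + 1) k f
  rw [add_sub_cancel_right] at this
  linear_combination -this

/-- The span of all words of strict partitions. -/
def allSpan : Submodule ℤ Gam := Submodule.span ℤ (word '' {L | ∃ M, IsStrictBelow M L})

lemma bOp_mem_allSpan (n : ℤ) {f : Gam} (hf : f ∈ allSpan) : bOp n f ∈ allSpan := by
  induction hf using Submodule.span_induction with
  | mem x hx =>
    obtain ⟨L, ⟨M, hL⟩, rfl⟩ := hx
    have h1 : IsStrictBelow (max M (n + 1)) L :=
      ⟨hL.1, fun x hx => ⟨(hL.2 x hx).1, lt_max_of_lt_left (hL.2 x hx).2⟩⟩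
    have h2 : n < max M (n + 1) := lt_max_of_lt_right (by omega)
    refine Submodule.span_mono (Set.image_mono ?_) (bOp_word_mem_strictSpan h1 h2)
    exact fun L hL => ⟨_, hL⟩
  | zero => rw [map_zero]; exact zero_mem _
  | add x y _ _ hx hy => rw [map_add]; exact add_mem hx hy
  | smul c x _ hx => rw [map_smul]; exact Submodule.smul_mem _ c hx

/-- Induction on the length, by the exchange relation `q_mul_bOp`; the inner induction on `k`
makes the remaining terms with `q_{k-1}` harmless. -/
lemma q_mul_word_mem_allSpan (L : List ℕ) (k : ℤ) : q k * word L ∈ allSpan := by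
  induction L generalizing k with
  | nil =>
    rw [show word [] = 1 from rfl, mul_one, ← bOp_one]
    exact bOp_mem_allSpan _ (Submodule.subset_span ⟨[], ⟨0, List.Pairwise.nil, by simp⟩, rfl⟩)
  | cons a L ih =>
    have key : ∀ N : ℕ, ∀ k < (N : ℤ), ∀ n, q k * bOp n (word L) ∈ allSpan := by
      intro N
      induction N with
      | zero => intro k hk n; rw [q_neg (by simpa using hk), zero_mul]; exact zero_mem _
      | succ N ihN =>
        intro k hk n
        rw [q_mul_bOp]
        exact add_mem (add_mem (bOp_mem_allSpan _ (ih _)) (bOp_mem_allSpan _ (ih _)))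
          (ihN _ (by push_cast at hk; omega) _)
    exact key (k.toNat + 1) k (by omega) a

lemma allSpan_eq_top : allSpan = ⊤ := by
  refine submodule_eq_top (Submodule.subset_span ⟨[], ⟨0, List.Pairwise.nil, by simp⟩, rfl⟩) ?_
  intro n f hf
  induction hf using Submodule.span_induction with
  | mem x hx =>
    obtain ⟨L, -, rfl⟩ := hx
    exact q_mul_word_mem_allSpan L n
  | zero => rw [mul_zero]; exact zero_mem _
  | add x y _ _ hx hy => rw [mul_add]; exact add_mem hx hy
  | smul c x _ hx =>
    rw [← LinearMap.mulLeft_apply (R := ℤ), map_smul]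
    exact Submodule.smul_mem _ c hx

lemma top_le_span_schurQ : ⊤ ≤ Submodule.span ℤ (Set.range schurQ) := by
  rw [← allSpan_eq_top]
  refine Submodule.span_mono ?_
  rintro _ ⟨L, ⟨M, hL⟩, rfl⟩
  exact ⟨⟨L, hL.1, fun x hx => (hL.2 x hx).1⟩, schurQ_eq_word _⟩

/-- The sign `(-1)^n` of an integer. -/
def sgn (n : ℤ) : ℤ := (-1) ^ n.natAbs

lemma sgn_mul_self (n : ℤ) : sgn n * sgn n = 1 := by
  rw [sgn, ← pow_add, Even.neg_one_pow ⟨_, rfl⟩]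

lemma sgn_congr {m n : ℤ} (h : Even m ↔ Even n) : sgn m = sgn n :=
  neg_one_pow_congr (by rwa [Int.natAbs_even, Int.natAbs_even])

lemma sgn_add (m n : ℤ) : sgn (m + n) = sgn m * sgn n := by
  rw [sgn, sgn, sgn, ← pow_add]
  exact neg_one_pow_congr (by simp only [Nat.even_iff]; omega)

lemma sgn_neg (n : ℤ) : sgn (-n) = sgn n := by rw [sgn, sgn, Int.natAbs_neg]

lemma sgn_one : sgn 1 = -1 := rfl

lemma sgn_natCast (n : ℕ) : sgn n = (-1) ^ n := rfl

lemma bOp_anticomm_sgn (i j : ℤ) (f : Gam) : bOp i (bOp j f) + bOp j (bOp i f) =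
    if i + j = 0 then (2 * sgn i) • f else 0 := by
  rw [bOp_anticomm]
  split_ifs
  · rw [zsmul_eq_mul, sgn]; push_cast; rfl
  · rfl

/-- The functional `f ↦` constant term of `B_{-μ_l} ⋯ B_{-μ_1} f`, which is up to sign and
scalar the coordinate of `Q_μ`. -/
def dual : List ℕ → Gam →ₗ[ℤ] ℤ
  | [] => constTerm.toAddMonoidHom.toIntLinearMap
  | n :: L => dual L ∘ₗ bOp (-n)

lemma dual_cons (n : ℕ) (L : List ℕ) (f : Gam) : dual (n :: L) f = dual L (bOp (-n) f) := rfl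

lemma dual_nil (f : Gam) : dual [] f = constTerm f := rfl

lemma constTerm_bOp_of_pos {n : ℤ} (hn : 0 < n) (f : Gam) : constTerm (bOp n f) = 0 := by
  obtain ⟨N, hN⟩ := exists_mem_degLE f
  rw [bOp, normal_apply _ _ hN, map_sum]
  refine Finset.sum_eq_zero fun i _ => ?_
  simp only [map_mul, constTerm_q]
  rw [if_neg (by omega)]
  simp

lemma constTerm_bOp_zero (f : Gam) : constTerm (bOp 0 f) = constTerm f := by
  obtain ⟨N, hN⟩ := exists_mem_degLE f
  rw [bOp, normal_apply _ _ hN, map_sum, Finset.sum_range_succ', Finset.sum_eq_zero]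
  · simp [q_zero, del_zero]
  · intro i _
    simp only [map_mul, constTerm_q]
    rw [if_neg (by positivity)]
    simp

lemma dual_bOp_of_notMem {n : ℕ} (hn : 0 < n) {L : List ℕ} (hL : n ∉ L) (f : Gam) :
    dual L (bOp n f) = 0 := by
  induction L generalizing f with
  | nil => exact constTerm_bOp_of_pos (by exact_mod_cast hn) f
  | cons a L ih =>
    rw [List.mem_cons, not_or] at hL
    rw [dual_cons, bOp_swap (by omega), map_neg, ih hL.2, neg_zero]

lemma bOp_neg_word_of_notMem {n : ℕ} (hn : 0 < n) {L : List ℕ} (hL : n ∉ L) :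
    bOp (-n) (word L) = 0 := by
  induction L with
  | nil => exact bOp_neg_one (by omega)
  | cons a L ih =>
    rw [List.mem_cons, not_or] at hL
    change bOp (-n) (bOp a (word L)) = 0
    rw [bOp_swap (by omega), ih hL.2, map_zero, neg_zero]

/-- The sign `(-1)^{|λ|}`. -/
def sgnList (L : List ℕ) : ℤ := sgn (L.map (Nat.cast : ℕ → ℤ)).sum

lemma sgnList_cons (n : ℕ) (L : List ℕ) : sgnList (n :: L) = sgn n * sgnList L := by
  rw [sgnList, List.map_cons, List.sum_cons, sgn_add]; rfl

lemma sgnList_mul_self (L : List ℕ) : sgnList L * sgnList L = 1 := sgn_mul_self _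

lemma notMem_of_isStrictBelow {M n : ℕ} {L : List ℕ} (h : IsStrictBelow M L) (hn : M ≤ n) :
    n ∉ L := fun hm => by
  have := (h.2 n hm).2
  omega

/-- The functionals `dual μ` are dual to the words of strict partitions. -/
lemma dual_word {M N : ℤ} {L K : List ℕ} (hL : IsStrictBelow M L) (hK : IsStrictBelow N K) :
    dual K (word L) = if L = K then sgnList L * 2 ^ L.length else 0 := by
  induction L generalizing M N K with
  | nil =>
    cases K with
    | nil => rw [if_pos rfl]; change constTerm 1 = _; rw [map_one]; rfl
    | cons b K =>
      have hb := (isStrictBelow_cons.1 hK).1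
      rw [if_neg (by simp), dual_cons]
      change dual K (bOp (-b) 1) = 0
      rw [bOp_neg_one (by omega), map_zero]
  | cons a L ih =>
    obtain ⟨ha, haM, hL'⟩ := isStrictBelow_cons.1 hL
    cases K with
    | nil =>
      rw [if_neg (by simp)]
      exact constTerm_bOp_of_pos (by exact_mod_cast ha) _
    | cons b K =>
      obtain ⟨hb, hbN, hK'⟩ := isStrictBelow_cons.1 hK
      rw [dual_cons]
      rcases lt_trichotomy a b with h | rfl | h
      · rw [bOp_neg_word_of_notMem hb, map_zero, if_neg]
        · rintro h1
          rw [List.cons.injEq] at h1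
          omega
        · rw [List.mem_cons, not_or]
          exact ⟨by omega, notMem_of_isStrictBelow hL' h.le⟩
      · have h1 := bOp_anticomm_sgn (-a) a (word L)
        rw [if_pos (by ring), bOp_neg_word_of_notMem ha (notMem_of_isStrictBelow hL' le_rfl),
          map_zero, add_zero] at h1
        change dual K (bOp (-a) (bOp a (word L))) = _
        rw [h1, map_zsmul, ih hL' hK', sgn_neg, sgnList_cons, List.length_cons]
        by_cases hLK : L = K
        · rw [if_pos hLK, if_pos (by rw [hLK]), smul_eq_mul]; ring
        · rw [if_neg hLK, if_neg (by simpa using hLK), smul_zero]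
      · change dual K (bOp (-b) (bOp a (word L))) = _
        rw [bOp_swap (by omega), map_neg, dual_bOp_of_notMem ha, neg_zero, if_neg]
        · rintro h1
          rw [List.cons.injEq] at h1
          omega
        · exact notMem_of_isStrictBelow hK' h.le

lemma StrictPartition.isStrictBelow (lam : StrictPartition) :
    ∃ M, IsStrictBelow M lam.parts := by
  refine ⟨(lam.parts.sum : ℤ) + 1, lam.strict, fun x hx => ⟨lam.pos x hx, ?_⟩⟩
  have := List.le_sum_of_mem hx
  omega

open Classical in
lemma dual_schurQ (lam mu : StrictPartition) : dual mu.parts (schurQ lam) =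
    if lam = mu then sgnList lam.parts * 2 ^ lam.length else 0 := by
  obtain ⟨M, hM⟩ := lam.isStrictBelow
  obtain ⟨N, hN⟩ := mu.isStrictBelow
  rw [schurQ_eq_word, dual_word hM hN]
  exact if_congr (StrictPartition.ext_iff).symm rfl rfl

/-- The words span by straightening, and the functionals `dual μ` show that they are independent. -/
lemma schurQIsBasis : SchurQIsBasis := by
  classical
  refine ⟨?_, top_le_span_schurQ⟩
  rw [linearIndependent_iff]
  intro c hc
  ext mu
  have h := congrArg (dual mu.parts) hc
  rw [map_zero, Finsupp.linearCombination_apply, Finsupp.sum, map_sum] at h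
  simp only [map_smul, dual_schurQ, smul_eq_mul, mul_ite, mul_zero] at h
  rw [Finset.sum_ite_eq'] at h
  by_cases hmu : mu ∈ c.support
  · rw [if_pos hmu] at h
    have h2 : sgnList mu.parts ≠ 0 := fun h0 => by
      have := sgnList_mul_self mu.parts
      rw [h0] at this; simp at this
    have h3 : (2 : ℤ) ^ mu.length ≠ 0 := by positivity
    rcases mul_eq_zero.1 h with h | h
    · exact h
    · exact absurd h (mul_ne_zero h2 h3)
  · simpa using hmu

/-! ### The adjoint operators -/

/-- The basis of Schur `Q`-functions. -/
def basisQ : Module.Basis StrictPartition ℤ Gam := Module.Basis.mk schurQIsBasis.1 schurQIsBasis.2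

lemma basisQ_apply (lam : StrictPartition) : basisQ lam = schurQ lam :=
  Module.Basis.mk_apply _ _ _

lemma form_schurQ (lam : StrictPartition) (f : Gam) :
    form (schurQ lam) f = sgnList lam.parts * dual lam.parts f := by
  classical
  have h1 : form (schurQ lam) = (2 : ℤ) ^ lam.length • basisQ.coord lam := by
    rw [form, dif_pos schurQIsBasis, ← basisQ_apply]
    exact basisQ.constr_basis ℤ _ lam
  have h2 : form (schurQ lam) = sgnList lam.parts • dual lam.parts := by
    refine basisQ.ext fun mu => ?_
    rw [h1, LinearMap.smul_apply, LinearMap.smul_apply, Module.Basis.coord_apply,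
      Module.Basis.repr_self, basisQ_apply, dual_schurQ, Finsupp.single_apply]
    by_cases h : mu = lam
    · rw [if_pos h, if_pos h, smul_eq_mul, smul_eq_mul, ← mul_assoc, h, sgnList_mul_self]; ring
    · rw [if_neg h, if_neg h, smul_zero, smul_zero]
  rw [h2]; rfl

lemma form_word {M : ℤ} {L : List ℕ} (hL : IsStrictBelow M L) (f : Gam) :
    form (word L) f = sgnList L * dual L f := by
  have := form_schurQ ⟨L, hL.1, fun x hx => (hL.2 x hx).1⟩ f
  rwa [schurQ_eq_word] at this

lemma form_one (f : Gam) : form 1 f = constTerm f := by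
  have := form_word (M := 0) (L := []) ⟨List.Pairwise.nil, by simp⟩ f
  rw [show word [] = 1 from rfl, dual_nil, show sgnList [] = 1 from rfl, one_mul] at this
  exact this

lemma form_nondegenerate {f g : Gam} (h : ∀ x, form f x = form g x) : f = g := by
  classical
  have h0 : ∀ lam : StrictPartition, basisQ.repr f lam * 2 ^ lam.length =
      basisQ.repr g lam * 2 ^ lam.length := by
    have key : ∀ (f : Gam) (lam : StrictPartition),
        form f (schurQ lam) = basisQ.repr f lam * 2 ^ lam.length := by
      intro f lam
      have : form.flip (schurQ lam) = (2 : ℤ) ^ lam.length • basisQ.coord lam := by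
        refine basisQ.ext fun mu => ?_
        rw [LinearMap.flip_apply, basisQ_apply, form_schurQ, dual_schurQ, LinearMap.smul_apply,
          Module.Basis.coord_apply, ← basisQ_apply, Module.Basis.repr_self, Finsupp.single_apply]
        by_cases h : lam = mu
        · rw [if_pos h, if_pos h.symm, h, ← mul_assoc, sgnList_mul_self, smul_eq_mul]; ring
        · rw [if_neg h, if_neg (Ne.symm h), mul_zero, smul_zero]
      have h2 := LinearMap.congr_fun this f
      rw [LinearMap.flip_apply] at h2
      rw [h2, mul_comm]; rfl
    intro lam
    rw [← key, ← key, h]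
  refine basisQ.repr.injective (Finsupp.ext fun lam => ?_)
  exact mul_right_cancel₀ (by positivity) (h0 lam)

/-- `B_n` and `(-1)^n B_{-n}` are adjoint, on a word. -/
lemma form_bOp_word {M : ℤ} {L : List ℕ} (hL : IsStrictBelow M L) (n : ℤ) (x : Gam) :
    form (bOp n (word L)) x = sgn n * form (word L) (bOp (-n) x) := by
  induction L generalizing M n x with
  | nil =>
    change form (bOp n 1) x = sgn n * form 1 (bOp (-n) x)
    rw [form_one]
    rcases lt_trichotomy n 0 with h | rfl | h
    · rw [bOp_neg_one h, constTerm_bOp_of_pos (by omega)]; simp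
    · rw [bOp_one, q_zero, neg_zero, constTerm_bOp_zero, form_one]
      rw [show sgn 0 = 1 from rfl, one_mul]
    · lift n to ℕ using h.le
      have := form_word (M := n + 1) (L := [n]) (isStrictBelow_cons.2
        ⟨by exact_mod_cast h, by omega, List.Pairwise.nil, by simp⟩) x
      rw [sgnList_cons, show sgnList [] = 1 from rfl, mul_one, dual_cons, dual_nil] at this
      exact this
  | cons a L ih =>
    obtain ⟨ha, haM, hL'⟩ := isStrictBelow_cons.1 hL
    have hform : ∀ x, form (word (a :: L)) x = sgn a * form (word L) (bOp (-a) x) := by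
      intro x
      rw [form_word hL, form_word hL', sgnList_cons, dual_cons]; ring
    rcases lt_trichotomy n a with h | rfl | h
    · -- move `B_n` past `B_a`
      have hz : ∀ z ∈ strictSpan a, ∀ x, form (bOp a z) x = sgn a * form z (bOp (-a) x) := by
        intro z hz x
        induction hz using Submodule.span_induction with
        | mem z hz =>
          obtain ⟨K, hK, rfl⟩ := hz
          rw [show bOp a (word K) = word (a :: K) from rfl, form_word hK,
            form_word (isStrictBelow_cons.2 ⟨ha, haM, hK⟩), sgnList_cons, dual_cons]
          ring
        | zero => simp
        | add y z _ _ hy hz =>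
          simp only [map_add, LinearMap.add_apply, hy, hz]; ring
        | smul c y _ hy =>
          simp only [map_smul, LinearMap.smul_apply, hy, smul_eq_mul]; ring
      have h1 := bOp_anticomm_sgn n a (word L)
      have h2 := bOp_anticomm_sgn (-n) (-a) x
      have h3 : form (bOp n (bOp a (word L))) x + form (bOp a (bOp n (word L))) x =
          form (if n + (a : ℤ) = 0 then (2 * sgn n) • word L else 0) x := by
        rw [← h1, map_add, LinearMap.add_apply]
      have h4 : form (word L) (bOp (-n) (bOp (-a) x)) + form (word L) (bOp (-a) (bOp (-n) x)) =
          form (word L) (if -n + -(a : ℤ) = 0 then (2 * sgn (-n)) • x else 0) := by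
        rw [← h2, map_add]
      rw [hz _ (bOp_word_mem_strictSpan hL' h), ih hL'] at h3
      rw [hform]
      change form (bOp n (bOp a (word L))) x = _
      by_cases h0 : n + (a : ℤ) = 0
      · rw [if_pos h0, map_smul, LinearMap.smul_apply, smul_eq_mul] at h3
        rw [if_pos (by omega), map_smul, smul_eq_mul, sgn_neg] at h4
        have hs : sgn a = sgn n := by
          rw [show (a : ℤ) = -n by omega, sgn_neg]
        have := sgn_mul_self n
        rw [hs] at h3 ⊢
        linear_combination h3 - sgn n * sgn n * h4 -
          2 * sgn n * form (word L) x * this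
      · rw [if_neg h0, map_zero, LinearMap.zero_apply] at h3
        rw [if_neg (by omega), map_zero] at h4
        linear_combination h3 - sgn a * sgn n * h4
    · rw [hform, bOp_sq (by omega)]
      change form (bOp a (bOp a (word L))) x = _
      rw [bOp_sq (by omega)]
      simp
    · lift n to ℕ using by omega
      have := form_word (L := n :: a :: L) (isStrictBelow_cons.2
        ⟨by omega, (by omega : (n : ℤ) < n + 1), isStrictBelow_cons.2 ⟨ha, h, hL'⟩⟩) x
      rw [sgnList_cons, dual_cons, mul_assoc, ← form_word hL] at this
      exact this

lemma word_induction {p : Gam → Prop} (hadd : ∀ f g, p f → p g → p (f + g))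
    (hzero : p 0) (hsmul : ∀ (c : ℤ) f, p f → p (c • f))
    (hword : ∀ L M, IsStrictBelow M L → p (word L)) (f : Gam) : p f := by
  have hf : f ∈ allSpan := by rw [allSpan_eq_top]; trivial
  induction hf using Submodule.span_induction with
  | mem x hx =>
    obtain ⟨L, ⟨M, hL⟩, rfl⟩ := hx
    exact hword L M hL
  | zero => exact hzero
  | add x y _ _ hx hy => exact hadd x y hx hy
  | smul c x _ hx => exact hsmul c x hx

/-- `B_n` and `(-1)^n B_{-n}` are adjoint. -/
lemma form_bOp (n : ℤ) (g x : Gam) : form (bOp n g) x = sgn n * form g (bOp (-n) x) := by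
  refine word_induction (p := fun g => form (bOp n g) x = sgn n * form g (bOp (-n) x))
    ?_ ?_ ?_ ?_ g
  · intro f g hf hg
    simp only [map_add, LinearMap.add_apply, hf, hg]; ring
  · simp
  · intro c f hf
    simp only [map_smul, LinearMap.smul_apply, hf, smul_eq_mul]; ring
  · intro L M hL
    exact form_bOp_word hL n x

/-- The adjoint of `q_k` is `D_k`: both sides of the adjunction satisfy the same recursion when
the first argument is a word and `B_n` is moved across the form. -/
lemma isPerp_q_del (k : ℤ) : IsPerp (q k) (del k) := by
  have step : ∀ g : Gam, (∀ k x, form (del k g) x = form g (q k * x)) →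
      ∀ N : ℕ, ∀ k < (N : ℤ), ∀ n x, form (del k (bOp n g)) x = form (bOp n g) (q k * x) := by
    intro g hg N
    induction N with
    | zero =>
      intro k hk n x
      rw [q_neg (by simpa using hk), del_neg (by simpa using hk)]; simp
    | succ N ih =>
      intro k hk n x
      have h1 := ih (k - 1) (by push_cast at hk; omega) (n - 1) x
      have h2 := congrArg (fun y => form y x) (del_bOp k n g)
      have h3 := congrArg (form g) (bOp_q_mul (-n + 1) k x)
      rw [add_sub_cancel_right] at h3
      simp only [map_sub, map_add, LinearMap.sub_apply, LinearMap.add_apply] at h2 h3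
      rw [form_bOp, show -(n - 1) = -n + 1 by ring] at h1
      rw [form_bOp n (del k g), form_bOp (n - 1) (del (k - 1) g), hg, hg,
        show -(n - 1) = -n + 1 by ring] at h2
      rw [form_bOp]
      have hs : sgn (n - 1) = -sgn n := by
        rw [sub_eq_add_neg, sgn_add, sgn_neg, sgn_one]; ring
      rw [hs] at h1 h2
      linear_combination h2 + h1 - sgn n * h3
  intro g
  have key : ∀ k x, form (del k g) x = form g (q k * x) := by
    refine word_induction (p := fun g => ∀ k x, form (del k g) x = form g (q k * x)) ?_ ?_ ?_ ?_ g
    · intro f g hf hg k x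
      simp only [map_add, LinearMap.add_apply, hf, hg]
    · simp
    · intro c f hf k x
      simp only [map_smul, LinearMap.smul_apply, hf]
    · intro L M hL
      clear hL
      induction L with
      | nil =>
        intro k x
        change form (del k 1) x = form 1 (q k * x)
        rw [del_one, form_one, map_mul, constTerm_q]
        by_cases h : k = 0
        · rw [if_pos h, if_pos h, form_one, one_mul]
        · rw [if_neg h, if_neg h]; simp
      | cons a L ih =>
        intro k x
        exact step (word L) ih (k.toNat + 1) k (by omega) a x
  exact key k

lemma IsPerp.unique {f : Gam} {S T : Module.End ℤ Gam} (hS : IsPerp f S) (hT : IsPerp f T) :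
    S = T :=
  LinearMap.ext fun g => form_nondegenerate fun x => by rw [hS, hT]

lemma isPerp_one : IsPerp 1 1 := fun g x => by rw [one_mul]; rfl

lemma IsPerp.mul {f g : Gam} {S T : Module.End ℤ Gam} (hS : IsPerp f S) (hT : IsPerp g T) :
    IsPerp (f * g) (S * T) := fun a x => by
  rw [Module.End.mul_apply, hS, hT, ← mul_assoc, mul_comm g f]

lemma IsPerp.add {f g : Gam} {S T : Module.End ℤ Gam} (hS : IsPerp f S) (hT : IsPerp g T) :
    IsPerp (f + g) (S + T) := fun a x => by
  rw [LinearMap.add_apply, map_add, LinearMap.add_apply, hS, hT, add_mul, map_add]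

lemma isPerp_zero : IsPerp 0 0 := fun a x => by simp

/-- Adjoints exist for the `q_n`, hence for sums and products of these. -/
lemma exists_isPerp (f : Gam) : ∃ T, IsPerp f T := by
  let W : Submodule ℤ Gam :=
    { carrier := {f | ∃ T, IsPerp f T}
      zero_mem' := ⟨0, isPerp_zero⟩
      add_mem' := fun ⟨S, hS⟩ ⟨T, hT⟩ => ⟨S + T, hS.add hT⟩
      smul_mem' := fun c f ⟨T, hT⟩ => ⟨c • T, fun a x => by
        have e : c • f * x = c • (f * x) := by rw [zsmul_eq_mul, zsmul_eq_mul, mul_assoc]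
        rw [e, map_zsmul, ← hT]
        change form (c • (T a)) x = _
        rw [map_zsmul]; rfl⟩ }
  have hW : W = ⊤ := submodule_eq_top ⟨1, isPerp_one⟩
    fun n f ⟨T, hT⟩ => ⟨del n * T, (isPerp_q_del n).mul hT⟩
  have : f ∈ W := by rw [hW]; trivial
  exact this

lemma isPerp_perp (f : Gam) : IsPerp f (perp f) := by
  rw [perp, dif_pos (exists_isPerp f)]
  exact (exists_isPerp f).choose_spec

lemma perp_q (n : ℤ) : perp (q n) = del n := (isPerp_perp _).unique (isPerp_q_del n)

/-- `f ↦ f^⊥` is a homomorphism of rings. -/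
def perpHom : Gam →+* Module.End ℤ Gam where
  toFun := perp
  map_one' := (isPerp_perp _).unique isPerp_one
  map_mul' f g := (isPerp_perp _).unique ((isPerp_perp f).mul (isPerp_perp g))
  map_zero' := (isPerp_perp _).unique isPerp_zero
  map_add' f g := (isPerp_perp _).unique ((isPerp_perp f).add (isPerp_perp g))

lemma termB_eq (n : ℤ) : termB n = normTerm n 1 := by
  funext i
  rw [termB, normTerm, perp_q, mul_one]

lemma locallyFinite_termB (n : ℤ) : LocallyFinite (termB n) := by
  rw [termB_eq]; exact locallyFinite_normTerm n 1

lemma opB_eq (n : ℤ) : opB n = bOp n := by rw [opB, termB_eq]; rfl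

/-! ### Polynomials acting on families indexed by integer vectors -/

section Action

variable {ι : Type} [DecidableEq ι] {V W : Type*} [AddCommGroup V] [AddCommGroup W]

/-- Laurent polynomials in variables `x_i`, `i ∈ ι`. -/
abbrev LPoly (ι : Type) : Type := AddMonoidAlgebra ℤ (ι → ℤ)

/-- The variable `x_i`. -/
def lX (i : ι) : LPoly ι := AddMonoidAlgebra.single (Pi.single i 1) 1

/-- Translation of families `h : (ι → ℤ) → V`. -/
def translate (ι : Type) (V : Type*) [AddCommGroup V] :
    Multiplicative (ι → ℤ) →* Module.End ℤ ((ι → ℤ) → V) where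
  toFun v :=
    { toFun := fun h n => h (n - v.toAdd)
      map_add' := fun _ _ => rfl
      map_smul' := fun _ _ => rfl }
  map_one' := by ext h n; simp
  map_mul' u v := by
    ext h n
    change h (n - (u.toAdd + v.toAdd)) = h (n - u.toAdd - v.toAdd)
    rw [sub_sub]

/-- A family `h` stands for the series `∑_n h_n x^n`, and Laurent polynomials act by
multiplication. -/
def act (ι : Type) (V : Type*) [AddCommGroup V] :
    LPoly ι →ₐ[ℤ] Module.End ℤ ((ι → ℤ) → V) :=
  AddMonoidAlgebra.lift ℤ _ _ (translate ι V)

lemma act_lX (i : ι) (h : (ι → ℤ) → V) (n : ι → ℤ) :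
    act ι V (lX i) h n = h (n - Pi.single i 1) := by
  have : act ι V (lX i) = (1 : ℤ) • translate ι V (.ofAdd (Pi.single i 1)) :=
    AddMonoidAlgebra.lift_single _ _ _
  rw [this, one_smul]; rfl

lemma act_lX_pow (i : ι) (k : ℕ) (h : (ι → ℤ) → V) (n : ι → ℤ) :
    act ι V (lX i ^ k) h n = h (n - Pi.single i (k : ℤ)) := by
  induction k generalizing n with
  | zero => simp
  | succ k ih =>
    rw [pow_succ', map_mul, Module.End.mul_apply, act_lX, ih]
    congr 1
    rw [sub_sub, ← Pi.single_add, Nat.cast_succ, add_comm]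

lemma act_mul (p r : LPoly ι) (h : (ι → ℤ) → V) : act ι V (p * r) h = act ι V p (act ι V r h) := by
  rw [map_mul]; rfl

/-- A property of families that is stable under sums, negation and translations is stable under
the action of Laurent polynomials. -/
lemma act_induction {p : ((ι → ℤ) → V) → Prop} (hadd : ∀ g h, p g → p h → p (g + h))
    (hneg : ∀ g, p g → p (-g)) (hzero : p 0)
    (hshift : ∀ (v : ι → ℤ) g, p g → p fun n => g (n - v))
    (r : LPoly ι) {h : (ι → ℤ) → V} (hh : p h) : p (act ι V r h) := by
  induction r using AddMonoidAlgebra.induction_on with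
  | of v =>
    have : act ι V (AddMonoidAlgebra.of ℤ (ι → ℤ) (.ofAdd v)) =
        (1 : ℤ) • translate ι V (.ofAdd v) := AddMonoidAlgebra.lift_single _ _ _
    rw [this, one_smul]
    exact hshift v h hh
  | add x y hx hy => rw [map_add]; exact hadd _ _ hx hy
  | smul c x hx =>
    rw [map_smul]
    change p (c • act ι V x h)
    have hnat : ∀ k : ℕ, p (k • act ι V x h) := by
      intro k
      induction k with
      | zero => rw [zero_smul]; exact hzero
      | succ k ih => rw [succ_nsmul]; exact hadd _ _ ih hx
    obtain ⟨k, rfl | rfl⟩ := c.eq_nat_or_neg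
    · rw [natCast_zsmul]; exact hnat k
    · rw [neg_smul, natCast_zsmul]; exact hneg _ (hnat k)

/-- Additive maps commute with the action of Laurent polynomials. -/
lemma act_map (φ : V →+ W) (r : LPoly ι) (h : (ι → ℤ) → V) :
    act ι W r (fun n => φ (h n)) = fun n => φ (act ι V r h n) := by
  induction r using AddMonoidAlgebra.induction_on with
  | of v =>
    have h1 : act ι V (AddMonoidAlgebra.of ℤ (ι → ℤ) (.ofAdd v)) =
        (1 : ℤ) • translate ι V (.ofAdd v) := AddMonoidAlgebra.lift_single _ _ _
    have h2 : act ι W (AddMonoidAlgebra.of ℤ (ι → ℤ) (.ofAdd v)) =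
        (1 : ℤ) • translate ι W (.ofAdd v) := AddMonoidAlgebra.lift_single _ _ _
    rw [h1, h2, one_smul, one_smul]
    rfl
  | add x y hx hy =>
    funext n
    rw [map_add, map_add]
    simp only [LinearMap.add_apply, Pi.add_apply, map_add, hx, hy]
  | smul c x hx =>
    funext n
    rw [map_smul, map_smul]
    simp only [LinearMap.smul_apply, Pi.smul_apply, map_zsmul, hx]

/-- The Laurent polynomials in the variables other than `x_i`. -/
def without (i : ι) : Subalgebra ℤ (LPoly ι) := Algebra.adjoin ℤ {x | ∃ j, j ≠ i ∧ x = lX j}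

lemma lX_mem_without {i j : ι} (h : j ≠ i) : lX j ∈ without i :=
  Algebra.subset_adjoin ⟨j, h, rfl⟩

/-- Additive maps that depend on the index `n i` only commute with the action of the variables
other than `x_i`. -/
lemma act_map_coord {i : ι} {r : LPoly ι} (hr : r ∈ without i) (φ : ℤ → V →+ W)
    (h : (ι → ℤ) → V) :
    act ι W r (fun n => φ (n i) (h n)) = fun n => φ (n i) (act ι V r h n) := by
  induction hr using Algebra.adjoin_induction generalizing h with
  | mem x hx =>
    obtain ⟨j, hj, rfl⟩ := hx
    funext n
    rw [act_lX, act_lX]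
    simp [hj.symm]
  | algebraMap c =>
    funext n
    rw [AlgHom.commutes, AlgHom.commutes]
    simp
  | add x y _ _ hx hy =>
    funext n
    rw [map_add, map_add]
    simp only [LinearMap.add_apply, Pi.add_apply, map_add, hx, hy]
  | mul x y _ _ hx hy => rw [act_mul, act_mul, hy, hx]

/-- The product of `F i j` over all pairs of a list, `i` before `j`. -/
def pairProd (F : ι → ι → LPoly ι) : List ι → LPoly ι
  | [] => 1
  | i :: l => (l.map (F i)).prod * pairProd F l

lemma pairProd_cons (F : ι → ι → LPoly ι) (i : ι) (l : List ι) :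
    pairProd F (i :: l) = (l.map (F i)).prod * pairProd F l := rfl

lemma pairProd_mul (F F' : ι → ι → LPoly ι) (l : List ι) :
    pairProd (fun i j => F i j * F' i j) l = pairProd F l * pairProd F' l := by
  induction l with
  | nil => simp [pairProd]
  | cons i l ih => rw [pairProd_cons, pairProd_cons, pairProd_cons, ih, List.prod_map_mul]; ring

lemma map_prod_mem_without {k i : ι} {l : List ι} {F : ι → ι → LPoly ι}
    (hF : ∀ i j, i ≠ k → j ≠ k → F i j ∈ without k) (hi : i ≠ k) (hl : k ∉ l) :
    (l.map (F i)).prod ∈ without k := by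
  refine Subalgebra.list_prod_mem _ fun x hx => ?_
  obtain ⟨j, hj, rfl⟩ := List.mem_map.1 hx
  exact hF i j hi fun h => hl (h ▸ hj)

lemma pairProd_mem_without {k : ι} {l : List ι} {F : ι → ι → LPoly ι}
    (hF : ∀ i j, i ≠ k → j ≠ k → F i j ∈ without k) (hl : k ∉ l) : pairProd F l ∈ without k := by
  induction l with
  | nil => exact one_mem _
  | cons i l ih =>
    rw [List.mem_cons, not_or] at hl
    exact mul_mem (map_prod_mem_without hF (Ne.symm hl.1) hl.2) (ih hl.2)

lemma lX_add_mem (k i j : ι) (hi : i ≠ k) (hj : j ≠ k) : lX i + lX j ∈ without k :=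
  add_mem (lX_mem_without hi) (lX_mem_without hj)

lemma lX_sub_mem (k i j : ι) (hi : i ≠ k) (hj : j ≠ k) : lX i - lX j ∈ without k :=
  sub_mem (lX_mem_without hi) (lX_mem_without hj)

end Action

/-! ### Products and normally ordered products of vertex operators -/

section Products

variable {ι : Type} [DecidableEq ι]

/-- The coefficients of the product `∏_i B(x_i)`, in the order of the list. -/
def prodB (l : List ι) (n : ι → ℤ) : Module.End ℤ Gam := (l.map fun i => bOp (n i)).prod

/-- The coefficients of the normally ordered product of the `B(x_i)` and a given operator. -/
def normalProd (l : List ι) (T : Module.End ℤ Gam) (n : ι → ℤ) : Module.End ℤ Gam :=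
  l.foldr (fun i T => normal (n i) T) T

lemma normal_add (n : ℤ) (S T : Module.End ℤ Gam) :
    normal n (S + T) = normal n S + normal n T := by
  refine LinearMap.ext fun f => ?_
  obtain ⟨N, hN⟩ := exists_mem_degLE f
  rw [LinearMap.add_apply, normal_apply _ _ hN, normal_apply _ _ hN, normal_apply _ _ hN,
    ← Finset.sum_add_distrib]
  refine Finset.sum_congr rfl fun i _ => ?_
  rw [LinearMap.add_apply]; ring

/-- Normal ordering as an additive map. -/
def normalHom (n : ℤ) : Module.End ℤ Gam →+ Module.End ℤ Gam :=
  AddMonoidHom.mk' (normal n) (normal_add n)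

lemma normalProd_cons (i : ι) (l : List ι) (T : Module.End ℤ Gam) (n : ι → ℤ) :
    normalProd (i :: l) T n = normal (n i) (normalProd l T n) := rfl

lemma prodB_cons (i : ι) (l : List ι) (n : ι → ℤ) :
    prodB (i :: l) n = bOp (n i) * prodB l n := by
  rw [prodB, List.map_cons, List.prod_cons]; rfl

lemma normalProd_normal (l : List ι) (T : Module.End ℤ Gam) (k : ℤ) (n : ι → ℤ) :
    normalProd l (normal k T) n = normal k (normalProd l T n) := by
  induction l with
  | nil => rfl
  | cons i l ih => rw [normalProd_cons, normalProd_cons, ih, normal_comm]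

lemma normalProd_congr {l : List ι} {T : Module.End ℤ Gam} {n n' : ι → ℤ}
    (h : ∀ i ∈ l, n i = n' i) : normalProd l T n = normalProd l T n' := by
  induction l with
  | nil => rfl
  | cons i l ih =>
    rw [normalProd_cons, normalProd_cons, h i List.mem_cons_self,
      ih fun j hj => h j (List.mem_cons_of_mem i hj)]

lemma prodB_congr {l : List ι} {n n' : ι → ℤ} (h : ∀ i ∈ l, n i = n' i) :
    prodB l n = prodB l n' := by
  rw [prodB, prodB]
  congr 1
  exact List.map_congr_left fun i hi => by rw [h i hi]

/-- `∏_j (x_i + x_j) B(x_i) :∏_j B(x_j): = ∏_j (x_i - x_j) :B(x_i) ∏_j B(x_j):`. -/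
lemma act_bOp_normalProd {i : ι} {l : List ι} (hl : l.Nodup) (hi : i ∉ l) :
    act ι (Module.End ℤ Gam) (l.map fun j => lX i + lX j).prod
        (fun n => bOp (n i) * normalProd l 1 n) =
      act ι (Module.End ℤ Gam) (l.map fun j => lX i - lX j).prod (normalProd (i :: l) 1) := by
  have key : act ι (Module.End ℤ Gam) (l.map fun j => lX i + lX j).prod
        (fun n => bOp (n i) * normalProd l 1 n) =
      act ι (Module.End ℤ Gam) (l.map fun j => lX i - lX j).prod
        (fun n => normalProd l (bOp (n i)) n) := by
    induction l with
    | nil => simp [normalProd]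
    | cons j l ih =>
      rw [List.nodup_cons] at hl
      rw [List.mem_cons, not_or] at hi
      obtain ⟨hij, hil⟩ := hi
      have h1 : act ι (Module.End ℤ Gam) (lX i + lX j)
            (fun n => bOp (n i) * normalProd (j :: l) 1 n) =
          act ι (Module.End ℤ Gam) (lX i - lX j)
            (fun n => normalHom (n j) (bOp (n i) * normalProd l 1 n)) := by
        funext n
        rw [map_add, map_sub]
        simp only [LinearMap.add_apply, LinearMap.sub_apply, Pi.add_apply, Pi.sub_apply, act_lX]
        have e1 : normalProd l 1 (n - Pi.single i 1) = normalProd l 1 n :=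
          normalProd_congr fun k hk => by
            have : k ≠ i := fun h => hil (h ▸ hk)
            simp [this]
        have e2 : normalProd l 1 (n - Pi.single j 1) = normalProd l 1 n :=
          normalProd_congr fun k hk => by
            have : k ≠ j := fun h => hl.1 (h ▸ hk)
            simp [this]
        rw [normalProd_cons, normalProd_cons, e1, e2]
        simp only [Pi.sub_apply, Pi.single_eq_same, Pi.single_eq_of_ne hij,
          Pi.single_eq_of_ne (Ne.symm hij), sub_zero]
        exact bOp_normal (n i) (n j) (normalProd l 1 n)
      rw [List.map_cons, List.prod_cons, List.map_cons, List.prod_cons, mul_comm, act_mul, h1,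
        ← act_mul, mul_comm, act_mul, act_map_coord, ih hl.2 hil, act_mul,
        ← act_map_coord (φ := normalHom)]
      · rfl
      · exact map_prod_mem_without (lX_sub_mem j) hij hl.1
      · exact map_prod_mem_without (lX_add_mem j) hij hl.1
  rw [key]
  congr 1
  funext n
  rw [bOp, normalProd_normal]
  rfl

/-- `∏_{i<j} (x_i + x_j) ∏_i B(x_i) = ∏_{i<j} (x_i - x_j) :∏_i B(x_i):`. -/
lemma act_prodB {l : List ι} (hl : l.Nodup) :
    act ι (Module.End ℤ Gam) (pairProd (fun i j => lX i + lX j) l) (prodB l) =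
      act ι (Module.End ℤ Gam) (pairProd (fun i j => lX i - lX j) l) (normalProd l 1) := by
  induction l with
  | nil => rfl
  | cons i l ih =>
    rw [List.nodup_cons] at hl
    have h1 : prodB (i :: l) = fun n => AddMonoidHom.mulLeft (bOp (n i)) (prodB l n) := by
      funext n
      exact prodB_cons i l n
    rw [pairProd_cons, act_mul, h1, act_map_coord (φ := fun k => AddMonoidHom.mulLeft (bOp k))
      (pairProd_mem_without (lX_add_mem i) hl.1), ih hl.2,
      ← act_map_coord (φ := fun k => AddMonoidHom.mulLeft (bOp k))
      (pairProd_mem_without (lX_sub_mem i) hl.1), ← act_mul, mul_comm, act_mul]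
    have h2 := act_bOp_normalProd hl.2 hl.1
    change act ι (Module.End ℤ Gam) _ (act ι (Module.End ℤ Gam) (l.map fun j => lX i + lX j).prod
      (fun n => bOp (n i) * normalProd l 1 n)) = _
    rw [h2, ← act_mul, mul_comm]
    rfl

/-- The polynomial `(x_i^m + x_j^m) / (x_i + x_j)`, for odd `m`. -/
def cofactor (m : ℕ) (i j : ι) : LPoly ι :=
  ∑ s ∈ range m, lX i ^ s * (-lX j) ^ (m - 1 - s)

lemma cofactor_mul {m : ℕ} (hm : Odd m) (i j : ι) :
    cofactor m i j * (lX i + lX j) = lX i ^ m + lX j ^ m := by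
  have := geom_sum₂_mul (lX i) (-lX j) m
  rw [sub_neg_eq_add, hm.neg_pow, sub_neg_eq_add] at this
  exact this

/-- `∏_{i<j} (x_i^m + x_j^m)`. -/
def clear (m : ℕ) (l : List ι) : LPoly ι := pairProd (fun i j => lX i ^ m + lX j ^ m) l

/-- `∏_{i<j} (x_i^m + x_j^m) (x_i - x_j) / (x_i + x_j)`. -/
def vander (m : ℕ) (l : List ι) : LPoly ι :=
  pairProd (fun i j => cofactor m i j * (lX i - lX j)) l

/-- Multiplication by `∏_{i<j} (x_i^m + x_j^m)` removes the poles of `∏_i B(x_i)` at the points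
`x_i^m = -x_j^m`. -/
lemma act_clear_prodB {m : ℕ} (hm : Odd m) {l : List ι} (hl : l.Nodup) :
    act ι (Module.End ℤ Gam) (clear m l) (prodB l) =
      act ι (Module.End ℤ Gam) (vander m l) (normalProd l 1) := by
  have h1 : clear m l = pairProd (cofactor m) l * pairProd (fun i j => lX i + lX j) l := by
    rw [← pairProd_mul, clear]
    simp only [cofactor_mul hm]
  rw [h1, act_mul, act_prodB hl, ← act_mul, ← pairProd_mul]
  rfl

end Products

/-! ### Summation over residue classes -/

section DiagSum

variable {m : ℕ} [NeZero m] {V W : Type*} [AddCommGroup V] [AddCommGroup W]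

/-- The vectors `n` that are supported on `l` and satisfy `n_ρ ≡ ρ` for `ρ ∈ l`: residue classes
modulo `m` serve both as names of variables and as prescribed residues. -/
def IsRes (l : List (ZMod m)) (n : ZMod m → ℤ) : Prop :=
  (∀ ρ ∈ l, (n ρ : ZMod m) = ρ) ∧ ∀ ρ ∉ l, n ρ = 0

/-- The vectors with prescribed residues and coordinate sum `d`. -/
def resSet (l : List (ZMod m)) (d : ℤ) : Set (ZMod m → ℤ) := {n | IsRes l n ∧ ∑ ρ, n ρ = d}

/-- The coefficient of `u^d` of the part of `∑ g_n x^n` with prescribed residues, after all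
variables have been set equal to `u`. -/
def diagSum (l : List (ZMod m)) (g : (ZMod m → ℤ) → V) (d : ℤ) : V := ∑ᶠ n ∈ resSet l d, g n

/-- All sums `diagSum l g d` are finite. -/
def DiagFinite (l : List (ZMod m)) (g : (ZMod m → ℤ) → V) : Prop :=
  ∀ d, (resSet l d ∩ Function.support g).Finite

lemma finite_setOf_le_sum_eq {ι : Type*} [Fintype ι] (K d : ℤ) :
    {n : ι → ℤ | (∀ i, K ≤ n i) ∧ ∑ i, n i = d}.Finite := by
  classical
  refine (Set.finite_Icc (fun _ : ι => K) fun _ => d - Fintype.card ι * K + K).subset ?_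
  rintro n ⟨h1, h2⟩
  refine ⟨h1, fun i => ?_⟩
  have h3 := Finset.single_le_sum (f := fun i => n i - K)
    (fun i _ => sub_nonneg.2 (h1 i)) (Finset.mem_univ i)
  rw [Finset.sum_sub_distrib, h2, Finset.sum_const, Finset.card_univ, nsmul_eq_mul] at h3
  linarith

lemma diagFinite_of_le {l : List (ZMod m)} {g : (ZMod m → ℤ) → V} (K : ℤ)
    (h : ∀ n, IsRes l n → g n ≠ 0 → ∀ ρ ∈ l, K ≤ n ρ) : DiagFinite l g := by
  intro d
  refine (finite_setOf_le_sum_eq (min K 0) d).subset ?_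
  rintro n ⟨⟨h1, h2⟩, h3⟩
  refine ⟨fun ρ => ?_, h2⟩
  by_cases hρ : ρ ∈ l
  · exact (min_le_left _ _).trans (h n h1 h3 ρ hρ)
  · rw [h1.2 ρ hρ]; exact min_le_right _ _

lemma DiagFinite.add {l : List (ZMod m)} {g h : (ZMod m → ℤ) → V} (hg : DiagFinite l g)
    (hh : DiagFinite l h) : DiagFinite l (g + h) := fun d => by
  refine ((hg d).union (hh d)).subset ?_
  rintro n ⟨h1, h2⟩
  rcases Function.support_add g h h2 with h3 | h3
  · exact Or.inl ⟨h1, h3⟩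
  · exact Or.inr ⟨h1, h3⟩

lemma DiagFinite.neg {l : List (ZMod m)} {g : (ZMod m → ℤ) → V} (hg : DiagFinite l g) :
    DiagFinite l (-g) := fun d => by
  rw [Function.support_neg]; exact hg d

lemma diagSum_add {l : List (ZMod m)} {g h : (ZMod m → ℤ) → V} (hg : DiagFinite l g)
    (hh : DiagFinite l h) (d : ℤ) : diagSum l (g + h) d = diagSum l g d + diagSum l h d :=
  finsum_mem_add_distrib' (hg d) (hh d)

lemma diagSum_neg (l : List (ZMod m)) (g : (ZMod m → ℤ) → V) (d : ℤ) :
    diagSum l (-g) d = -diagSum l g d := by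
  have : diagSum l (-g) d = ∑ᶠ n, -∑ᶠ (_ : n ∈ resSet l d), g n := by
    refine finsum_congr fun n => ?_
    rw [← finsum_neg_distrib]; rfl
  rw [this, finsum_neg_distrib]; rfl

lemma diagSum_congr {l : List (ZMod m)} {g h : (ZMod m → ℤ) → V}
    (hgh : ∀ n, IsRes l n → g n = h n) (d : ℤ) : diagSum l g d = diagSum l h d :=
  finsum_mem_congr rfl fun n hn => hgh n hn.1

lemma DiagFinite.congr {l : List (ZMod m)} {g h : (ZMod m → ℤ) → V}
    (hgh : ∀ n, IsRes l n → g n = h n) (hg : DiagFinite l g) : DiagFinite l h := fun d => by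
  refine (hg d).subset ?_
  rintro n ⟨h1, h2⟩
  exact ⟨h1, by rw [Function.mem_support, hgh n h1.1]; exact h2⟩

lemma diagSum_map (φ : V →+ W) {l : List (ZMod m)} {g : (ZMod m → ℤ) → V} (hg : DiagFinite l g)
    (d : ℤ) : φ (diagSum l g d) = diagSum l (fun n => φ (g n)) d := by
  exact φ.map_finsum_mem' (hg d)

lemma isRes_sub_single {l : List (ZMod m)} {ρ : ZMod m} (hρ : ρ ∈ l) (n : ZMod m → ℤ) :
    IsRes l (n - Pi.single ρ (m : ℤ)) ↔ IsRes l n := by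
  constructor <;>
  · rintro ⟨h1, h2⟩
    constructor
    · intro σ hσ
      have := h1 σ hσ
      by_cases h : σ = ρ
      · subst h; simpa using this
      · simpa [h] using this
    · intro σ hσ
      have h : σ ≠ ρ := fun h => hσ (h ▸ hρ)
      simpa [h] using h2 σ hσ

lemma bijOn_sub_single {l : List (ZMod m)} {ρ : ZMod m} (hρ : ρ ∈ l) (d : ℤ) :
    Set.BijOn (fun n : ZMod m → ℤ => n - Pi.single ρ (m : ℤ)) (resSet l d)
      (resSet l (d - m)) := by
  refine ⟨?_, fun _ _ _ _ h => sub_left_injective h, ?_⟩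
  · rintro n ⟨h1, h2⟩
    refine ⟨(isRes_sub_single hρ n).2 h1, ?_⟩
    simp [Finset.sum_sub_distrib, h2]
  · rintro n ⟨h1, h2⟩
    refine ⟨n + Pi.single ρ (m : ℤ), ⟨?_, ?_⟩, by simp⟩
    · rw [← isRes_sub_single hρ]; simpa using h1
    · simp [Finset.sum_add_distrib, h2]

lemma diagSum_lX_pow {l : List (ZMod m)} {ρ : ZMod m} (hρ : ρ ∈ l) (g : (ZMod m → ℤ) → V)
    (d : ℤ) : diagSum l (act _ V (lX ρ ^ m) g) d = diagSum l g (d - m) :=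
  finsum_mem_eq_of_bijOn _ (bijOn_sub_single hρ d) fun n _ => act_lX_pow ρ m g n

lemma DiagFinite.lX_pow {l : List (ZMod m)} {ρ : ZMod m} (hρ : ρ ∈ l) {g : (ZMod m → ℤ) → V}
    (hg : DiagFinite l g) : DiagFinite l (act _ V (lX ρ ^ m) g) := fun d => by
  refine Set.Finite.of_injOn (f := fun n : ZMod m → ℤ => n - Pi.single ρ (m : ℤ)) ?_
    (fun _ _ _ _ h => sub_left_injective h) (hg (d - m))
  rintro n ⟨h1, h2⟩
  refine ⟨(bijOn_sub_single hρ d).mapsTo h1, ?_⟩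
  rwa [Function.mem_support, act_lX_pow] at h2

lemma DiagFinite.pair {l : List (ZMod m)} {ρ σ : ZMod m} (hρ : ρ ∈ l) (hσ : σ ∈ l)
    {g : (ZMod m → ℤ) → V} (hg : DiagFinite l g) :
    DiagFinite l (act _ V (lX ρ ^ m + lX σ ^ m) g) := by
  rw [map_add]; exact (hg.lX_pow hρ).add (hg.lX_pow hσ)

/-- On a diagonal sum, `x_ρ^m` acts as a shift of the degree by `m`, because a translation by `m`
does not alter residues. Hence `x_ρ^m + x_σ^m` acts as twice a shift. -/
lemma diagSum_pair {l : List (ZMod m)} {ρ σ : ZMod m} (hρ : ρ ∈ l) (hσ : σ ∈ l)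
    {g : (ZMod m → ℤ) → V} (hg : DiagFinite l g) (d : ℤ) :
    diagSum l (act _ V (lX ρ ^ m + lX σ ^ m) g) d = (2 : ℤ) • diagSum l g (d - m) := by
  rw [map_add]
  change diagSum l (act _ V (lX ρ ^ m) g + act _ V (lX σ ^ m) g) d = _
  rw [diagSum_add (hg.lX_pow hρ) (hg.lX_pow hσ), diagSum_lX_pow hρ, diagSum_lX_pow hσ, two_zsmul]

lemma diagSum_list {l : List (ZMod m)} {ρ : ZMod m} (hρ : ρ ∈ l) {k : List (ZMod m)}
    (hk : ∀ σ ∈ k, σ ∈ l) {g : (ZMod m → ℤ) → V} (hg : DiagFinite l g) (d : ℤ) :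
    DiagFinite l (act _ V (k.map fun σ => lX ρ ^ m + lX σ ^ m).prod g) ∧
    diagSum l (act _ V (k.map fun σ => lX ρ ^ m + lX σ ^ m).prod g) d =
      (2 : ℤ) ^ k.length • diagSum l g (d - m * k.length) := by
  induction k generalizing d with
  | nil => simpa using hg
  | cons σ k ih =>
    have hk' : ∀ σ ∈ k, σ ∈ l := fun τ hτ => hk τ (List.mem_cons_of_mem σ hτ)
    have hσ := hk σ List.mem_cons_self
    rw [List.map_cons, List.prod_cons, act_mul]
    refine ⟨(ih hk' d).1.pair hρ hσ, ?_⟩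
    rw [diagSum_pair hρ hσ (ih hk' d).1, (ih hk' (d - m)).2, smul_smul, List.length_cons, pow_succ',
      show d - (m : ℤ) - m * k.length = d - m * (k.length + 1 : ℕ) by push_cast; ring]

end DiagSum

lemma finsum_mem_prod {α β M : Type*} [AddCommMonoid M] {s : Set α} {t : Set β} {f : α × β → M}
    (hf : (s ×ˢ t ∩ Function.support f).Finite) :
    ∑ᶠ x ∈ s ×ˢ t, f x = ∑ᶠ a ∈ s, ∑ᶠ b ∈ t, f (a, b) := by
  classical
  rw [finsum_mem_def, finsum_curry]
  · rw [finsum_mem_def]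
    refine finsum_congr fun a => ?_
    by_cases ha : a ∈ s
    · rw [Set.indicator_of_mem ha, finsum_mem_def]
      refine finsum_congr fun b => ?_
      by_cases hb : b ∈ t
      · rw [Set.indicator_of_mem (Set.mk_mem_prod ha hb), Set.indicator_of_mem hb]
      · rw [Set.indicator_of_notMem (fun h => hb h.2), Set.indicator_of_notMem hb]
    · rw [Set.indicator_of_notMem ha]
      exact finsum_eq_zero_of_forall_eq_zero fun b => Set.indicator_of_notMem (fun h => ha h.1) _
  · rwa [Function.HasFiniteSupport, Set.support_indicator]

/-! ### The factors of the product -/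

lemma opBB_eq_zero {N : ℕ} {f : Gam} (hf : f ∈ degLE N) {i j : ℤ} (h : i < -N ∨ j < -N) :
    opBB i j f = 0 := by
  rw [opBB, opB_eq, opB_eq]
  split_ifs with h1 h2
  · rw [Module.End.mul_apply, bOp_eq_zero_of_lt hf (by omega : j < -N), map_zero]
  · rw [LinearMap.neg_apply, Module.End.mul_apply, bOp_eq_zero_of_lt hf (by omega : i < -N),
      map_zero, neg_zero]
  · rfl

/-- The operators `B_{i,j}`: products in which the larger index acts last. -/
lemma opBB_of_ne (i j : ℤ) (hij : i ≠ j) :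
    opBB i j = if j < i then bOp i * bOp j else -(bOp j * bOp i) := by
  rw [opBB, opB_eq, opB_eq]
  split_ifs with h1 h2
  · rfl
  · rfl
  · omega

/-- The pairs of indices of total degree `e` in the factor with residues `-l`, `l`. -/
def pairSet (m : ℕ) (l e : ℤ) : Set (ℤ × ℤ) :=
  {p | p.1 ≡ -l [ZMOD m] ∧ p.2 ≡ l [ZMOD m] ∧ p.1 + p.2 = e}

lemma finite_pairSet_inter (m : ℕ) (l e K : ℤ) :
    (pairSet m l e ∩ {p | K ≤ p.1 ∧ K ≤ p.2}).Finite := by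
  refine Set.Finite.of_injOn (f := Prod.fst) (t := Set.Icc K (e - K)) ?_ ?_ (Set.finite_Icc _ _)
  · rintro ⟨i, j⟩ ⟨⟨-, -, h⟩, h1, h2⟩
    simp only at h h1 h2
    exact ⟨h1, by simp only; omega⟩
  · rintro ⟨i, j⟩ ⟨⟨-, -, h⟩, -⟩ ⟨i', j'⟩ ⟨⟨-, -, h'⟩, -⟩ hi
    simp only at h h' hi
    rw [Prod.mk.injEq]
    exact ⟨hi, by omega⟩

lemma locallyFinite_pairTerm (m : ℕ) (l d : ℤ) : LocallyFinite (pairTerm m l d) := by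
  intro f
  obtain ⟨N, hN⟩ := exists_mem_degLE f
  refine Set.Finite.of_injOn (f := Subtype.val) ?_ Subtype.val_injective.injOn
    (finite_pairSet_inter m l d (-N))
  rintro ⟨p, hp⟩ h0
  refine ⟨hp, ?_⟩
  by_contra hlt
  refine h0 (opBB_eq_zero hN ?_)
  rw [Set.mem_ofPred_eq, not_and_or, not_le, not_le] at hlt
  exact hlt

/-- The coefficients of a factor, the summand `1` being attached to the indices `-l`, `l`. -/
def pairC (l i j : ℤ) : Module.End ℤ Gam := opBB i j + if i = -l ∧ j = l then 1 else 0

/-- Attaching the summand `1` to the pair `(-l, l)`, which has the required residues and total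
degree `0`, turns a factor into a single sum. -/
lemma pairFactor_apply (m : ℕ) (l e : ℤ) (f : Gam) :
    pairFactor m l e f = ∑ᶠ p ∈ pairSet m l e, pairC l p.1 p.2 f := by
  classical
  have h1 : opSum (pairTerm m l e) f = ∑ᶠ p ∈ pairSet m l e, opBB p.1 p.2 f := by
    rw [opSum_apply (locallyFinite_pairTerm m l e)]
    exact finsum_set_coe_eq_finsum_mem (f := fun p : ℤ × ℤ => opBB p.1 p.2 f) (pairSet m l e)
  have h2 : (if e = 0 then (1 : Module.End ℤ Gam) else 0) f = ∑ᶠ p ∈ pairSet m l e,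
      (if p.1 = -l ∧ p.2 = l then (1 : Module.End ℤ Gam) else 0) f := by
    by_cases he : e = 0
    · rw [if_pos he, finsum_eq_single _ (-l, l)]
      · rw [finsum_eq_if, if_pos, if_pos ⟨rfl, rfl⟩]
        exact ⟨Int.ModEq.refl _, Int.ModEq.refl _, by simp [he]⟩
      · rintro ⟨i, j⟩ hp
        rw [Ne, Prod.mk.injEq] at hp
        simp [hp]
    · rw [if_neg he]
      refine (finsum_mem_eq_zero_of_forall_eq_zero ?_).symm
      rintro ⟨i, j⟩ ⟨-, -, hp⟩
      simp only at hp ⊢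
      rw [if_neg (by omega)]; rfl
  have hfin : (pairSet m l e ∩ Function.support fun p => opBB p.1 p.2 f).Finite := by
    obtain ⟨N, hN⟩ := exists_mem_degLE f
    refine (finite_pairSet_inter m l e (-N)).subset ?_
    rintro p ⟨h1, h2⟩
    refine ⟨h1, ?_⟩
    by_contra h3
    refine h2 (opBB_eq_zero hN ?_)
    rw [Set.mem_ofPred_eq, not_and_or, not_le, not_le] at h3
    exact h3
  rw [pairFactor, LinearMap.add_apply, h1, h2, add_comm, ← finsum_mem_add_distrib' hfin]
  · rfl
  · refine (Set.finite_singleton (-l, l)).subset ?_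
    rintro ⟨i, j⟩ ⟨-, hp⟩
    by_contra h
    rw [Set.mem_singleton_iff, Prod.mk.injEq] at h
    refine hp ?_
    simp only
    rw [if_neg h]; rfl

/-! ### The residues of the factors -/

section ResList

variable {m : ℕ}

/-- The residues `-2(c+1), 2(c+1), …, -(m-1), m-1, 0` of the factors of `tailProduct m c`. -/
def resList (m c : ℕ) : List (ZMod m) :=
  (List.range' (c + 1) ((m - 1) / 2 - c)).foldr
    (fun k l => ((-(2 * k) : ℤ) : ZMod m) :: ((2 * k : ℤ) : ZMod m) :: l) [0]

lemma resList_of_le {c : ℕ} (h : (m - 1) / 2 ≤ c) : resList m c = [0] := by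
  rw [resList, Nat.sub_eq_zero_of_le h]; rfl

lemma tailProduct_of_le {c : ℕ} (h : (m - 1) / 2 ≤ c) : tailProduct m c = lastFactor m := by
  rw [tailProduct, Nat.sub_eq_zero_of_le h]; rfl

lemma range'_of_lt {c r : ℕ} (h : c < r) :
    List.range' (c + 1) (r - c) = (c + 1) :: List.range' (c + 1 + 1) (r - (c + 1)) := by
  rw [show r - c = (r - (c + 1)) + 1 by omega, List.range'_succ]

lemma resList_of_lt {c : ℕ} (h : c < (m - 1) / 2) :
    resList m c = ((-(2 * (c + 1 : ℕ)) : ℤ) : ZMod m) :: ((2 * (c + 1 : ℕ) : ℤ) : ZMod m) ::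
      resList m (c + 1) := by
  rw [resList, range'_of_lt h]; rfl

lemma tailProduct_of_lt {c : ℕ} (h : c < (m - 1) / 2) :
    tailProduct m c = mulSeries (pairFactor m (2 * ((c + 1 : ℕ) : ℤ))) (tailProduct m (c + 1)) := by
  rw [tailProduct, range'_of_lt h]; rfl

lemma two_mul_ne_zero (hm : Odd m) {x : ℤ} (hx : x ≠ 0) (h : |x| < m) :
    ((2 * x : ℤ) : ZMod m) ≠ 0 := by
  rw [Ne, ZMod.intCast_zmod_eq_zero_iff_dvd]
  intro hd
  have hc : IsCoprime (m : ℤ) 2 := by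
    rw [Int.isCoprime_iff_gcd_eq_one]
    simpa [Int.gcd] using Nat.Coprime.symm (Nat.coprime_two_left.2 hm)
  exact hx (Int.eq_zero_of_abs_lt_dvd (hc.dvd_of_dvd_mul_left hd) h)

lemma mem_resList (c : ℕ) {ρ : ZMod m} (h : ρ ∈ resList m c) :
    ∃ x : ℤ, ρ = ((2 * x : ℤ) : ZMod m) ∧ |x| ≤ ((m - 1) / 2 : ℕ) ∧ (x ≠ 0 → c < |x|) := by
  by_cases hc : (m - 1) / 2 ≤ c
  · rw [resList_of_le hc, List.mem_singleton] at h
    exact ⟨0, by simp [h], by rw [abs_zero]; positivity, fun h => absurd rfl h⟩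
  · rw [not_le] at hc
    rw [resList_of_lt hc, List.mem_cons, List.mem_cons] at h
    have h1 : |((c + 1 : ℕ) : ℤ)| = c + 1 := by
      rw [abs_of_nonneg (by positivity), Nat.cast_succ]
    rcases h with h | h | h
    · refine ⟨-(c + 1 : ℕ), by rw [h, mul_neg], ?_, fun _ => ?_⟩ <;>
        rw [abs_neg, h1]
      · exact_mod_cast hc
      · exact lt_add_one _
    · refine ⟨(c + 1 : ℕ), h, ?_, fun _ => ?_⟩ <;> rw [h1]
      · exact_mod_cast hc
      · exact lt_add_one _
    · obtain ⟨x, h1, h2, h3⟩ := mem_resList (c + 1) h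
      refine ⟨x, h1, h2, fun h4 => ?_⟩
      have := h3 h4
      push_cast at this
      omega
  termination_by (m - 1) / 2 - c

/-- The residues of a factor are not opposite to those of the later factors. -/
lemma add_ne_zero_of_mem_resList (hm : Odd m) {c : ℕ} (hc : 1 ≤ c) (hc' : c ≤ (m - 1) / 2)
    {ρ : ZMod m} (h : ρ ∈ resList m c) :
    ((2 * c : ℤ) : ZMod m) + ρ ≠ 0 ∧ ((-(2 * c) : ℤ) : ZMod m) + ρ ≠ 0 := by
  obtain ⟨x, rfl, h1, h2⟩ := mem_resList c h
  have hm0 : 0 < m := hm.pos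
  have h4 : |(c : ℤ) + x| < m ∧ |(-(c : ℤ)) + x| < m := by
    have h5 : ((c : ℕ) : ℤ) ≤ ((m - 1) / 2 : ℕ) := by exact_mod_cast hc'
    rw [abs_le] at h1
    constructor <;> rw [abs_lt] <;> constructor <;> omega
  have h6 : x ≠ c ∧ x ≠ -c := by
    constructor <;> rintro rfl <;> simp at h2 <;> omega
  rw [← Int.cast_add, ← Int.cast_add, show (2 * c + 2 * x : ℤ) = 2 * (c + x) by ring,
    show (-(2 * c) + 2 * x : ℤ) = 2 * (-c + x) by ring]
  exact ⟨two_mul_ne_zero hm (by omega) h4.1, two_mul_ne_zero hm (by omega) h4.2⟩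

lemma two_mul_ne_neg (hm : Odd m) {c : ℕ} (hc : 1 ≤ c) (hc' : c ≤ (m - 1) / 2) :
    ((-(2 * c) : ℤ) : ZMod m) ≠ ((2 * c : ℤ) : ZMod m) := by
  have hm0 : 0 < m := hm.pos
  intro h
  refine two_mul_ne_zero hm (x := c + c) (by omega) ?_ ?_
  · rw [abs_lt]; constructor <;> omega
  · rw [show (2 * ((c : ℤ) + c)) = 2 * c - -(2 * c) by ring, Int.cast_sub, h, sub_self]

lemma notMem_resList (hm : Odd m) {c : ℕ} (hc : 1 ≤ c) (hc' : c ≤ (m - 1) / 2) :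
    ((-(2 * c) : ℤ) : ZMod m) ∉ resList m c ∧ ((2 * c : ℤ) : ZMod m) ∉ resList m c := by
  constructor <;> intro h
  · exact (add_ne_zero_of_mem_resList hm hc hc' h).1 (by push_cast; ring)
  · exact (add_ne_zero_of_mem_resList hm hc hc' h).2 (by push_cast; ring)

lemma nodup_resList (hm : Odd m) (c : ℕ) : (resList m c).Nodup := by
  by_cases hc : (m - 1) / 2 ≤ c
  · rw [resList_of_le hc]; exact List.nodup_singleton _
  · rw [not_le] at hc
    obtain ⟨h1, h2⟩ := notMem_resList hm (Nat.succ_pos c) hc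
    rw [resList_of_lt hc, List.nodup_cons, List.nodup_cons, List.mem_cons, not_or]
    exact ⟨⟨two_mul_ne_neg hm (Nat.succ_pos c) hc, h1⟩, h2, nodup_resList hm (c + 1)⟩
  termination_by (m - 1) / 2 - c

lemma length_resList (c : ℕ) : (resList m c).length = 2 * ((m - 1) / 2 - c) + 1 := by
  by_cases hc : (m - 1) / 2 ≤ c
  · rw [resList_of_le hc, Nat.sub_eq_zero_of_le hc]; rfl
  · rw [not_le] at hc
    rw [resList_of_lt hc, List.length_cons, List.length_cons, length_resList (c + 1)]
    omega
  termination_by (m - 1) / 2 - c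

lemma mem_resList_zero [NeZero m] (hm : Odd m) (ρ : ZMod m) : ρ ∈ resList m 0 := by
  have h1 : (resList m 0).toFinset = Finset.univ := by
    refine Finset.eq_univ_of_card _ ?_
    rw [List.toFinset_card_of_nodup (nodup_resList hm 0), length_resList, ZMod.card]
    obtain ⟨k, rfl⟩ := hm
    omega
  rw [← List.mem_toFinset, h1]
  exact Finset.mem_univ ρ

/-- The number of pairs of entries. -/
def npairs {α : Type*} : List α → ℕ
  | [] => 0
  | _ :: l => l.length + npairs l

end ResList

/-! ### Supports -/

section Support

variable {m : ℕ} [NeZero m]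

/-- The coefficients of `∏_{i<j} (x_i^m + x_j^m) ∏_i B(x_i)`. -/
def clearB (m : ℕ) [NeZero m] (l : List (ZMod m)) : (ZMod m → ℤ) → Module.End ℤ Gam :=
  act _ (Module.End ℤ Gam) (clear m l) (prodB l)

lemma normalProd_eq_zero {l : List (ZMod m)} {N : ℕ} {f : Gam} (hf : f ∈ degLE N)
    {n : ZMod m → ℤ} {ρ : ZMod m} (hρ : ρ ∈ l) (hn : n ρ < -N) : normalProd l 1 n f = 0 := by
  induction l generalizing f with
  | nil => simp at hρ
  | cons σ l ih =>
    rw [normalProd_cons, normal_apply _ _ hf]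
    refine Finset.sum_eq_zero fun i hi => ?_
    rw [Finset.mem_range] at hi
    rcases List.mem_cons.1 hρ with rfl | h
    · rw [q_neg (by omega), zero_mul, mul_zero]
    · rw [ih (del_mem_degLE hf i) h, mul_zero, mul_zero]

/-- The coefficients of the cleared product are supported in an orthant. -/
lemma exists_le_of_clearB_ne_zero (hm : Odd m) {l : List (ZMod m)} (hl : l.Nodup) (f : Gam) :
    ∃ K : ℤ, ∀ n, clearB m l n f ≠ 0 → ∀ ρ ∈ l, K ≤ n ρ := by
  rw [clearB, act_clear_prodB hm hl]
  refine act_induction (p := fun h : (ZMod m → ℤ) → Module.End ℤ Gam =>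
    ∃ K : ℤ, ∀ n, h n f ≠ 0 → ∀ ρ ∈ l, K ≤ n ρ) ?_ ?_ ?_ ?_ _ ?_
  · rintro g h ⟨K, hK⟩ ⟨L, hL⟩
    refine ⟨min K L, fun n hn ρ hρ => ?_⟩
    by_cases h0 : g n f = 0
    · refine (min_le_right _ _).trans (hL n (fun h1 => hn ?_) ρ hρ)
      rw [Pi.add_apply, LinearMap.add_apply, h0, h1, add_zero]
    · exact (min_le_left _ _).trans (hK n h0 ρ hρ)
  · rintro g ⟨K, hK⟩
    refine ⟨K, fun n hn => hK n fun h1 => hn ?_⟩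
    rw [Pi.neg_apply, LinearMap.neg_apply, h1, neg_zero]
  · exact ⟨0, fun n hn => absurd rfl hn⟩
  · rintro v g ⟨K, hK⟩
    refine ⟨K - ∑ ρ, |v ρ|, fun n hn ρ hρ => ?_⟩
    have h1 := hK _ hn ρ hρ
    rw [Pi.sub_apply] at h1
    have h2 := Finset.single_le_sum (f := fun ρ => |v ρ|) (fun ρ _ => abs_nonneg (v ρ))
      (Finset.mem_univ ρ)
    have h3 := neg_abs_le (v ρ)
    linarith
  · obtain ⟨N, hN⟩ := exists_mem_degLE f
    refine ⟨-N, fun n hn ρ hρ => ?_⟩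
    by_contra h
    exact hn (normalProd_eq_zero hN hρ (not_le.1 h))

lemma diagFinite_clearB (hm : Odd m) {l : List (ZMod m)} (hl : l.Nodup) (f : Gam) :
    DiagFinite l fun n => clearB m l n f := by
  obtain ⟨K, hK⟩ := exists_le_of_clearB_ne_zero hm hl f
  exact diagFinite_of_le K fun n _ hn => hK n hn

lemma clear_cons (i : ZMod m) (l : List (ZMod m)) :
    clear m (i :: l) = (l.map fun σ => lX i ^ m + lX σ ^ m).prod * clear m l := rfl

/-- A property that is stable under sums and under the action of the `x_ρ^m` is stable under the
action of the clearing polynomial. -/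
lemma act_clear_induction {V : Type*} [AddCommGroup V] {l : List (ZMod m)}
    {p : ((ZMod m → ℤ) → V) → Prop} (hadd : ∀ g h, p g → p h → p (g + h))
    (hshift : ∀ ρ ∈ l, ∀ g, p g → p (act _ V (lX ρ ^ m) g)) {h : (ZMod m → ℤ) → V} (hh : p h) :
    p (act _ V (clear m l) h) := by
  have h1 : ∀ ρ ∈ l, ∀ k : List (ZMod m), (∀ σ ∈ k, σ ∈ l) → ∀ g, p g →
      p (act _ V (k.map fun σ => lX ρ ^ m + lX σ ^ m).prod g) := by
    intro ρ hρ k hk g hg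
    induction k with
    | nil => simpa using hg
    | cons σ k ih =>
      rw [List.map_cons, List.prod_cons, act_mul, map_add]
      have := ih fun τ hτ => hk τ (List.mem_cons_of_mem _ hτ)
      exact hadd _ _ (hshift _ hρ _ this) (hshift _ (hk σ List.mem_cons_self) _ this)
  have h2 : ∀ k : List (ZMod m), (∀ σ ∈ k, σ ∈ l) → p (act _ V (clear m k) h) := by
    intro k hk
    induction k with
    | nil => simpa [clear, pairProd] using hh
    | cons σ k ih =>
      rw [clear_cons, act_mul]
      have hk' : ∀ τ ∈ k, τ ∈ l := fun τ hτ => hk τ (List.mem_cons_of_mem _ hτ)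
      exact h1 σ (hk σ List.mem_cons_self) k hk' _ (ih hk')
  exact h2 l fun σ hσ => hσ

lemma bOp_prodB {y : ℤ} {f : Gam} (hf : bOp y f = 0) {l : List (ZMod m)} {n : ZMod m → ℤ}
    (h : ∀ ρ ∈ l, y + n ρ ≠ 0) : bOp y (prodB l n f) = 0 := by
  induction l with
  | nil => simpa [prodB] using hf
  | cons ρ l ih =>
    rw [prodB_cons, Module.End.mul_apply, bOp_swap (h ρ List.mem_cons_self),
      ih fun σ hσ => h σ (List.mem_cons_of_mem _ hσ), map_zero, neg_zero]

/-- `B_y` anticommutes with the coefficients that have the prescribed residues, provided `y` is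
not opposite to any of these. -/
lemma bOp_clearB {y : ℤ} {f : Gam} (hf : bOp y f = 0) {l : List (ZMod m)}
    (h : ∀ ρ ∈ l, (y : ZMod m) + ρ ≠ 0) {n : ZMod m → ℤ} (hn : ∀ ρ ∈ l, (n ρ : ZMod m) = ρ) :
    bOp y (clearB m l n f) = 0 := by
  refine act_clear_induction (p := fun g : (ZMod m → ℤ) → Module.End ℤ Gam =>
    ∀ n : ZMod m → ℤ, (∀ ρ ∈ l, (n ρ : ZMod m) = ρ) → bOp y (g n f) = 0) ?_ ?_ ?_ n hn
  · intro g g' hg hg' n hn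
    rw [Pi.add_apply, LinearMap.add_apply, map_add, hg n hn, hg' n hn, add_zero]
  · intro ρ hρ g hg n hn
    rw [act_lX_pow]
    refine hg _ fun σ hσ => ?_
    have := hn σ hσ
    by_cases h : σ = ρ
    · subst h; simpa using this
    · simpa [h] using this
  · intro n hn
    refine bOp_prodB hf fun ρ hρ h0 => h ρ hρ ?_
    rw [← hn ρ hρ, ← Int.cast_add, h0, Int.cast_zero]

lemma clearB_congr {l : List (ZMod m)} {n n' : ZMod m → ℤ} (h : ∀ ρ ∈ l, n ρ = n' ρ) :
    clearB m l n = clearB m l n' := by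
  refine act_induction (p := fun g : (ZMod m → ℤ) → Module.End ℤ Gam =>
    ∀ n n' : ZMod m → ℤ, (∀ ρ ∈ l, n ρ = n' ρ) → g n = g n') ?_ ?_ ?_ ?_ _ ?_ n n' h
  · intro g g' hg hg' n n' h
    rw [Pi.add_apply, Pi.add_apply, hg n n' h, hg' n n' h]
  · intro g hg n n' h
    rw [Pi.neg_apply, Pi.neg_apply, hg n n' h]
  · intro n n' _; rfl
  · intro v g hg n n' h
    exact hg _ _ fun ρ hρ => by rw [Pi.sub_apply, Pi.sub_apply, h ρ hρ]
  · intro n n' h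
    exact prodB_congr h

end Support

/-! ### The product of one factor with the later ones -/

lemma finsum_fiberwise {α β M : Type*} [AddCommMonoid M] {s : Set α} {g : α → β} {f : α → M}
    (hf : (s ∩ Function.support f).Finite) :
    ∑ᶠ b, ∑ᶠ a ∈ s ∩ {a | g a = b}, f a = ∑ᶠ a ∈ s, f a := by
  classical
  have h1 : ∀ b, ∑ᶠ a ∈ s ∩ {a | g a = b}, f a = ∑ a ∈ hf.toFinset with g a = b, f a := by
    intro b
    refine finsum_mem_eq_sum_of_inter_support_eq _ ?_
    ext a
    simp only [Set.mem_inter_iff, Set.mem_ofPred_eq, Finset.coe_filter, Set.Finite.mem_toFinset]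
    tauto
  rw [finsum_congr h1, finsum_mem_eq_sum_of_inter_support_eq (t := hf.toFinset) f (by ext; simp),
    finsum_eq_sum_of_support_subset (s := hf.toFinset.image g)]
  · exact Finset.sum_fiberwise_of_maps_to (fun a ha => Finset.mem_image_of_mem g ha) f
  · intro b hb
    obtain ⟨a, ha, -⟩ := Finset.exists_ne_zero_of_sum_ne_zero hb
    rw [Finset.mem_filter] at ha
    exact Finset.mem_coe.2 (Finset.mem_image.2 ⟨a, ha⟩)

section Step

variable {m : ℕ} [NeZero m]

/-- A vector with prescribed residues decomposes into its coordinates at `a` and `b` and a vector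
that is supported on the remaining residues. -/
lemma bijOn_cons_cons {a b : ZMod m} {l : List (ZMod m)} {c : ℤ} (ha : ((-c : ℤ) : ZMod m) = a)
    (hb : (c : ZMod m) = b) (hab : a ≠ b) (hal : a ∉ l) (hbl : b ∉ l) (e D : ℤ) :
    Set.BijOn (fun x : (ZMod m → ℤ) × (ℤ × ℤ) => x.1 + Pi.single a x.2.1 + Pi.single b x.2.2)
      (resSet l (D - e) ×ˢ pairSet m c e)
      (resSet (a :: b :: l) D ∩ {n | n a + n b = e}) := by
  have hba := hab.symm
  have hmod : ∀ x y : ℤ, x ≡ y [ZMOD m] ↔ (x : ZMod m) = y := fun x y =>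
    (ZMod.intCast_eq_intCast_iff x y m).symm
  refine ⟨?_, ?_, ?_⟩
  · rintro ⟨n, i, j⟩ ⟨⟨⟨h1, h2⟩, h3⟩, h4, h5, h6⟩
    simp only [hmod] at h1 h2 h3 h4 h5 h6
    refine ⟨⟨⟨fun σ hσ => ?_, fun σ hσ => ?_⟩, ?_⟩, ?_⟩
    · rw [List.mem_cons, List.mem_cons] at hσ
      by_cases hσa : σ = a
      · subst hσa; simpa [hab, h2 _ hal] using h4.trans ha
      by_cases hσb : σ = b
      · subst hσb; simpa [hba, h2 _ hbl] using h5.trans hb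
      simpa [hσa, hσb] using h1 σ (by tauto)
    · rw [List.mem_cons, List.mem_cons] at hσ
      push Not at hσ
      simp [hσ.1, hσ.2.1, h2 σ hσ.2.2]
    · simp [Finset.sum_add_distrib, h3]
      linarith
    · simp [hab, hba, h2 _ hal, h2 _ hbl, h6]
  · rintro ⟨n, i, j⟩ ⟨⟨⟨-, h2⟩, -⟩, -⟩ ⟨n', i', j'⟩ ⟨⟨⟨-, h2'⟩, -⟩, -⟩ h
    simp only at h h2 h2'
    have h3 := congrFun h a
    have h4 := congrFun h b
    simp only [Pi.add_apply, Pi.single_eq_same, Pi.single_eq_of_ne hab, Pi.single_eq_of_ne hba,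
      h2 a hal, h2 b hbl, h2' a hal, h2' b hbl, zero_add, add_zero] at h3 h4
    subst h3 h4
    simp only [Prod.mk.injEq, and_true]
    simpa using h
  · rintro n ⟨⟨⟨h1, h2⟩, h3⟩, h4⟩
    refine ⟨(n - Pi.single a (n a) - Pi.single b (n b), n a, n b), ⟨⟨⟨fun σ hσ => ?_,
      fun σ hσ => ?_⟩, ?_⟩, ?_, ?_, h4⟩, by simp only; abel⟩
    · have hσa : σ ≠ a := fun h => hal (h ▸ hσ)
      have hσb : σ ≠ b := fun h => hbl (h ▸ hσ)
      simpa [hσa, hσb] using h1 σ (by simp [hσ])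
    · by_cases hσa : σ = a
      · subst hσa; simp [hab]
      by_cases hσb : σ = b
      · subst hσb; simp [hba]
      simpa [hσa, hσb] using h2 σ (by simp [hσ, hσa, hσb])
    · simp only [Set.mem_ofPred_eq] at h4
      simp [Finset.sum_sub_distrib, h3]
      linarith
    · simp only [hmod]; rw [h1 a (by simp), ha]
    · simp only [hmod]; rw [h1 b (by simp), hb]

/-- The pair of generating variables of one factor, applied to the cleared product of the later
factors. -/
def pairClearB (c : ℤ) (l : List (ZMod m)) (f : Gam) (n : ZMod m → ℤ) : Gam :=
  pairC c (n ((-c : ℤ) : ZMod m)) (n (c : ZMod m)) (clearB m l n f)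

/-- The operator with the smaller index of a pair acts first. It anticommutes past the cleared
product, by `bOp_clearB`, and annihilates `f` if its index is very negative. -/
lemma diagFinite_pairClearB (hm : Odd m) {c : ℕ} (hc : 1 ≤ c) (hc' : c ≤ (m - 1) / 2) (f : Gam) :
    DiagFinite (((-(2 * c) : ℤ) : ZMod m) :: ((2 * c : ℤ) : ZMod m) :: resList m c)
      (pairClearB (2 * c) (resList m c) f) := by
  obtain ⟨K, hK⟩ := exists_le_of_clearB_ne_zero hm (nodup_resList hm c) f
  obtain ⟨N, hN⟩ := exists_mem_degLE f
  refine diagFinite_of_le (min K (min (-N) (-(2 * c)))) fun n hn h0 => ?_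
  have h1 : clearB m (resList m c) n f ≠ 0 := by
    intro h1; rw [pairClearB, h1, map_zero] at h0; exact h0 rfl
  have hna := hn.1 _ (List.mem_cons_self)
  have hnb := hn.1 _ (List.mem_cons_of_mem _ List.mem_cons_self)
  have hnr : ∀ ρ ∈ resList m c, (n ρ : ZMod m) = ρ := fun ρ hρ =>
    hn.1 ρ (List.mem_cons_of_mem _ (List.mem_cons_of_mem _ hρ))
  have hkill : ∀ y : ℤ, ((y : ZMod m) = ((2 * c : ℤ) : ZMod m) ∨
      (y : ZMod m) = ((-(2 * c) : ℤ) : ZMod m)) → y < -N →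
      bOp y (clearB m (resList m c) n f) = 0 := by
    intro y hy hyN
    refine bOp_clearB (bOp_eq_zero_of_lt hN hyN) (fun ρ hρ => ?_) hnr
    rcases hy with hy | hy <;> rw [hy]
    · exact (add_ne_zero_of_mem_resList hm hc hc' hρ).1
    · exact (add_ne_zero_of_mem_resList hm hc hc' hρ).2
  have hpair : min (-N : ℤ) (-(2 * c)) ≤ n ((-(2 * c) : ℤ) : ZMod m) ∧
      min (-N : ℤ) (-(2 * c)) ≤ n ((2 * c : ℤ) : ZMod m) := by
    set i := n ((-(2 * c) : ℤ) : ZMod m)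
    set j := n ((2 * c : ℤ) : ZMod m)
    by_contra hlt
    refine h0 ?_
    change pairC _ i j _ = 0
    rw [pairC, if_neg (by omega), add_zero, opBB, opB_eq, opB_eq]
    split_ifs with h2 h3
    · rw [Module.End.mul_apply, hkill j (Or.inl hnb) (by omega), map_zero]
    · rw [LinearMap.neg_apply, Module.End.mul_apply, hkill i (Or.inr hna) (by omega), map_zero,
        neg_zero]
    · rfl
  intro ρ hρ
  rcases List.mem_cons.1 hρ with rfl | hρ
  · exact (min_le_right _ _).trans hpair.1
  rcases List.mem_cons.1 hρ with rfl | hρ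
  · exact (min_le_right _ _).trans hpair.2
  · exact (min_le_left _ _).trans (hK n h1 ρ hρ)

/-- The product of the factors from the `(c + 1)`-st on is, up to a power of `2` and a shift of
degree, the selection of the monomials with prescribed residues in
`∏_{i<j} (x_i^m + x_j^m) ∏_i B(x_i)`, with all variables set equal. Each of the `npairs` factors
`x_i^m + x_j^m` then becomes `2 u^m`. -/
def IsClearing (m : ℕ) [NeZero m] (c : ℕ) : Prop :=
  ∀ (d : ℤ) (f : Gam), (2 : ℤ) ^ npairs (resList m c) • tailProduct m c d f =
    diagSum (resList m c) (fun n => clearB m (resList m c) n f) (d + m * npairs (resList m c))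

/-- Each term of the product of one factor with the later ones is a sum over the vectors in which
the two indices of the factor have a prescribed sum. -/
lemma IsClearing.pairFactor_apply (hm : Odd m) {c : ℕ} (hc : 1 ≤ c) (hc' : c ≤ (m - 1) / 2)
    (h : IsClearing m c) (d e : ℤ) (f : Gam) :
    (2 : ℤ) ^ npairs (resList m c) • pairFactor m (2 * c) e (tailProduct m c (d - e) f) =
      ∑ᶠ n ∈ resSet (((-(2 * c) : ℤ) : ZMod m) :: ((2 * c : ℤ) : ZMod m) :: resList m c)
          (d + m * npairs (resList m c)) ∩
        {n | n ((-(2 * c) : ℤ) : ZMod m) + n ((2 * c : ℤ) : ZMod m) = e},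
      pairClearB (2 * c) (resList m c) f n := by
  obtain ⟨hal, hbl⟩ := notMem_resList hm hc hc'
  have hbij := bijOn_cons_cons rfl rfl (two_mul_ne_neg hm hc hc') hal hbl e
    (d + m * npairs (resList m c))
  have hfin := diagFinite_pairClearB hm hc hc' f (d + m * npairs (resList m c))
  have hval : ∀ x : (ZMod m → ℤ) × (ℤ × ℤ), x ∈ resSet (resList m c)
      (d + m * npairs (resList m c) - e) ×ˢ pairSet m (2 * c) e →
      pairC (2 * c) x.2.1 x.2.2 (clearB m (resList m c) x.1 f) =
      pairClearB (2 * c) (resList m c) f (x.1 + Pi.single ((-(2 * c) : ℤ) : ZMod m) x.2.1 +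
        Pi.single ((2 * c : ℤ) : ZMod m) x.2.2) := by
    rintro ⟨n, i, j⟩ ⟨⟨h1, -⟩, -⟩
    have hab := two_mul_ne_neg hm hc hc'
    have hab' := hab.symm
    have h0 : ∀ ρ ∉ resList m c, n ρ = 0 := h1.2
    simp only
    set v : ZMod m → ℤ := n + Pi.single ((-(2 * c) : ℤ) : ZMod m) i +
      Pi.single ((2 * c : ℤ) : ZMod m) j with hv
    have e1 : v ((-(2 * c) : ℤ) : ZMod m) = i := by
      rw [hv, Pi.add_apply, Pi.add_apply, h0 _ hal, Pi.single_eq_same, Pi.single_eq_of_ne hab]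
      simp
    have e2 : v ((2 * c : ℤ) : ZMod m) = j := by
      rw [hv, Pi.add_apply, Pi.add_apply, h0 _ hbl, Pi.single_eq_same, Pi.single_eq_of_ne hab']
      simp
    have e3 : clearB m (resList m c) n = clearB m (resList m c) v := by
      refine clearB_congr fun ρ hρ => ?_
      have h2 : ρ ≠ ((-(2 * c) : ℤ) : ZMod m) := fun h => hal (h ▸ hρ)
      have h3 : ρ ≠ ((2 * c : ℤ) : ZMod m) := fun h => hbl (h ▸ hρ)
      rw [hv, Pi.add_apply, Pi.add_apply, Pi.single_eq_of_ne h2, Pi.single_eq_of_ne h3, add_zero,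
        add_zero]
    rw [pairClearB, e1, e2, e3]
  have hmap := diagSum_map (pairFactor m (2 * c) e).toAddMonoidHom
    (diagFinite_clearB hm (nodup_resList hm c) f) (d - e + m * npairs (resList m c))
  simp only [LinearMap.toAddMonoidHom_coe] at hmap
  rw [← map_zsmul, h, hmap,
    ← finsum_mem_eq_of_bijOn _ hbij hval, finsum_mem_prod]
  · rw [diagSum, show d - e + m * npairs (resList m c) = d + m * npairs (resList m c) - e by ring]
    refine finsum_mem_congr rfl fun n _ => ?_
    exact SchurQ.pairFactor_apply m (2 * c) e _
  · refine Set.Finite.of_injOn (f := fun x : (ZMod m → ℤ) × (ℤ × ℤ) =>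
      x.1 + Pi.single ((-(2 * c) : ℤ) : ZMod m) x.2.1 + Pi.single ((2 * c : ℤ) : ZMod m) x.2.2)
      ?_ (hbij.injOn.mono Set.inter_subset_left) hfin
    rintro x ⟨h1, h2⟩
    refine ⟨(hbij.mapsTo h1).1, ?_⟩
    rw [Function.mem_support] at h2 ⊢
    rwa [← hval x h1]

lemma IsClearing.locallyFinite (hm : Odd m) {c : ℕ} (hc : 1 ≤ c) (hc' : c ≤ (m - 1) / 2)
    (h : IsClearing m c) (d : ℤ) :
    LocallyFinite (mulTerm (pairFactor m (2 * c)) (tailProduct m c) d) := by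
  intro f
  have hfin := diagFinite_pairClearB hm hc hc' f (d + m * npairs (resList m c))
  refine (hfin.image fun n => n ((-(2 * c) : ℤ) : ZMod m) + n ((2 * c : ℤ) : ZMod m)).subset ?_
  intro e he
  have h1 : (2 : ℤ) ^ npairs (resList m c) •
      pairFactor m (2 * c) e (tailProduct m c (d - e) f) ≠ 0 :=
    fun h0 => he (zsmul_eq_zero_gam (by positivity) h0)
  rw [h.pairFactor_apply hm hc hc'] at h1
  obtain ⟨n, ⟨hn1, hn2⟩, hn3⟩ := exists_ne_zero_of_finsum_mem_ne_zero h1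
  exact ⟨n, ⟨hn1, hn3⟩, hn2⟩

/-- Summation over the degree of the first factor. -/
lemma IsClearing.mulSeries_apply (hm : Odd m) {c : ℕ} (hc : 1 ≤ c) (hc' : c ≤ (m - 1) / 2)
    (h : IsClearing m c) (d : ℤ) (f : Gam) :
    (2 : ℤ) ^ npairs (resList m c) • mulSeries (pairFactor m (2 * c)) (tailProduct m c) d f =
      diagSum (((-(2 * c) : ℤ) : ZMod m) :: ((2 * c : ℤ) : ZMod m) :: resList m c)
        (pairClearB (2 * c) (resList m c) f) (d + m * npairs (resList m c)) := by
  have hfin := diagFinite_pairClearB hm hc hc' f (d + m * npairs (resList m c))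
  rw [mulSeries, opSum_apply (h.locallyFinite hm hc hc' d), diagSum, ← finsum_fiberwise hfin
    (g := fun n => n ((-(2 * c) : ℤ) : ZMod m) + n ((2 * c : ℤ) : ZMod m))]
  have h1 := (DistribSMul.toAddMonoidHom Gam ((2 : ℤ) ^ npairs (resList m c))).map_finsum
    (h.locallyFinite hm hc hc' d f)
  refine h1.trans (finsum_congr fun e => ?_)
  exact h.pairFactor_apply hm hc hc' d e f

end Step

/-! ### The product as a sum over residue classes -/

section Clearing

variable {m : ℕ}

lemma pairC_eq {i j : ℤ} (hij : i ≠ j) (l : ℤ) (g : Gam) :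
    pairC l i j g = bOp i (bOp j g) + (if i = -l ∧ j = l then g else 0) -
      (if i < j ∧ i + j = 0 then 2 * (-1) ^ i.natAbs * g else 0) := by
  have h1 := bOp_anticomm i j g
  have h2 : (if i = -l ∧ j = l then (1 : Module.End ℤ Gam) else 0) g =
      if i = -l ∧ j = l then g else 0 := by split_ifs <;> rfl
  rw [pairC, LinearMap.add_apply, h2, opBB_of_ne i j hij]
  by_cases h : j < i
  · rw [if_pos h, if_neg (fun h' : i < j ∧ i + j = 0 => by omega), Module.End.mul_apply, sub_zero]
  · have h3 : i < j := by omega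
    rw [if_neg h, LinearMap.neg_apply, Module.End.mul_apply]
    simp only [h3, true_and]
    linear_combination -h1

lemma neg_one_pow_natAbs_sub (hm : Odd m) (i : ℤ) :
    (-1 : Gam) ^ (i - m).natAbs = -(-1) ^ i.natAbs := by
  have hm' : Odd (m : ℤ) := by exact_mod_cast hm
  rcases Int.even_or_odd i with h | h
  · rw [Even.neg_one_pow (α := Gam) (Int.natAbs_even.2 h),
      Odd.neg_one_pow (α := Gam) (Int.natAbs_odd.2 (h.sub_odd hm'))]
  · rw [Odd.neg_one_pow (α := Gam) (Int.natAbs_odd.2 h),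
      Even.neg_one_pow (α := Gam) (Int.natAbs_even.2 (h.sub_odd hm'))]
    exact (neg_neg (1 : Gam)).symm

/-- The corrections that distinguish the coefficients of a factor from those of `B(x) B(y)` arise
from `B_i B_{-i} + B_{-i} B_i = ± 2` and alternate in sign along a residue class, as `m` is odd.
Multiplication by `x^m + y^m` turns them into `(y^m - x^m) x^{-2c} y^{2c}`, which vanishes for
`x = y`. -/
lemma pairC_step (hm : Odd m) {c : ℕ} (hc : 1 ≤ c) (hc' : c ≤ (m - 1) / 2) {i j : ℤ}
    (hi : (i : ZMod m) = ((-(2 * c) : ℤ) : ZMod m)) (hj : (j : ZMod m) = ((2 * c : ℤ) : ZMod m))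
    (g : Gam) :
    pairC (2 * c) (i - m) j g + pairC (2 * c) i (j - m) g =
      bOp (i - m) (bOp j g) + bOp i (bOp (j - m) g) +
      ((if i = -(2 * c) ∧ j - m = 2 * c then g else 0) -
        if i - m = -(2 * c) ∧ j = 2 * c then g else 0) := by
  have hab := two_mul_ne_neg hm hc hc'
  have h1 : i - m ≠ j := by
    intro h; apply hab; rw [← hi, ← hj, ← h]; push_cast; simp
  have h2 : i ≠ j - m := by
    intro h; apply hab; rw [← hi, ← hj, h]; push_cast; simp
  rw [pairC_eq h1, pairC_eq h2]
  by_cases hs : i + j = m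
  · obtain rfl : j = m - i := by omega
    rw [neg_one_pow_natAbs_sub hm]
    have hm0 := hm.pos
    by_cases hi0 : i < 0
    · rw [if_neg (fun h : i - m = -(2 * c) ∧ m - i = 2 * c => by omega),
        if_pos (show i - m < m - i ∧ i - m + (m - i) = 0 by omega),
        if_pos (show i < m - i - m ∧ i + (m - i - m) = 0 by omega)]
      ring
    by_cases him : i < m
    -- the only index in `[0, m)` with the residue `-2c` is `m - 2c`
    · have hd : (m : ℤ) ∣ i + 2 * c := by
        rw [← ZMod.intCast_zmod_eq_zero_iff_dvd, Int.cast_add, hi]; push_cast; ring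
      obtain ⟨k, hk⟩ := hd
      have hk1 : k = 1 := by
        have h3 : 0 < (m : ℤ) * k := by omega
        have h4 : (m : ℤ) * k < m * 2 := by omega
        have h5 : 0 < k := pos_of_mul_pos_right h3 (by omega)
        have h6 : k < 2 := lt_of_mul_lt_mul_left h4 (by omega)
        omega
      rw [hk1, mul_one] at hk
      have hodd : Odd i.natAbs := by
        have hm' : Odd (m : ℤ) := by exact_mod_cast hm
        rw [Int.natAbs_odd, show i = m - 2 * c by omega]
        exact hm'.sub_even (even_two_mul _)
      rw [if_pos (show i - m = -(2 * c) ∧ m - i = 2 * c by omega),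
        if_pos (show i - m < m - i ∧ i - m + (m - i) = 0 by omega),
        if_neg (fun h : i < m - i - m ∧ i + (m - i - m) = 0 => by omega),
        if_neg (fun h : i = -(2 * c) ∧ m - i - m = 2 * c => by omega),
        Odd.neg_one_pow (α := Gam) hodd]
      ring
    · rw [if_neg (fun h : i - m = -(2 * c) ∧ m - i = 2 * c => by omega),
        if_neg (fun h : i - m < m - i ∧ i - m + (m - i) = 0 => by omega),
        if_neg (fun h : i < m - i - m ∧ i + (m - i - m) = 0 => by omega)]
      ring
  · rw [if_neg (fun h : i - m = -(2 * c) ∧ j = 2 * c => by omega),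
      if_neg (fun h : i - m < j ∧ i - m + j = 0 => by omega),
      if_neg (fun h : i < j - m ∧ i + (j - m) = 0 => by omega),
      if_neg (fun h : i = -(2 * c) ∧ j - m = 2 * c => by omega)]
    ring

variable [NeZero m]

/-- Evaluation at `f`. -/
def evalHom (f : Gam) : Module.End ℤ Gam →+ Gam :=
  AddMonoidHom.mk' (fun T => T f) fun _ _ => rfl

/-- The clearing polynomial of `a :: b :: l` consists of the factors with `a` or `b` and that of
`l`; the latter commutes with `B(x_a) B(x_b)`. -/
lemma clearB_cons_cons {a b : ZMod m} {l : List (ZMod m)} (hal : a ∉ l)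
    (hbl : b ∉ l) (f : Gam) :
    (fun n => clearB m (a :: b :: l) n f) =
      act _ Gam (l.map fun σ => lX a ^ m + lX σ ^ m).prod
        (act _ Gam (l.map fun σ => lX b ^ m + lX σ ^ m).prod
          (act _ Gam (lX a ^ m + lX b ^ m) fun n => bOp (n a) (bOp (n b) (clearB m l n f)))) := by
  have hF : ∀ k i j : ZMod m, i ≠ k → j ≠ k → lX i ^ m + lX j ^ m ∈ without k := fun k i j h h' =>
    add_mem (pow_mem (lX_mem_without h) m) (pow_mem (lX_mem_without h') m)
  have h1 : ∀ k, k ∉ l → clear m l ∈ without k := fun k h =>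
    pairProd_mem_without (hF k) h
  have h2 : (fun n : ZMod m → ℤ => bOp (n a) (bOp (n b) (clearB m l n f))) =
      act _ Gam (clear m l) fun n => prodB (a :: b :: l) n f := by
    have e1 : (fun n => clearB m l n f) = act _ Gam (clear m l) fun n => prodB l n f :=
      (act_map (evalHom f) (clear m l) (prodB l)).symm
    have e2 : (fun n : ZMod m → ℤ => bOp (n b) (clearB m l n f)) =
        act _ Gam (clear m l) fun n => bOp (n b) (prodB l n f) := by
      have := act_map_coord (h1 b hbl) (fun k => (bOp k).toAddMonoidHom) fun n => prodB l n f
      rw [← e1] at this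
      exact this.symm
    have e3 := act_map_coord (h1 a hal) (fun k => (bOp k).toAddMonoidHom)
      fun n => bOp (n b) (prodB l n f)
    rw [← e2] at e3
    have e4 : (fun n => prodB (a :: b :: l) n f) =
        fun n : ZMod m → ℤ => (bOp (n a)).toAddMonoidHom (bOp (n b) (prodB l n f)) := by
      funext n
      rw [prodB_cons, prodB_cons]; rfl
    rw [e4, e3]; rfl
  rw [h2, ← act_mul, ← act_mul, ← act_mul]
  have h3 : (fun n => clearB m (a :: b :: l) n f) =
      act _ Gam (clear m (a :: b :: l)) fun n => prodB (a :: b :: l) n f :=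
    (act_map (evalHom f) (clear m (a :: b :: l)) (prodB (a :: b :: l))).symm
  rw [h3, clear_cons, clear_cons, List.map_cons, List.prod_cons]
  congr 2
  ring

/-- Under `x_a^m + x_b^m`, the coefficients of a factor may be replaced by those of
`B(x_a) B(x_b)`: by `pairC_step` the difference vanishes when the variables are set equal. -/
lemma diagSum_pairClearB (hm : Odd m) {c : ℕ} (hc : 1 ≤ c) (hc' : c ≤ (m - 1) / 2) (f : Gam)
    (d : ℤ) {l : List (ZMod m)}
    (hl : l = ((-(2 * c) : ℤ) : ZMod m) :: ((2 * c : ℤ) : ZMod m) :: resList m c) :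
    DiagFinite l (act _ Gam (lX ((-(2 * c) : ℤ) : ZMod m) ^ m + lX ((2 * c : ℤ) : ZMod m) ^ m)
        fun n => bOp (n ((-(2 * c) : ℤ) : ZMod m)) (bOp (n ((2 * c : ℤ) : ZMod m))
          (clearB m (resList m c) n f))) ∧
    diagSum l (act _ Gam (lX ((-(2 * c) : ℤ) : ZMod m) ^ m + lX ((2 * c : ℤ) : ZMod m) ^ m)
        fun n => bOp (n ((-(2 * c) : ℤ) : ZMod m)) (bOp (n ((2 * c : ℤ) : ZMod m))
          (clearB m (resList m c) n f))) d =
      (2 : ℤ) • diagSum l (pairClearB (2 * c) (resList m c) f) (d - m) := by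
  have hab := two_mul_ne_neg hm hc hc'
  obtain ⟨hal, hbl⟩ := notMem_resList hm hc hc'
  have hw := diagFinite_pairClearB hm hc hc' f
  rw [← hl] at hw
  obtain ⟨K, hK⟩ := exists_le_of_clearB_ne_zero hm (nodup_resList hm c) f
  set a : ZMod m := ((-(2 * c) : ℤ) : ZMod m) with ha
  set b : ZMod m := ((2 * c : ℤ) : ZMod m) with hb
  have hal' : a ∈ l := by simp [hl]
  have hbl' : b ∈ l := by simp [hl]
  -- the difference of the two families is `(x_a^m - x_b^m) h0`
  set h0 : (ZMod m → ℤ) → Gam := fun n =>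
    if n a = -(2 * c) ∧ n b = 2 * c then clearB m (resList m c) n f else 0 with hh0
  have hfin0 : DiagFinite l h0 := by
    refine diagFinite_of_le (min K (-(2 * c))) fun n hn hne ρ hρ => ?_
    simp only [hh0] at hne
    rw [ite_ne_right_iff] at hne
    obtain ⟨⟨h1, h2⟩, h3⟩ := hne
    rw [hl] at hρ
    rcases List.mem_cons.1 hρ with rfl | hρ
    · rw [h1]; exact min_le_right _ _
    rcases List.mem_cons.1 hρ with rfl | hρ
    · rw [h2]; exact (min_le_right _ _).trans (by omega)
    · exact (min_le_left _ _).trans (hK n h3 ρ hρ)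
  have key : ∀ n, IsRes l n → (act _ Gam (lX a ^ m + lX b ^ m)
        (pairClearB (2 * c) (resList m c) f) +
      (act _ Gam (lX a ^ m) h0 + -act _ Gam (lX b ^ m) h0)) n =
      act _ Gam (lX a ^ m + lX b ^ m)
        (fun n => bOp (n a) (bOp (n b) (clearB m (resList m c) n f))) n := by
    intro n hn
    have e1 : clearB m (resList m c) (n - Pi.single a (m : ℤ)) = clearB m (resList m c) n :=
      clearB_congr fun ρ hρ => by
        have : ρ ≠ a := fun h => hal (h ▸ hρ)
        simp [this]
    have e2 : clearB m (resList m c) (n - Pi.single b (m : ℤ)) = clearB m (resList m c) n :=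
      clearB_congr fun ρ hρ => by
        have : ρ ≠ b := fun h => hbl (h ▸ hρ)
        simp [this]
    have := pairC_step hm hc hc' (hn.1 a hal') (hn.1 b hbl') (clearB m (resList m c) n f)
    rw [map_add]
    simp only [LinearMap.add_apply, Pi.add_apply, Pi.neg_apply, act_lX_pow, pairClearB, hh0, e1,
      e2, Pi.sub_apply, Pi.single_eq_same, Pi.single_eq_of_ne hab, Pi.single_eq_of_ne hab.symm,
      sub_zero, ← ha, ← hb]
    linear_combination this
  have hX := hw.pair hal' hbl'
  have hf1 := hfin0.lX_pow hal'
  have hf2 := (hfin0.lX_pow hbl').neg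
  refine ⟨DiagFinite.congr key (hX.add (hf1.add hf2)), ?_⟩
  rw [← diagSum_congr key, diagSum_add hX (hf1.add hf2), diagSum_add hf1 hf2, diagSum_neg,
    diagSum_lX_pow hal', diagSum_lX_pow hbl', add_neg_cancel, add_zero, diagSum_pair hal' hbl' hw]

/-- For the last factor there is nothing to clear. -/
lemma isClearing_of_le {c : ℕ} (hc : (m - 1) / 2 ≤ c) : IsClearing m c := by
  intro d f
  have h1 : ∀ n, clearB m [(0 : ZMod m)] n f = bOp (n 0) f := by
    intro n
    simp [clearB, clear, pairProd, prodB]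
  rw [tailProduct_of_le hc, resList_of_le hc]
  simp only [npairs, List.length_nil, add_zero, pow_zero, one_smul, Nat.cast_zero, mul_zero, h1]
  rw [lastFactor, diagSum]
  have h2 : resSet [(0 : ZMod m)] d = {n | n = Pi.single 0 d ∧ d ≡ 0 [ZMOD m]} := by
    ext n
    simp only [resSet, IsRes, List.mem_singleton, Set.mem_ofPred_eq, forall_eq]
    have hd : d ≡ 0 [ZMOD m] ↔ (d : ZMod m) = 0 := by
      rw [← ZMod.intCast_eq_intCast_iff, Int.cast_zero]
    rw [hd]
    constructor
    · rintro ⟨⟨h3, h4⟩, h5⟩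
      have h6 : n = Pi.single 0 (n 0) := by
        funext ρ
        by_cases hρ : ρ = 0
        · subst hρ; simp
        · rw [h4 ρ hρ]; simp [hρ]
      have h7 : n 0 = d := by
        rw [← h5]
        exact (Finset.sum_eq_single 0 (fun ρ _ hρ => h4 ρ hρ) (by simp)).symm
      exact ⟨h7 ▸ h6, h7 ▸ h3⟩
    · rintro ⟨rfl, h3⟩
      refine ⟨⟨by simpa using h3, fun ρ hρ => by simp [hρ]⟩, by simp⟩
  rw [h2]
  by_cases hd : d ≡ 0 [ZMOD m]
  · simp [hd, opB_eq]
  · simp [hd]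

/-- Both sides acquire the same power of `2` from the clearing factors that involve the two new
variables. -/
lemma IsClearing.step (hm : Odd m) {c : ℕ} (hc : c < (m - 1) / 2) (h : IsClearing m (c + 1)) :
    IsClearing m c := by
  intro d f
  have hc1 := Nat.succ_pos c
  have hl := resList_of_lt hc
  have hab := two_mul_ne_neg hm hc1 hc
  obtain ⟨hal, hbl⟩ := notMem_resList hm hc1 hc
  have h1 := h.mulSeries_apply hm hc1 hc d f
  rw [← hl, ← tailProduct_of_lt hc] at h1
  have hmem : ∀ ρ ∈ resList m (c + 1), ρ ∈ resList m c := fun ρ hρ => by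
    rw [hl]; exact List.mem_cons_of_mem _ (List.mem_cons_of_mem _ hρ)
  have ha : ((-(2 * (c + 1 : ℕ)) : ℤ) : ZMod m) ∈ resList m c := by
    rw [hl]; exact List.mem_cons_self
  have hb : ((2 * (c + 1 : ℕ) : ℤ) : ZMod m) ∈ resList m c := by
    rw [hl]; exact List.mem_cons_of_mem _ List.mem_cons_self
  have h2 := diagSum_pairClearB hm hc1 hc f
    (d + m * npairs (resList m (c + 1)) + m) hl
  have h3 := clearB_cons_cons hal hbl f
  rw [← hl] at h3
  have h4 := fun d' => diagSum_list hb hmem h2.1 d'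
  have h5 := diagSum_list ha hmem (h4 0).1 (d + m * npairs (resList m c))
  have h6 : npairs (resList m c) =
      (resList m (c + 1)).length + 1 +
        ((resList m (c + 1)).length + npairs (resList m (c + 1))) := by
    rw [hl]; rfl
  rw [h3, h5.2, (h4 _).2, smul_smul, h6,
    show d + (m : ℤ) * ((resList m (c + 1)).length + 1 +
      ((resList m (c + 1)).length + npairs (resList m (c + 1))) : ℕ) -
      m * (resList m (c + 1)).length - m * (resList m (c + 1)).length =
      d + m * npairs (resList m (c + 1)) + m by push_cast; ring, h2.2,
    add_sub_cancel_right, ← h1, smul_smul, smul_smul]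
  congr 1
  ring

/-- The product is obtained from the cleared product of the generating functions `B(x_ρ)` by
selecting the monomials with prescribed residues and setting all variables equal. -/
lemma isClearing (hm : Odd m) (c : ℕ) : IsClearing m c := by
  by_cases hc : (m - 1) / 2 ≤ c
  · exact isClearing_of_le hc
  · exact (isClearing hm (c + 1)).step hm (not_le.1 hc)
  termination_by (m - 1) / 2 - c

lemma locallyFinite_mulTerm (hm : Odd m) {c : ℕ} (hc : 1 ≤ c) (hc' : c ≤ (m - 1) / 2) (d : ℤ) :
    LocallyFinite (mulTerm (pairFactor m (2 * c)) (tailProduct m c) d) :=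
  (isClearing hm c).locallyFinite hm hc hc' d

end Clearing

/-! ### Evaluation at roots of unity -/

section Fourier

variable {m : ℕ} [NeZero m] {S : Type} [AddCommGroup S] [Module ℂ S]

/-- The vectors with coordinate sum `d`. -/
def degSet (m : ℕ) [NeZero m] (d : ℤ) : Set (ZMod m → ℤ) := {n | ∑ ρ, n ρ = d}

/-- All coordinate sums occur only finitely often in the support. -/
def DegFinite (g : (ZMod m → ℤ) → S) : Prop := ∀ d, (degSet m d ∩ Function.support g).Finite

/-- The value of the monomial `x^n` at `x_ρ = χ(a_ρ)`, for a primitive additive character `χ`. -/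
def rootMonomial (a : ZMod m → ZMod m) (n : ZMod m → ℤ) : ℂ :=
  ZMod.stdAddChar (∑ ρ, a ρ * (n ρ : ZMod m))

/-- The coefficient of `u^d` in `∑ g_n x^n` at `x_ρ = χ(a_ρ) u`. -/
def rootSum (a : ZMod m → ZMod m) (g : (ZMod m → ℤ) → S) (d : ℤ) : S :=
  ∑ᶠ n ∈ degSet m d, rootMonomial a n • g n

lemma rootMonomial_add (a : ZMod m → ZMod m) (n n' : ZMod m → ℤ) :
    rootMonomial a (n + n') = rootMonomial a n * rootMonomial a n' := by
  rw [rootMonomial, rootMonomial, rootMonomial, ← AddChar.map_add_eq_mul, ← Finset.sum_add_distrib]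
  congr 1
  refine Finset.sum_congr rfl fun ρ _ => ?_
  rw [Pi.add_apply, Int.cast_add, mul_add]

lemma rootMonomial_single (a : ZMod m → ZMod m) (ρ : ZMod m) :
    rootMonomial a (Pi.single ρ 1) = ZMod.stdAddChar (a ρ) := by
  rw [rootMonomial, Finset.sum_eq_single ρ]
  · simp
  · intro σ _ h; simp [h]
  · simp

lemma DegFinite.add {g h : (ZMod m → ℤ) → S} (hg : DegFinite g) (hh : DegFinite h) :
    DegFinite (g + h) := fun d => by
  refine ((hg d).union (hh d)).subset ?_
  rintro n ⟨h1, h2⟩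
  rcases Function.support_add g h h2 with h3 | h3
  · exact Or.inl ⟨h1, h3⟩
  · exact Or.inr ⟨h1, h3⟩

lemma DegFinite.smul {g : (ZMod m → ℤ) → S} (hg : DegFinite g) (c : (ZMod m → ℤ) → ℂ) (d : ℤ) :
    (degSet m d ∩ Function.support fun n => c n • g n).Finite :=
  (hg d).subset fun _ h => ⟨h.1, fun h0 => h.2 (by simp only [h0, smul_zero])⟩

lemma rootSum_add (a : ZMod m → ZMod m) {g h : (ZMod m → ℤ) → S} (hg : DegFinite g)
    (hh : DegFinite h) (d : ℤ) : rootSum a (g + h) d = rootSum a g d + rootSum a h d := by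
  rw [rootSum, rootSum, rootSum, ← finsum_mem_add_distrib' (hg.smul _ d) (hh.smul _ d)]
  simp only [Pi.add_apply, smul_add]

lemma rootSum_smul (a : ZMod m → ZMod m) (c : ℂ) {g : (ZMod m → ℤ) → S} (hg : DegFinite g)
    (d : ℤ) : rootSum a (fun n => c • g n) d = c • rootSum a g d := by
  have := (DistribSMul.toAddMonoidHom S c).map_finsum_mem' (hg.smul (rootMonomial a) d)
  refine Eq.trans ?_ this.symm
  exact finsum_mem_congr rfl fun n _ => smul_comm _ _ _

lemma rootSum_neg (a : ZMod m → ZMod m) {g : (ZMod m → ℤ) → S} (hg : DegFinite g)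
    (d : ℤ) : rootSum a (-g) d = -rootSum a g d := by
  have := rootSum_smul a (-1) hg d
  simp only [neg_smul, one_smul] at this
  exact this

lemma bijOn_degSet_add (v : ZMod m → ℤ) (d : ℤ) :
    Set.BijOn (fun n : ZMod m → ℤ => n + v) (degSet m d) (degSet m (d + ∑ ρ, v ρ)) := by
  refine ⟨fun n hn => ?_, fun _ _ _ _ h => add_right_cancel h, fun n hn => ⟨n - v, ?_, by simp⟩⟩
  · change ∑ ρ, (n ρ + v ρ) = _
    rw [Finset.sum_add_distrib]
    exact congrArg (· + _) hn
  · change ∑ ρ, (n ρ - v ρ) = _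
    rw [Finset.sum_sub_distrib, sub_eq_iff_eq_add]
    exact hn

lemma DegFinite.comp_add {g : (ZMod m → ℤ) → S} (hg : DegFinite g) (v : ZMod m → ℤ) :
    DegFinite fun n => g (n + v) := fun d =>
  Set.Finite.of_injOn (f := fun n : ZMod m → ℤ => n + v)
    (t := degSet m (d + ∑ ρ, v ρ) ∩ Function.support g)
    (fun _ h => ⟨(bijOn_degSet_add v d).mapsTo h.1, h.2⟩) (fun _ _ _ _ h => add_right_cancel h)
    (hg (d + ∑ ρ, v ρ))

lemma rootSum_comp_add (a : ZMod m → ZMod m) {g : (ZMod m → ℤ) → S} (hg : DegFinite g)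
    (v : ZMod m → ℤ) (d : ℤ) :
    rootMonomial a v • rootSum a (fun n => g (n + v)) d = rootSum a g (d + ∑ ρ, v ρ) := by
  rw [← rootSum_smul a _ (hg.comp_add v)]
  refine finsum_mem_eq_of_bijOn _ (bijOn_degSet_add v d) fun n _ => ?_
  rw [rootMonomial_add, mul_smul]

/-- Under `x_ρ = χ(a_ρ) u`, the Laurent polynomial `p` becomes `v u^k`. -/
def EvaluatesTo (a : ZMod m → ZMod m) (p : LPoly (ZMod m)) (k : ℤ) (v : ℂ) : Prop :=
  ∀ (S : Type) [AddCommGroup S] [Module ℂ S] (g : (ZMod m → ℤ) → S), DegFinite g →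
    DegFinite (act _ S p g) ∧ ∀ d, rootSum a (act _ S p g) d = v • rootSum a g (d - k)

namespace EvaluatesTo

variable {a : ZMod m → ZMod m} {p r : LPoly (ZMod m)} {k k' : ℤ} {v w : ℂ}

lemma variable_lX (a : ZMod m → ZMod m) (ρ : ZMod m) :
    EvaluatesTo a (lX ρ) 1 (ZMod.stdAddChar (a ρ)) := by
  intro S _ _ g hg
  have h1 : act _ S (lX ρ) g = fun n => g (n + -Pi.single ρ 1) := by
    funext n; rw [act_lX, sub_eq_add_neg]
  have h2 : DegFinite (act _ S (lX ρ) g) := h1 ▸ hg.comp_add _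
  refine ⟨h2, fun d => ?_⟩
  have h3 := rootSum_comp_add a h2 (Pi.single ρ 1) (d - 1)
  have h4 : (fun n => act _ S (lX ρ) g (n + Pi.single ρ 1)) = g := by
    funext n; rw [act_lX, add_sub_cancel_right]
  rw [h4, rootMonomial_single] at h3
  rw [h3]
  simp

lemma one (a : ZMod m → ZMod m) : EvaluatesTo a 1 0 1 := fun S _ _ g hg => by
  simpa using hg

lemma mul (hp : EvaluatesTo a p k v) (hr : EvaluatesTo a r k' w) :
    EvaluatesTo a (p * r) (k + k') (v * w) := fun S _ _ g hg => by
  rw [act_mul]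
  have h1 := hr S g hg
  have h2 := hp S _ h1.1
  refine ⟨h2.1, fun d => ?_⟩
  rw [h2.2, h1.2, smul_smul, sub_sub]

lemma pow (hp : EvaluatesTo a p k v) (s : ℕ) : EvaluatesTo a (p ^ s) (s * k) (v ^ s) := by
  induction s with
  | zero => simpa using one a
  | succ s ih =>
    rw [pow_succ, pow_succ, Nat.cast_succ, add_mul, one_mul]
    exact ih.mul hp

lemma add (hp : EvaluatesTo a p k v) (hr : EvaluatesTo a r k w) :
    EvaluatesTo a (p + r) k (v + w) := fun S _ _ g hg => by
  have h1 := hp S g hg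
  have h2 := hr S g hg
  rw [map_add]
  refine ⟨h1.1.add h2.1, fun d => ?_⟩
  rw [add_smul, ← h1.2, ← h2.2]
  exact rootSum_add a h1.1 h2.1 d

lemma neg (hp : EvaluatesTo a p k v) : EvaluatesTo a (-p) k (-v) := fun S _ _ g hg => by
  have h1 := hp S g hg
  rw [map_neg]
  have h2 : DegFinite (-act _ S p g) := fun d => by
    rw [Function.support_neg]; exact h1.1 d
  refine ⟨h2, fun d => ?_⟩
  rw [neg_smul, ← h1.2]
  exact rootSum_neg a h1.1 d

lemma sub (hp : EvaluatesTo a p k v) (hr : EvaluatesTo a r k w) :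
    EvaluatesTo a (p - r) k (v - w) := by
  rw [sub_eq_add_neg, sub_eq_add_neg]; exact hp.add hr.neg

lemma sum {ι : Type*} {s : Finset ι} (hs : s.Nonempty) {p : ι → LPoly (ZMod m)} {v : ι → ℂ}
    (h : ∀ i ∈ s, EvaluatesTo a (p i) k (v i)) :
    EvaluatesTo a (∑ i ∈ s, p i) k (∑ i ∈ s, v i) := by
  induction hs using Finset.Nonempty.cons_induction with
  | singleton i => simpa using h
  | cons i s hi _ ih =>
    rw [Finset.sum_cons, Finset.sum_cons]
    exact (h i (Finset.mem_cons_self i s)).add (ih fun j hj => h j (Finset.mem_cons_of_mem hj))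

/-- A factor of `vander` takes the value `0` if the two variables coincide. -/
lemma exists_cofactor (a : ZMod m → ZMod m) (ρ σ : ZMod m) :
    ∃ v, EvaluatesTo a (cofactor m ρ σ * (lX ρ - lX σ)) m v ∧ (a ρ = a σ → v = 0) := by
  have hm : 0 < m := Nat.pos_of_ne_zero (NeZero.ne m)
  have h1 : EvaluatesTo a (cofactor m ρ σ) ((m - 1 : ℕ) : ℤ) (∑ s ∈ range m,
      ZMod.stdAddChar (a ρ) ^ s * (-ZMod.stdAddChar (a σ)) ^ (m - 1 - s)) := by
    refine sum ⟨0, Finset.mem_range.2 hm⟩ fun s hs => ?_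
    rw [Finset.mem_range] at hs
    have := ((variable_lX a ρ).pow s).mul ((variable_lX a σ).neg.pow (m - 1 - s))
    rwa [mul_one, mul_one, ← Nat.cast_add, show s + (m - 1 - s) = m - 1 by omega] at this
  have h2 := h1.mul ((variable_lX a ρ).sub (variable_lX a σ))
  rw [show ((m - 1 : ℕ) : ℤ) + 1 = m by omega] at h2
  exact ⟨_, h2, fun h => by rw [h, sub_self, mul_zero]⟩

/-- `vander` takes a single value at roots of unity, and this value is `0` unless they are
distinct. -/
lemma exists_vander (a : ZMod m → ZMod m) (l : List (ZMod m)) :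
    ∃ v, EvaluatesTo a (vander m l) (m * npairs l) v ∧ (¬(l.map a).Nodup → v = 0) := by
  induction l with
  | nil =>
    refine ⟨1, ?_, fun h => absurd (by simp) h⟩
    have := one a
    simpa [vander, pairProd, npairs] using this
  | cons ρ l ih =>
    obtain ⟨w, hw, hw0⟩ := ih
    have h1 : ∀ k : List (ZMod m), ∃ v, EvaluatesTo a
        (k.map fun σ => cofactor m ρ σ * (lX ρ - lX σ)).prod (m * k.length) v ∧
        (a ρ ∈ k.map a → v = 0) := by
      intro k
      induction k with
      | nil => exact ⟨1, by simpa using one a, by simp⟩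
      | cons σ k ih =>
        obtain ⟨v, hv, hv0⟩ := ih
        obtain ⟨u, hu, hu0⟩ := exists_cofactor a ρ σ
        refine ⟨u * v, ?_, ?_⟩
        · rw [List.map_cons, List.prod_cons, List.length_cons,
            show (m : ℤ) * (k.length + 1 : ℕ) = m + m * k.length by push_cast; ring]
          exact hu.mul hv
        · rw [List.map_cons, List.mem_cons]
          rintro (h | h)
          · rw [hu0 h, zero_mul]
          · rw [hv0 h, mul_zero]
    obtain ⟨v, hv, hv0⟩ := h1 l
    refine ⟨v * w, ?_, ?_⟩
    · rw [npairs, show (m : ℤ) * (l.length + npairs l : ℕ) = m * l.length + m * npairs l by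
        push_cast; ring]
      exact hv.mul hw
    · rw [List.map_cons, List.nodup_cons, not_and_or, not_not]
      rintro (h | h)
      · rw [hv0 h, zero_mul]
      · rw [hw0 h, mul_zero]

end EvaluatesTo

lemma stdAddChar_sum (f : ZMod m → ZMod m) :
    (ZMod.stdAddChar (∑ ρ, f ρ) : ℂ) = ∏ ρ, ZMod.stdAddChar (f ρ) :=
  map_prod (ZMod.stdAddChar (N := m)).toMonoidHom (fun ρ => Multiplicative.ofAdd (f ρ)) Finset.univ

/-- Orthogonality of characters. -/
lemma sum_rootMonomial (n : ZMod m → ℤ) :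
    ∑ a : ZMod m → ZMod m, ZMod.stdAddChar (-∑ ρ, a ρ * ρ) * rootMonomial a n =
      if ∀ ρ, (n ρ : ZMod m) = ρ then (m : ℂ) ^ m else 0 := by
  have h1 : ∀ a : ZMod m → ZMod m, (ZMod.stdAddChar (-∑ ρ, a ρ * ρ) * rootMonomial a n : ℂ) =
      ∏ ρ, ZMod.stdAddChar (a ρ * ((n ρ : ZMod m) - ρ)) := by
    intro a
    rw [rootMonomial, ← AddChar.map_add_eq_mul, ← stdAddChar_sum]
    congr 1
    simp only [mul_sub, Finset.sum_sub_distrib]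
    ring
  have h2 := Finset.prod_univ_sum (fun _ : ZMod m => (Finset.univ : Finset (ZMod m)))
    fun ρ x => (ZMod.stdAddChar (x * ((n ρ : ZMod m) - ρ)) : ℂ)
  rw [Fintype.piFinset_univ] at h2
  rw [Finset.sum_congr rfl fun a _ => h1 a, ← h2]
  simp only [AddChar.sum_mulShift _ (ZMod.isPrimitive_stdAddChar m), sub_eq_zero, ZMod.card]
  split_ifs with h
  · simp [h, ZMod.card]
  · push Not at h
    obtain ⟨ρ, hρ⟩ := h
    exact Finset.prod_eq_zero (Finset.mem_univ ρ) (by simp [hρ])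

/-- Fourier inversion: the selection of residues is an average over the `m`-th roots of unity. -/
lemma diagSum_eq_sum_rootSum {l : List (ZMod m)} (hl : ∀ ρ, ρ ∈ l) {g : (ZMod m → ℤ) → S}
    (hg : DegFinite g) (d : ℤ) :
    ((m : ℂ) ^ m) • diagSum l g d =
      ∑ a : ZMod m → ZMod m, (ZMod.stdAddChar (-∑ ρ, a ρ * ρ) : ℂ) • rootSum a g d := by
  classical
  have h1 : ∀ a, rootSum a g d = ∑ n ∈ (hg d).toFinset, rootMonomial a n • g n := by
    intro a
    refine finsum_mem_eq_sum_of_subset _ ?_ ?_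
    · rintro n ⟨hn, hn'⟩
      rw [Set.Finite.coe_toFinset]
      exact ⟨hn, fun h0 => hn' (by simp only [h0, smul_zero])⟩
    · rw [Set.Finite.coe_toFinset]; exact Set.inter_subset_left
  have h2 : diagSum l g d = ∑ n ∈ (hg d).toFinset with ∀ ρ, (n ρ : ZMod m) = ρ, g n := by
    refine finsum_mem_eq_sum_of_inter_support_eq _ ?_
    ext n
    simp only [resSet, IsRes, degSet, Set.mem_inter_iff, Set.mem_ofPred_eq, Finset.coe_filter,
      Set.Finite.mem_toFinset, hl]
    simp only [not_true, forall_true_left, IsEmpty.forall_iff, implies_true, and_true]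
    tauto
  rw [h2, Finset.sum_filter, Finset.smul_sum]
  simp only [h1, Finset.smul_sum]
  rw [Finset.sum_comm]
  refine Finset.sum_congr rfl fun n _ => ?_
  simp only [smul_smul]
  rw [← Finset.sum_smul, sum_rootMonomial]
  split_ifs <;> simp

/-- The family is invariant under permutations of the variables. -/
def IsSymm (h : (ZMod m → ℤ) → S) : Prop := ∀ (e : Equiv.Perm (ZMod m)) n, h (n ∘ e) = h n

lemma rootSum_perm {h : (ZMod m → ℤ) → S} (hs : IsSymm h) (a : ZMod m → ZMod m)
    (e : Equiv.Perm (ZMod m)) (d : ℤ) : rootSum (a ∘ e) h d = rootSum a h d := by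
  refine finsum_mem_eq_of_bijOn (fun n : ZMod m → ℤ => n ∘ e.symm) ⟨?_, ?_, ?_⟩ ?_
  · intro n hn
    change ∑ ρ, n (e.symm ρ) = d
    rw [Equiv.sum_comp e.symm n]; exact hn
  · intro n _ n' _ hnn
    funext ρ
    have := congrFun hnn (e ρ)
    simpa using this
  · intro n hn
    refine ⟨n ∘ e, ?_, by funext ρ; simp⟩
    change ∑ ρ, n (e ρ) = d
    rw [Equiv.sum_comp e n]; exact hn
  · intro n _
    rw [hs, rootMonomial, rootMonomial]
    congr 2
    have := Equiv.sum_comp e fun ρ => a ρ * ((n (e.symm ρ) : ℤ) : ZMod m)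
    simp only [Equiv.symm_apply_apply] at this
    exact this

/-- For symmetric families, the selection of residues amounts to the evaluation at the `m`-th roots
of unity: the points with two equal coordinates do not contribute, since `vander` vanishes there. -/
lemma exists_diagSum_vander {l : List (ZMod m)} (hl : ∀ ρ, ρ ∈ l) :
    ∃ κ : ℂ, ∀ (S : Type) [AddCommGroup S] [Module ℂ S] (h : (ZMod m → ℤ) → S), DegFinite h →
      IsSymm h → ∀ d, diagSum l (act _ S (vander m l) h) (d + m * npairs l) =
        κ • rootSum id h d := by
  choose v hv hv0 using fun a : ZMod m → ZMod m => EvaluatesTo.exists_vander a l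
  have hm : (m : ℂ) ^ m ≠ 0 := pow_ne_zero _ (Nat.cast_ne_zero.2 (NeZero.ne m))
  refine ⟨((m : ℂ) ^ m)⁻¹ * ∑ a : ZMod m → ZMod m, ZMod.stdAddChar (-∑ ρ, a ρ * ρ) * v a,
    fun S _ _ h hf hs d => ?_⟩
  rw [mul_smul, eq_inv_smul_iff₀ hm, diagSum_eq_sum_rootSum hl (hv 0 S h hf).1, Finset.sum_smul]
  refine Finset.sum_congr rfl fun a _ => ?_
  rw [(hv a S h hf).2, add_sub_cancel_right, mul_smul]
  by_cases ha : Function.Injective a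
  · have := rootSum_perm hs id (Equiv.ofBijective a (Finite.injective_iff_bijective.1 ha)) d
    congr 2
  · rw [hv0 a, zero_smul, zero_smul]
    intro hnd
    exact ha fun x y hxy => List.inj_on_of_nodup_map hnd (hl x) (hl y) hxy

end Fourier

/-! ### The action on the vacuum -/

lemma finsum_mem_eq_single {α M : Type*} [AddCommMonoid M] {s : Set α} {f : α → M} {a : α}
    (ha : a ∈ s) (h : ∀ x ∈ s, x ≠ a → f x = 0) : ∑ᶠ x ∈ s, f x = f a := by
  classical
  rw [finsum_mem_def, finsum_eq_single _ a, Set.indicator_of_mem ha]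
  intro x hx
  by_cases hs : x ∈ s
  · rw [Set.indicator_of_mem hs, h x hs hx]
  · rw [Set.indicator_of_notMem hs]

section Vacuum

variable {m : ℕ} [NeZero m]

/-- On the vacuum, `B_y` with `y < 0` anticommutes past the later factors. -/
lemma bOp_tailProduct_one (hm : Odd m) {c : ℕ} (hc : 1 ≤ c) (hc' : c ≤ (m - 1) / 2) {y : ℤ}
    (hy : y < 0) (hy' : (y : ZMod m) = ((2 * c : ℤ) : ZMod m) ∨
      (y : ZMod m) = ((-(2 * c) : ℤ) : ZMod m)) (d : ℤ) : bOp y (tailProduct m c d 1) = 0 := by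
  have h1 := congrArg (bOp y) (isClearing hm c d 1)
  have h2 := diagSum_map (bOp y).toAddMonoidHom
    (diagFinite_clearB hm (nodup_resList hm c) 1) (d + m * npairs (resList m c))
  simp only [LinearMap.toAddMonoidHom_coe] at h2
  rw [map_zsmul, h2] at h1
  refine zsmul_eq_zero_gam (c := 2 ^ npairs (resList m c)) (by positivity) (h1.trans ?_)
  refine finsum_mem_eq_zero_of_forall_eq_zero fun n hn => ?_
  refine bOp_clearB (bOp_neg_one hy) (fun ρ hρ => ?_) hn.1.1
  rcases hy' with hy' | hy' <;> rw [hy']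
  · exact (add_ne_zero_of_mem_resList hm hc hc' hρ).1
  · exact (add_ne_zero_of_mem_resList hm hc hc' hρ).2

/-- In degree at most `0` one of the two indices is negative, so only the summand `1` remains. -/
lemma pairFactor_apply_of_nonpos (hm : Odd m) {c : ℕ} (hc : 1 ≤ c) (hc' : c ≤ (m - 1) / 2)
    {g : Gam} (hg : ∀ y : ℤ, y < 0 → ((y : ZMod m) = ((2 * c : ℤ) : ZMod m) ∨
      (y : ZMod m) = ((-(2 * c) : ℤ) : ZMod m)) → bOp y g = 0) {e : ℤ} (he : e ≤ 0) :
    pairFactor m (2 * c) e g = if e = 0 then g else 0 := by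
  have hm0 := hm.pos
  have hne : ((2 * c : ℤ) : ZMod m) ≠ 0 := two_mul_ne_zero hm (by omega)
    (by rw [abs_lt]; constructor <;> omega)
  have hmod : ∀ x y : ℤ, x ≡ y [ZMOD m] ↔ (x : ZMod m) = y := fun x y =>
    (ZMod.intCast_eq_intCast_iff x y m).symm
  have key : ∀ p ∈ pairSet m (2 * c) e, pairC (2 * c) p.1 p.2 g =
      if p.1 = -(2 * c) ∧ p.2 = 2 * c then g else 0 := by
    rintro ⟨i, j⟩ ⟨hi, hj, hij⟩
    simp only [hmod] at hi hj hij ⊢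
    have h1 : opBB i j g = 0 := by
      rw [opBB, opB_eq, opB_eq]
      have hi0 : i ≠ 0 := by
        rintro rfl
        apply hne
        rw [Int.cast_neg, Int.cast_zero] at hi
        exact neg_eq_zero.1 hi.symm
      split_ifs with h2 h3
      · rw [Module.End.mul_apply, hg j (by omega) (Or.inl hj), map_zero]
      · rw [LinearMap.neg_apply, Module.End.mul_apply, hg i (by omega) (Or.inr hi), map_zero,
          neg_zero]
      · rfl
    rw [pairC, LinearMap.add_apply, h1, zero_add]
    split_ifs <;> rfl
  rw [pairFactor_apply, finsum_mem_congr rfl key]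
  by_cases he0 : e = 0
  · rw [if_pos he0, finsum_mem_eq_single (a := (-(2 * c : ℤ), (2 * c : ℤ)))]
    · simp
    · exact ⟨Int.ModEq.refl _, Int.ModEq.refl _, by simp [he0]⟩
    · rintro ⟨i, j⟩ - hp
      rw [Ne, Prod.mk.injEq] at hp
      rw [if_neg hp]
  · rw [if_neg he0]
    refine finsum_mem_eq_zero_of_forall_eq_zero ?_
    rintro ⟨i, j⟩ ⟨-, -, hp⟩
    simp only at hp
    rw [if_neg (by simp only; omega)]

/-- The product maps `1` to `1 + ∑_{d > 0} T_d(1) u^d`. -/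
lemma tailProduct_one (hm : Odd m) (c : ℕ) {d : ℤ} (hd : d ≤ 0) :
    tailProduct m c d 1 = if d = 0 then 1 else 0 := by
  by_cases hc : (m - 1) / 2 ≤ c
  · rw [tailProduct_of_le hc, lastFactor]
    by_cases h0 : d = 0
    · rw [if_pos (by rw [h0]), opB_eq, bOp_one, h0, q_zero, if_pos rfl]
    · rw [if_neg h0, opB_eq]
      split_ifs
      · exact bOp_neg_one (by omega)
      · rfl
  · have hc1 := Nat.succ_pos c
    rw [not_le] at hc
    rw [tailProduct_of_lt hc, mulSeries, opSum_apply (locallyFinite_mulTerm hm hc1 hc d)]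
    have key : ∀ e, mulTerm (pairFactor m (2 * ((c + 1 : ℕ) : ℤ))) (tailProduct m (c + 1)) d e 1 =
        if e = 0 then (if d = 0 then 1 else 0) else 0 := by
      intro e
      rw [mulTerm, Module.End.mul_apply]
      by_cases he : 0 < e
      · rw [tailProduct_one hm (c + 1) (by omega : d - e ≤ 0), if_neg (by omega), if_neg (by omega),
          map_zero]
      · rw [pairFactor_apply_of_nonpos hm hc1 hc
          (fun y hy hy' => bOp_tailProduct_one hm hc1 hc hy hy' _) (not_lt.1 he)]
        by_cases he0 : e = 0
        · rw [if_pos he0, if_pos he0, he0, sub_zero, tailProduct_one hm (c + 1) hd]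
        · rw [if_neg he0, if_neg he0]
    rw [finsum_congr key, finsum_eq_single _ 0 (fun e he => if_neg he), if_pos rfl]
  termination_by (m - 1) / 2 - c

end Vacuum

/-! ### The product as a sum over roots of unity -/

section RootSum

variable {m : ℕ} [NeZero m] {S : Type} [AddCommGroup S] [Module ℂ S]

lemma degFinite_normalProd (hm : Odd m) (f : Gam) (φ : Gam →+ S) :
    DegFinite fun n => φ (normalProd (resList m 0) 1 n f) := by
  intro d
  obtain ⟨N, hN⟩ := exists_mem_degLE f
  refine (finite_setOf_le_sum_eq (-N) d).subset ?_
  rintro n ⟨h1, h2⟩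
  refine ⟨fun ρ => ?_, h1⟩
  by_contra h3
  refine h2 ?_
  simp only
  rw [normalProd_eq_zero hN (mem_resList_zero hm ρ) (not_le.1 h3), map_zero]

lemma normalProd_apply_one (hm : Odd m) (n : ZMod m → ℤ) :
    normalProd (resList m 0) 1 n 1 = ∏ ρ, q (n ρ) := by
  have h1 : ∀ l : List (ZMod m), normalProd l 1 n 1 = (l.map fun ρ => q (n ρ)).prod := by
    intro l
    induction l with
    | nil => rfl
    | cons ρ l ih =>
      rw [normalProd_cons, normal_apply _ _ one_mem_degLE, List.map_cons, List.prod_cons, ← ih]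
      simp [del_zero]
  rw [h1, ← List.prod_toFinset _ (nodup_resList hm 0)]
  congr 1
  ext ρ
  simp [mem_resList_zero hm ρ]

lemma isSymm_prod {R : Type*} [CommMonoid R] (F : ℤ → R) (φ : R → S) :
    IsSymm (m := m) fun n => φ (∏ ρ, F (n ρ)) := by
  intro e n
  simp only [Function.comp_apply]
  rw [Equiv.prod_comp e fun ρ => F (n ρ)]

lemma map_diagSum_clearB (hm : Odd m) (f : Gam) (φ : Gam →+ S) (d : ℤ) :
    (2 : ℂ) ^ npairs (resList m 0) • φ (tailProduct m 0 d f) =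
      diagSum (resList m 0) (act _ S (vander m (resList m 0)) fun n =>
        φ (normalProd (resList m 0) 1 n f)) (d + m * npairs (resList m 0)) := by
  have h1 := congrArg φ (isClearing hm 0 d f)
  rw [diagSum_map φ (diagFinite_clearB hm (nodup_resList hm 0) f), map_zsmul] at h1
  have h2 := act_map (φ.comp (evalHom f)) (vander m (resList m 0)) (normalProd (resList m 0) 1)
  rw [← act_clear_prodB hm (nodup_resList hm 0)] at h2
  have h3 : (2 : ℂ) ^ npairs (resList m 0) • φ (tailProduct m 0 d f) =
      (2 : ℤ) ^ npairs (resList m 0) • φ (tailProduct m 0 d f) := by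
    rw [← Int.cast_smul_eq_zsmul ℂ]; push_cast; rfl
  rw [h3, h1]
  exact (congrArg (fun g => diagSum (resList m 0) g (d + m * npairs (resList m 0))) h2).symm

/-- The normalising constant is found by comparing the constant terms of both sides at `1`. -/
lemma diagSum_vander (hm : Odd m) {h : (ZMod m → ℤ) → S} (hf : DegFinite h) (hs : IsSymm h)
    (d : ℤ) : diagSum (resList m 0) (act _ S (vander m (resList m 0)) h)
      (d + m * npairs (resList m 0)) = (2 : ℂ) ^ npairs (resList m 0) • rootSum id h d := by
  obtain ⟨κ, hκ⟩ := exists_diagSum_vander (mem_resList_zero hm)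
  suffices hκ2 : κ = 2 ^ npairs (resList m 0) by rw [hκ S h hf hs, hκ2]
  obtain ⟨φ, hφ⟩ : ∃ φ : Gam →+ ℂ, ∀ x, φ x = (constTerm x : ℂ) :=
    ⟨((Int.castRingHom ℂ).comp constTerm).toAddMonoidHom, fun _ => rfl⟩
  have h1 := map_diagSum_clearB hm 1 φ 0
  have h2 := degFinite_normalProd hm 1 φ
  have h3 : IsSymm fun n => φ (normalProd (resList m 0) 1 n 1) := by
    simp only [normalProd_apply_one hm]
    exact isSymm_prod q φ
  rw [hκ ℂ _ h2 h3, tailProduct_one hm 0 le_rfl, if_pos rfl] at h1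
  have h4 : rootSum id (fun n : ZMod m → ℤ => φ (normalProd (resList m 0) 1 n 1)) 0 = 1 := by
    rw [rootSum, finsum_mem_eq_single (a := 0)]
    · rw [normalProd_apply_one hm, hφ]
      simp [rootMonomial, q_zero]
    · simp [degSet]
    · intro n hn hn0
      obtain ⟨ρ, hρ⟩ := Function.ne_iff.1 hn0
      rw [normalProd_apply_one hm, hφ]
      have : constTerm (∏ ρ, q (n ρ)) = 0 := by
        rw [map_prod]
        exact Finset.prod_eq_zero (Finset.mem_univ ρ) (by rw [constTerm_q]; exact if_neg hρ)
      rw [this, Int.cast_zero, smul_zero]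
  have h5 : φ 1 = 1 := by rw [hφ, map_one, Int.cast_one]
  rw [h4, h5] at h1
  simpa using h1.symm

/-- The map `φ` serves to pass to a complex vector space; normally ordered products are symmetric,
so that `diagSum_vander` applies to them. -/
lemma map_tailProduct_apply (hm : Odd m) (f : Gam) (φ : Gam →+ S)
    (hs : IsSymm fun n : ZMod m → ℤ => φ (normalProd (resList m 0) 1 n f)) (d : ℤ) :
    φ (tailProduct m 0 d f) = rootSum id (fun n => φ (normalProd (resList m 0) 1 n f)) d := by
  have h1 := map_diagSum_clearB hm f φ d
  rw [diagSum_vander hm (degFinite_normalProd hm f φ) hs] at h1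
  exact (smul_right_injective S (pow_ne_zero _ two_ne_zero)) h1

lemma map_tailProduct_one (hm : Odd m) (φ : Gam →+ S) (d : ℤ) :
    φ (tailProduct m 0 d 1) = rootSum id (fun n : ZMod m → ℤ => φ (∏ ρ, q (n ρ))) d := by
  have h1 := map_tailProduct_apply hm 1 φ (by
    simp only [normalProd_apply_one hm]; exact isSymm_prod q φ) d
  simpa only [normalProd_apply_one hm] using h1

/-- The residues modulo `m` add up to `0`, as `m` is odd. -/
lemma tailProduct_eq_zero (hm : Odd m) {d : ℤ} (hd : ¬(m : ℤ) ∣ d) : tailProduct m 0 d = 0 := by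
  refine LinearMap.ext fun f => ?_
  refine zsmul_eq_zero_gam (c := 2 ^ npairs (resList m 0)) (by positivity) ?_
  rw [isClearing hm 0 d f]
  refine finsum_mem_eq_zero_of_forall_eq_zero fun n hn => absurd ?_ hd
  have h1 : ((∑ ρ, n ρ : ℤ) : ZMod m) = ∑ ρ, ρ := by
    rw [Int.cast_sum]
    exact Finset.sum_congr rfl fun ρ _ => hn.1.1 ρ (mem_resList_zero hm ρ)
  have h2 : (∑ ρ : ZMod m, ρ) = 0 := by
    have h3 : (2 : ZMod m) * ∑ ρ : ZMod m, ρ = 0 := by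
      have h4 := Equiv.sum_comp (Equiv.neg (ZMod m)) fun ρ => ρ
      simp only [Equiv.neg_apply] at h4
      rw [Finset.sum_neg_distrib] at h4
      linear_combination -h4
    have h5 : IsUnit (2 : ZMod m) := by
      have := (ZMod.isUnit_iff_coprime 2 m).2 (Nat.coprime_two_left.2 hm)
      exact_mod_cast this
    exact (h5.mul_right_eq_zero).1 h3
  rw [hn.2, h2, ZMod.intCast_zmod_eq_zero_iff_dvd] at h1
  exact (Int.dvd_add_left (dvd_mul_right _ _)).1 h1

end RootSum

/-! ### The plethysms `q_n ∘ p_m` -/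

section Plethysm

variable {m : ℕ} [NeZero m]

/-- The inclusion of `Γ` into the power series with complex coefficients, a complex vector space in
which sums over roots of unity can be formed. -/
def toComplex : Gam →+* MvPowerSeries ℕ ℂ :=
  (MvPowerSeries.map (Int.castRingHom ℂ)).comp GammaRing.val.toRingHom

lemma toComplex_injective : Function.Injective toComplex := by
  intro f g h
  refine Subtype.ext (MvPowerSeries.ext fun d => ?_)
  have := congrArg (MvPowerSeries.coeff d) h
  change MvPowerSeries.coeff d (MvPowerSeries.map (Int.castRingHom ℂ) (f : MvPowerSeries ℕ ℤ)) =
    MvPowerSeries.coeff d (MvPowerSeries.map (Int.castRingHom ℂ) (g : MvPowerSeries ℕ ℤ)) at this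
  rw [MvPowerSeries.coeff_map, MvPowerSeries.coeff_map] at this
  exact (Int.cast_injective (α := ℂ)) this

/-- `∏_ρ (1 - χ(ρ) y) = 1 - y^m`. -/
lemma prod_one_sub_stdAddChar {R : Type*} [CommRing R] [IsDomain R] {φ : ℂ →+* R}
    (y : R) : ∏ ρ : ZMod m, (1 - φ (ZMod.stdAddChar ρ) * y) = 1 - y ^ m := by
  classical
  have hφ := φ.injective
  have h1 : IsPrimitiveRoot (φ (ZMod.stdAddChar (1 : ZMod m))) m := by
    refine IsPrimitiveRoot.map_of_injective ?_ hφ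
    have := ZMod.stdAddChar_coe (N := m) 1
    rw [Int.cast_one] at this
    rw [this]
    simpa using Complex.isPrimitiveRoot_exp m (NeZero.ne m)
  have hpos : 0 < m := Nat.pos_of_ne_zero (NeZero.ne m)
  have h2 : Polynomial.nthRootsFinset m (1 : R) =
      Finset.univ.image fun ρ : ZMod m => φ (ZMod.stdAddChar ρ) := by
    refine (Finset.eq_of_subset_of_card_le ?_ ?_).symm
    · intro x hx
      obtain ⟨ρ, -, rfl⟩ := Finset.mem_image.1 hx
      rw [Polynomial.mem_nthRootsFinset hpos, ← map_pow, ← AddChar.map_nsmul_eq_pow]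
      simp
    · rw [h1.card_nthRootsFinset, Finset.card_image_of_injective, Finset.card_univ, ZMod.card]
      exact hφ.comp ZMod.injective_stdAddChar
  have h3 := h1.pow_sub_pow_eq_prod_sub_mul 1 y hpos
  rw [one_pow, h2, Finset.prod_image fun _ _ _ _ h => ZMod.injective_stdAddChar (hφ h)] at h3
  exact h3.symm

/-- The effect of `D_j` on some of the factors of `∏_ρ q_{n_ρ}`. -/
def delPart (k : Finset (ZMod m)) (j : ℤ) (n : ZMod m → ℤ) : Gam :=
  (∏ ρ ∈ kᶜ, q (n ρ)) * del j (∏ ρ ∈ k, q (n ρ))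

lemma degFinite_delPart {S : Type} [AddCommGroup S] [Module ℂ S] (φ : Gam →+ S)
    (k : Finset (ZMod m)) (j : ℤ) : DegFinite fun n => φ (delPart k j n) := by
  intro d
  refine (finite_setOf_le_sum_eq 0 d).subset ?_
  rintro n ⟨h1, h2⟩
  refine ⟨fun ρ => ?_, h1⟩
  by_contra h3
  refine h2 ?_
  simp only
  rw [delPart]
  by_cases hρ : ρ ∈ k
  · rw [Finset.prod_eq_zero hρ (q_neg (not_le.1 h3)), map_zero, mul_zero, map_zero]
  · rw [Finset.prod_eq_zero (Finset.mem_compl.2 hρ) (q_neg (not_le.1 h3)), zero_mul, map_zero]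

/-- The relation `(1 - s t) D(s) Q(t) = (1 + s t) Q(t)` for one factor, in which `s` is the
variable of `D(s)` and `t` is `x_ρ`. -/
lemma delPart_insert {k : Finset (ZMod m)} {ρ : ZMod m} (hρ : ρ ∉ k) (j : ℤ) (n : ZMod m → ℤ) :
    delPart (insert ρ k) j n - delPart (insert ρ k) (j - 1) (n - Pi.single ρ 1) =
      delPart k j n + delPart k (j - 1) (n - Pi.single ρ 1) := by
  have h1 : kᶜ = insert ρ (insert ρ k)ᶜ := by
    ext σ
    simp only [Finset.mem_compl, Finset.mem_insert]
    by_cases h : σ = ρ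
    · simp [h, hρ]
    · simp [h]
  have h2 : ρ ∉ (insert ρ k)ᶜ := by simp
  have h3 : ∀ s : Finset (ZMod m), ρ ∉ s →
      ∏ σ ∈ s, q ((n - Pi.single ρ 1 : ZMod m → ℤ) σ) = ∏ σ ∈ s, q (n σ) := fun s hs =>
    Finset.prod_congr rfl fun σ hσ => by
      have : σ ≠ ρ := fun h => hs (h ▸ hσ)
      simp [this]
  simp only [delPart]
  rw [h1, Finset.prod_insert hρ, Finset.prod_insert hρ, Finset.prod_insert h2,
    Finset.prod_insert h2, h3 _ h2, h3 _ hρ]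
  simp only [Pi.sub_apply, Pi.single_eq_same]
  linear_combination (∏ σ ∈ (insert ρ k)ᶜ, q (n σ)) *
    del_q_mul j (n ρ) (∏ σ ∈ k, q (n σ))

/-- The simultaneous shift of both indices of a family. -/
def doubleShift (S : Type) [AddCommGroup S] [Module ℂ S] : Module.End ℂ (ℤ → ℤ → S) where
  toFun F j d := F (j - 1) (d - 1)
  map_add' _ _ := rfl
  map_smul' _ _ := rfl

lemma doubleShift_pow (S : Type) [AddCommGroup S] [Module ℂ S] (s : ℕ) (F : ℤ → ℤ → S) (j d : ℤ) :
    (doubleShift S ^ s) F j d = F (j - s) (d - s) := by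
  induction s generalizing j d with
  | zero => simp
  | succ s ih =>
    rw [pow_succ', Module.End.mul_apply]
    change (doubleShift S ^ s) F (j - 1) (d - 1) = _
    rw [ih]
    congr 1 <;> push_cast <;> ring

/-- `delPart_insert` at `x_ρ = χ(ρ) u`: multiplication by `s u` is `doubleShift`. -/
lemma rootSum_delPart_insert {S : Type} [AddCommGroup S] [Module ℂ S] (φ : Gam →+ S)
    {k : Finset (ZMod m)} {ρ : ZMod m} (hρ : ρ ∉ k) :
    (1 - (ZMod.stdAddChar ρ : ℂ) • doubleShift S)
        (fun j => rootSum id fun n => φ (delPart (insert ρ k) j n)) =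
      (1 + (ZMod.stdAddChar ρ : ℂ) • doubleShift S)
        (fun j => rootSum id fun n => φ (delPart k j n)) := by
  funext j d
  have h1 : ∀ k j, (ZMod.stdAddChar ρ : ℂ) • rootSum id (fun n => φ (delPart k (j - 1) n)) (d - 1) =
      rootSum id (act _ S (lX ρ) fun n => φ (delPart k (j - 1) n)) d := fun k j =>
    ((EvaluatesTo.variable_lX id ρ S _ (degFinite_delPart φ k (j - 1))).2 d).symm
  have h2 : ∀ k j, DegFinite (act _ S (lX ρ) fun n => φ (delPart k (j - 1) n)) := fun k j =>
    (EvaluatesTo.variable_lX id ρ S _ (degFinite_delPart φ k (j - 1))).1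
  change rootSum id (fun n => φ (delPart (insert ρ k) j n)) d -
      (ZMod.stdAddChar ρ : ℂ) • rootSum id (fun n => φ (delPart (insert ρ k) (j - 1) n)) (d - 1) =
    rootSum id (fun n => φ (delPart k j n)) d +
      (ZMod.stdAddChar ρ : ℂ) • rootSum id (fun n => φ (delPart k (j - 1) n)) (d - 1)
  rw [h1, h1, ← rootSum_add id (degFinite_delPart φ k j) (h2 k j), sub_eq_iff_eq_add,
    ← rootSum_add id ((degFinite_delPart φ k j).add (h2 k j)) (h2 _ j)]
  congr 1
  funext n
  simp only [Pi.add_apply, act_lX]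
  rw [← map_add, ← map_add]
  congr 1
  linear_combination delPart_insert hρ j n

open Polynomial in
/-- The relation `(1 - s^m u^m) D(s) T(u) 1 = (1 + s^m u^m) T(u) 1`, where `T(u)` denotes the
product. -/
lemma del_tailProduct_one (hm : Odd m) (j d : ℤ) :
    del j (tailProduct m 0 d 1) - del (j - m) (tailProduct m 0 (d - m) 1) =
      (if j = 0 then tailProduct m 0 d 1 else 0) +
        if j = m then tailProduct m 0 (d - m) 1 else 0 := by
  set S := MvPowerSeries ℕ ℂ
  set φ : Gam →+ S := toComplex.toAddMonoidHom
  set E : Finset (ZMod m) → ℤ → ℤ → S := fun k j => rootSum id fun n => φ (delPart k j n) with hE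
  have key : ∀ k : Finset (ZMod m),
      aeval (doubleShift S) (∏ ρ ∈ k, (1 - C (ZMod.stdAddChar ρ) * X : ℂ[X])) (E k) =
        aeval (doubleShift S) (∏ ρ ∈ k, (1 - C (ZMod.stdAddChar ρ) * (-X) : ℂ[X])) (E ∅) := by
    intro k
    induction k using Finset.induction_on with
    | empty => simp
    | insert ρ k hρ ih =>
      have h1 : aeval (doubleShift S) (1 - C (ZMod.stdAddChar ρ) * X : ℂ[X]) (E (insert ρ k)) =
          aeval (doubleShift S) (1 - C (ZMod.stdAddChar ρ) * (-X) : ℂ[X]) (E k) := by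
        have := rootSum_delPart_insert φ hρ
        rw [mul_neg, sub_neg_eq_add]
        simp only [map_sub, map_add, map_mul, map_one, aeval_X, aeval_C, ← Algebra.smul_def]
        exact this
      rw [Finset.prod_insert hρ, Finset.prod_insert hρ, mul_comm, map_mul, Module.End.mul_apply, h1,
        ← Module.End.mul_apply, ← map_mul, mul_comm, map_mul, Module.End.mul_apply, ih,
        ← Module.End.mul_apply, ← map_mul]
  have h1 := congrFun (congrFun (key Finset.univ) j) d
  rw [prod_one_sub_stdAddChar (φ := C), prod_one_sub_stdAddChar (φ := C), hm.neg_pow,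
    sub_neg_eq_add] at h1
  simp only [map_sub, map_add, map_one, map_pow, aeval_X, LinearMap.sub_apply, LinearMap.add_apply,
    Pi.sub_apply, Pi.add_apply, doubleShift_pow, Module.End.one_apply] at h1
  have h2 : ∀ j d, E Finset.univ j d = φ (del j (tailProduct m 0 d 1)) := by
    intro j d
    have := map_tailProduct_one hm (φ.comp (del j).toAddMonoidHom) d
    refine Eq.trans ?_ this.symm
    simp [hE, delPart]
  have h3 : ∀ j d, E ∅ j d = φ (if j = 0 then tailProduct m 0 d 1 else 0) := by
    intro j d
    by_cases hj : j = 0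
    · rw [if_pos hj]
      refine Eq.trans ?_ (map_tailProduct_one hm φ d).symm
      simp [hE, delPart, hj, del_one]
    · rw [if_neg hj, map_zero]
      simp [hE, delPart, hj, del_one, rootSum]
  rw [h2, h2, h3, h3, ← map_sub, ← map_add] at h1
  have h4 := toComplex_injective h1
  rw [h4]
  simp only [sub_eq_zero]

lemma constTerm_tailProduct_one (hm : Odd m) (d : ℤ) :
    constTerm (tailProduct m 0 d 1) = if d = 0 then 1 else 0 := by
  obtain ⟨φ, hφ⟩ : ∃ φ : Gam →+ ℂ, ∀ x, φ x = (constTerm x : ℂ) :=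
    ⟨((Int.castRingHom ℂ).comp constTerm).toAddMonoidHom, fun _ => rfl⟩
  have h1 := map_tailProduct_one hm φ d
  by_cases hd : d = 0
  · rw [if_pos hd, tailProduct_one hm 0 hd.le, if_pos hd, map_one]
  · rw [if_neg hd]
    rw [rootSum, hφ] at h1
    rw [finsum_mem_eq_zero_of_forall_eq_zero] at h1
    · exact_mod_cast h1
    · intro n hn
      obtain ⟨ρ, hρ⟩ : ∃ ρ, n ρ ≠ 0 := by
        by_contra! h
        exact hd (by rw [← show ∑ ρ, n ρ = d from hn]; simp [h])
      have : constTerm (∏ ρ, q (n ρ)) = 0 := by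
        rw [map_prod]
        exact Finset.prod_eq_zero (Finset.mem_univ ρ) (by rw [constTerm_q, if_neg hρ])
      rw [hφ, this, Int.cast_zero, smul_zero]

lemma pleth_eq_expand (f : MvPowerSeries ℕ ℤ) :
    pleth m f = MvPowerSeries.expand m (NeZero.ne m) f := by
  rw [MvPowerSeries.expand, MvPowerSeries.substAlgHom_apply]; rfl

lemma headCoeff_pleth_mul (j : ℕ) (f : MvPowerSeries ℕ ℤ) :
    headCoeff (m * j) (pleth m f) = pleth m (headCoeff j f) := by
  rw [pleth_eq_expand, pleth_eq_expand]
  ext d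
  rw [coeff_headCoeff]
  by_cases h : ∀ i, m ∣ d i
  · obtain ⟨d', rfl⟩ : ∃ d' : ℕ →₀ ℕ, m • d' = d :=
      ⟨d.mapRange (· / m) (Nat.zero_div m), by ext i; simp [Nat.mul_div_cancel' (h i)]⟩
    have : consExp (m * j) (m • d') = m • consExp j d' := by
      ext i; cases i <;> simp
    rw [this, MvPowerSeries.coeff_expand_smul, MvPowerSeries.coeff_expand_smul, coeff_headCoeff]
  · push Not at h
    obtain ⟨i, hi⟩ := h
    rw [MvPowerSeries.coeff_expand_of_not_dvd m _ _ hi,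
      MvPowerSeries.coeff_expand_of_not_dvd m _ _ (i := i + 1) (by simpa using hi)]

lemma headCoeff_pleth_of_not_dvd {j : ℕ} (hj : ¬m ∣ j) (f : MvPowerSeries ℕ ℤ) :
    headCoeff j (pleth m f) = 0 := by
  rw [pleth_eq_expand]
  ext d
  rw [coeff_headCoeff, MvPowerSeries.coeff_expand_of_not_dvd m _ _ (i := 0) (by simpa using hj),
    map_zero]

/-- The coefficient of `u^d` in `∑_n (q_n ∘ p_m) u^{nm}`. -/
def plethCoeff (m : ℕ) (d : ℤ) : MvPowerSeries ℕ ℤ :=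
  if (m : ℤ) ∣ d then pleth m (q (d / m)) else 0

lemma headCoeff_plethCoeff_of_lt {j : ℕ} (hj : j < m) (d : ℤ) :
    headCoeff j (plethCoeff m d) = if j = 0 then plethCoeff m d else 0 := by
  rw [plethCoeff]
  by_cases hd : (m : ℤ) ∣ d
  · rw [if_pos hd]
    by_cases hj0 : j = 0
    · have := headCoeff_pleth_mul (m := m) 0 (q (d / m) : MvPowerSeries ℕ ℤ)
      rw [if_pos hj0, hj0]
      rw [mul_zero, ← coe_del, Nat.cast_zero, del_zero] at this
      exact this
    · rw [if_neg hj0, headCoeff_pleth_of_not_dvd]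
      exact fun h => hj0 (Nat.eq_zero_of_dvd_of_lt h hj)
  · simp [hd]

lemma headCoeff_plethCoeff_of_le {j : ℕ} (hj : m ≤ j) (d : ℤ) :
    headCoeff j (plethCoeff m d) = headCoeff (j - m) (plethCoeff m (d - m)) +
      if j = m then plethCoeff m (d - m) else 0 := by
  have hm0 : (m : ℤ) ≠ 0 := Nat.cast_ne_zero.2 (NeZero.ne m)
  have hpos : 0 < m := Nat.pos_of_ne_zero (NeZero.ne m)
  rw [plethCoeff, plethCoeff]
  by_cases hd : (m : ℤ) ∣ d
  · obtain ⟨d', rfl⟩ := hd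
    rw [show (m : ℤ) * d' - m = m * (d' - 1) by ring, if_pos (dvd_mul_right _ _),
      if_pos (dvd_mul_right _ _), Int.mul_ediv_cancel_left _ hm0, Int.mul_ediv_cancel_left _ hm0]
    by_cases hjm : m ∣ j
    · obtain ⟨j', rfl⟩ := hjm
      obtain ⟨i, rfl⟩ : ∃ i, j' = i + 1 := ⟨j' - 1, by
        have : j' ≠ 0 := by rintro rfl; omega
        omega⟩
      have h1 := del_q_mul (i + 1 : ℕ) d' 1
      rw [mul_one, mul_one, del_one, del_one] at h1
      have h2 : del (i + 1 : ℕ) (q d') = del i (q (d' - 1)) + if i = 0 then q (d' - 1) else 0 := by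
        rw [show ((i + 1 : ℕ) : ℤ) - 1 = i by push_cast; ring] at h1
        rw [if_neg (by omega : ((i + 1 : ℕ) : ℤ) ≠ 0), sub_eq_iff_eq_add] at h1
        rw [h1]
        by_cases hi : i = 0 <;> simp [hi]
        ring
      rw [show m * (i + 1) - m = m * i by rw [mul_add, mul_one, Nat.add_sub_cancel],
        headCoeff_pleth_mul, headCoeff_pleth_mul, ← coe_del, ← coe_del, h2, pleth_eq_expand,
        pleth_eq_expand, pleth_eq_expand]
      by_cases hi : i = 0
      · rw [if_pos hi, if_pos (by rw [hi]; ring)]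
        exact map_add _ _ _
      · rw [if_neg hi, if_neg, add_zero, add_zero]
        intro h
        apply hi
        have := Nat.eq_of_mul_eq_mul_left hpos (h.trans (mul_one m).symm)
        omega
    · rw [headCoeff_pleth_of_not_dvd hjm, headCoeff_pleth_of_not_dvd, if_neg, add_zero]
      · rintro rfl; exact hjm dvd_rfl
      · intro h
        exact hjm ((Nat.sub_add_cancel hj) ▸ (h.add dvd_rfl))
  · have hd' : ¬(m : ℤ) ∣ d - m := fun h => hd (by simpa using dvd_add h (dvd_refl (m : ℤ)))
    simp [hd, hd']

/-- `q_n ∘ p_m` is the coefficient of `u^{nm}` in the value of the product at `1`, since both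
have the same constant terms and behave in the same way when the first variable is split off. -/
lemma coe_tailProduct_one (hm : Odd m) (d : ℤ) :
    (tailProduct m 0 d 1 : MvPowerSeries ℕ ℤ) = plethCoeff m d := by
  set δ : ℤ → MvPowerSeries ℕ ℤ := fun d => (tailProduct m 0 d 1 : MvPowerSeries ℕ ℤ) -
    plethCoeff m d with hδ
  have hpos : 0 < m := Nat.pos_of_ne_zero (NeZero.ne m)
  have h1 : ∀ j : ℕ, ∀ d, headCoeff j (δ d) ∈ AddSubgroup.closure (Set.range δ) := by
    intro j
    induction j using Nat.strong_induction_on with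
    | _ j ih =>
      intro d
      have hmem : ∀ d, δ d ∈ AddSubgroup.closure (Set.range δ) := fun d =>
        AddSubgroup.subset_closure ⟨d, rfl⟩
      have h2 := del_tailProduct_one hm j d
      by_cases hj : j < m
      · rw [del_neg (by omega : (j : ℤ) - m < 0), LinearMap.zero_apply, sub_zero,
          if_neg (by omega : (j : ℤ) ≠ m), add_zero] at h2
        have h3 : headCoeff j (δ d) = if j = 0 then δ d else 0 := by
          rw [hδ, map_sub, headCoeff_plethCoeff_of_lt hj, ← coe_del, h2]
          by_cases h0 : j = 0 <;> simp [h0]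
        rw [h3]
        split_ifs
        · exact hmem d
        · exact zero_mem _
      · rw [not_lt] at hj
        have h3 : headCoeff j (δ d) = headCoeff (j - m) (δ (d - m)) +
            if j = m then δ (d - m) else 0 := by
          rw [if_neg (by omega : (j : ℤ) ≠ 0), zero_add, sub_eq_iff_eq_add,
            show (j : ℤ) - m = (j - m : ℕ) by omega] at h2
          rw [hδ, map_sub, headCoeff_plethCoeff_of_le hj, ← coe_del, h2, map_sub, ← coe_del]
          by_cases h0 : j = m
          · simp [h0]
            ring
          · have h0' : (j : ℤ) ≠ m := by exact_mod_cast h0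
            simp [h0, h0']
        rw [h3]
        refine add_mem (ih _ (by omega) _) ?_
        split_ifs
        · exact hmem _
        · exact zero_mem _
  refine sub_eq_zero.1 (eq_zero_of_mem_of_headCoeff_mem (AddSubgroup.closure (Set.range δ)) ?_ ?_
    (δ d) (AddSubgroup.subset_closure ⟨d, rfl⟩))
  · intro f hf
    induction hf using AddSubgroup.closure_induction with
    | mem f hf =>
      obtain ⟨d, rfl⟩ := hf
      have h2 : MvPowerSeries.constantCoeff (plethCoeff m d) = if d = 0 then 1 else 0 := by
        rw [plethCoeff]
        split_ifs with h3 h4 h4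
        · rw [pleth_eq_expand, MvPowerSeries.constantCoeff_expand, h4]
          exact (constTerm_q _).trans (by simp)
        · rw [pleth_eq_expand, MvPowerSeries.constantCoeff_expand]
          refine (constTerm_q _).trans (if_neg fun h5 => h4 ?_)
          obtain ⟨d', rfl⟩ := h3
          rw [Int.mul_ediv_cancel_left _ (Nat.cast_ne_zero.2 (NeZero.ne m))] at h5
          rw [h5, mul_zero]
        · rw [h4] at h3; exact absurd (dvd_zero _) h3
        · exact map_zero _
      rw [hδ, map_sub, h2]
      exact sub_eq_zero.2 (constTerm_tailProduct_one hm d)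
    | zero => exact map_zero _
    | add f g _ _ hf hg => rw [map_add, hf, hg, add_zero]
    | neg f _ hf => rw [map_neg, hf, neg_zero]
  · intro f hf j
    induction hf using AddSubgroup.closure_induction with
    | mem f hf => obtain ⟨d, rfl⟩ := hf; exact h1 j d
    | zero => rw [map_zero]; exact zero_mem _
    | add f g _ _ hf hg => rw [map_add]; exact add_mem hf hg
    | neg f _ hf => rw [map_neg]; exact neg_mem hf

lemma pleth_q_eq (hm : Odd m) (n : ℤ) :
    pleth m (q n : MvPowerSeries ℕ ℤ) = tailProduct m 0 (m * n) 1 := by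
  rw [coe_tailProduct_one hm, plethCoeff, if_pos (dvd_mul_right _ _),
    Int.mul_ediv_cancel_left _ (Nat.cast_ne_zero.2 (NeZero.ne m))]

lemma pleth_q_mem (hm : Odd m) (n : ℤ) : pleth m (q n : MvPowerSeries ℕ ℤ) ∈ GammaRing := by
  rw [pleth_q_eq hm]; exact (tailProduct m 0 (m * n) 1).2

lemma qPleth_eq (hm : Odd m) (n : ℤ) : qPleth m n = tailProduct m 0 (m * n) 1 := by
  rw [qPleth, dif_pos (pleth_q_mem hm n)]
  exact Subtype.ext (pleth_q_eq hm n)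

end Plethysm

/-! ### Expansion of the normally ordered product -/

section Expansion

open scoped TensorProduct

variable {A : Type} [CommRing A]

/-- The ring `A ⊗ A` over `ℤ`, as a type of its own: this fixes the `ℤ`-module structure on `A` once
and for all. -/
def TensorSquare (A : Type) [CommRing A] : Type := A ⊗[ℤ] A

instance : CommRing (TensorSquare A) := inferInstanceAs (CommRing (A ⊗[ℤ] A))

/-- The element `x ⊗ y`. -/
def tensorMk (x y : A) : TensorSquare A := x ⊗ₜ[ℤ] y

lemma tensorSquare_induction {p : TensorSquare A → Prop} (zero : p 0)
    (mk : ∀ x y, p (tensorMk x y)) (add : ∀ a b, p a → p b → p (a + b)) (z : TensorSquare A) :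
    p z :=
  TensorProduct.induction_on (R := ℤ) (motive := p) z zero mk add

lemma prod_tensorMk {ι : Type*} (s : Finset ι) (x y : ι → A) :
    ∏ i ∈ s, tensorMk (x i) (y i) = tensorMk (∏ i ∈ s, x i) (∏ i ∈ s, y i) := by
  classical
  induction s using Finset.induction_on with
  | empty => rfl
  | insert i s hi ih =>
    rw [Finset.prod_insert hi, Finset.prod_insert hi, Finset.prod_insert hi, ih]
    exact Algebra.TensorProduct.tmul_mul_tmul (R := ℤ) (x i) (∏ i ∈ s, x i) (y i) (∏ i ∈ s, y i)

/-- The map `x ⊗ y ↦ x · p(y)`. -/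
def tensorApply (p : A →+ A) : TensorSquare A →+ A :=
  (TensorProduct.liftAddHom
    (AddMonoidHom.mk' (fun x => (AddMonoidHom.mulLeft x).comp p)
      fun x y => AddMonoidHom.ext fun z => add_mul x y (p z))
    fun c x y => by
      change (c • x) * p y = x * p (c • y)
      rw [map_zsmul, smul_mul_assoc, mul_smul_comm] : A ⊗[ℤ] A →+ A)

lemma tensorApply_mk (p : A →+ A) (x y : A) : tensorApply p (tensorMk x y) = x * p y := rfl

lemma tensorApply_mk_mul (p : A →+ A) (x y : A) (z : TensorSquare A) :
    tensorApply p (tensorMk x y * z) =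
      x * tensorApply (p.comp (AddMonoidHom.mulLeft y)) z := by
  induction z using tensorSquare_induction with
  | zero => rw [mul_zero, map_zero, map_zero, mul_zero]
  | mk a b =>
    have h1 : tensorMk x y * tensorMk a b = tensorMk (x * a) (y * b) :=
      Algebra.TensorProduct.tmul_mul_tmul (R := ℤ) x a y b
    rw [h1, tensorApply_mk, tensorApply_mk, mul_assoc]
    rfl
  | add a b ha hb => rw [mul_add, map_add, map_add, mul_add, ha, hb]

/-- The map `x ↦ x^⊥ f`. -/
def perpAt (f : Gam) : Gam →+ Gam := (evalHom f).comp perpHom.toAddMonoidHom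

lemma perpAt_comp_mulLeft (f y : Gam) :
    (perpAt f).comp (AddMonoidHom.mulLeft y) = perpAt (perp y f) := by
  refine AddMonoidHom.ext fun x => ?_
  change perp (y * x) f = perp x (perp y f)
  rw [mul_comm]
  exact congrArg (fun T : Module.End ℤ Gam => T f) (map_mul perpHom x y)

/-- The coefficient of `x^k` in `Q(x) ⊗ Q(-1/x)`, up to terms of degree greater than `N` in the
second factor. -/
def tensorQ (N : ℕ) (k : ℤ) : TensorSquare Gam :=
  ∑ i ∈ Finset.Icc (0 : ℤ) N, tensorMk ((sgn i : Gam) * q (k + i)) (q i)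

lemma sum_range_eq_sum_Icc {M : Type*} [AddCommMonoid M] (N : ℕ) (F : ℤ → M) :
    ∑ i ∈ range (N + 1), F i = ∑ i ∈ Finset.Icc (0 : ℤ) N, F i := by
  refine Finset.sum_nbij' (fun i : ℕ => (i : ℤ)) Int.toNat ?_ ?_ ?_ ?_ ?_
  · intro i hi; simp only [Finset.mem_range, Finset.mem_Icc] at hi ⊢; omega
  · intro i hi; simp only [Finset.mem_range, Finset.mem_Icc] at hi ⊢; omega
  · intro i _; exact Int.toNat_natCast i
  · intro i hi; simp only [Finset.mem_Icc] at hi; omega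
  · intro i _; rfl

variable {m : ℕ} [NeZero m]

/-- A normally ordered product is evaluated by multiplying the series `Q(x) ⊗ Q(-1/x)` in the
commutative ring `Γ ⊗ Γ` and letting the second factor act as an adjoint. This makes its symmetry
evident. -/
lemma normalProd_eq_tensorApply {N : ℕ} {f : Gam} (hf : f ∈ degLE N) (l : List (ZMod m))
    (n : ZMod m → ℤ) :
    normalProd l 1 n f = tensorApply (perpAt f) (l.map fun ρ => tensorQ N (n ρ)).prod := by
  induction l generalizing f with
  | nil =>
    have h1 : tensorApply (perpAt f) (tensorMk 1 1) = f := by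
      rw [tensorApply_mk, one_mul]
      exact congrArg (fun T : Module.End ℤ Gam => T f) (map_one perpHom)
    exact h1.symm
  | cons ρ l ih =>
    rw [normalProd_cons, normal_apply _ _ hf, List.map_cons, List.prod_cons]
    nth_rewrite 1 [tensorQ]
    rw [Finset.sum_mul, map_sum, ← sum_range_eq_sum_Icc N fun i =>
      tensorApply (perpAt f) (tensorMk ((sgn i : Gam) * q (n ρ + i)) (q i) *
        (l.map fun ρ => tensorQ N (n ρ)).prod)]
    refine Finset.sum_congr rfl fun i _ => ?_
    rw [tensorApply_mk_mul, perpAt_comp_mulLeft, perp_q, ← ih (del_mem_degLE hf i), sgn_natCast]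
    push_cast
    ring

lemma prod_tensorQ (N : ℕ) (n : ZMod m → ℤ) :
    ∏ ρ, tensorQ N (n ρ) = ∑ i ∈ Fintype.piFinset fun _ : ZMod m => Finset.Icc (0 : ℤ) N,
      tensorMk ((sgn (∑ ρ, i ρ) : Gam) * ∏ ρ, q (n ρ + i ρ)) (∏ ρ, q (i ρ)) := by
  have h2 : ∀ (s : Finset (ZMod m)) (i : ZMod m → ℤ), sgn (∑ ρ ∈ s, i ρ) = ∏ ρ ∈ s, sgn (i ρ) := by
    intro s i
    induction s using Finset.induction_on with
    | empty => rfl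
    | insert ρ s hρ ih => rw [Finset.sum_insert hρ, Finset.prod_insert hρ, sgn_add, ih]
  simp only [tensorQ]
  rw [Finset.prod_univ_sum]
  refine Finset.sum_congr rfl fun i _ => ?_
  rw [prod_tensorMk, Finset.prod_mul_distrib, h2, Int.cast_prod]

lemma normalProd_eq_tensorApply_prod (hm : Odd m) {N : ℕ} {f : Gam} (hf : f ∈ degLE N)
    (n : ZMod m → ℤ) :
    normalProd (resList m 0) 1 n f = tensorApply (perpAt f) (∏ ρ, tensorQ N (n ρ)) := by
  rw [normalProd_eq_tensorApply hf, ← List.prod_toFinset _ (nodup_resList hm 0)]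
  congr 2
  ext ρ
  simp [mem_resList_zero hm ρ]

/-- The expansion of the normally ordered product into multiplications and adjoints. -/
lemma normalProd_eq_sum (hm : Odd m) {N : ℕ} {f : Gam} (hf : f ∈ degLE N) (n : ZMod m → ℤ) :
    normalProd (resList m 0) 1 n f = ∑ i ∈ Fintype.piFinset fun _ : ZMod m => Finset.Icc (0 : ℤ) N,
      (sgn (∑ ρ, i ρ) : Gam) * (∏ ρ, q (n ρ + i ρ)) * perp (∏ ρ, q (i ρ)) f := by
  rw [normalProd_eq_tensorApply_prod hm hf, prod_tensorQ, map_sum]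
  rfl

end Expansion

/-! ### The coefficients of the product -/

section Coefficients

variable {m : ℕ} [NeZero m]

lemma perp_prod_q_eq_zero {N : ℕ} {f : Gam} (hf : f ∈ degLE N) {n : ZMod m → ℤ} {ρ : ZMod m}
    (hρ : n ρ < 0 ∨ N < n ρ) : perp (∏ ρ, q (n ρ)) f = 0 := by
  have h1 : perp (∏ ρ, q (n ρ)) f = perpHom (∏ ρ, q (n ρ)) f := rfl
  rw [h1, ← Finset.mul_prod_erase _ _ (Finset.mem_univ ρ), mul_comm, map_mul, Module.End.mul_apply]
  have h2 : perpHom (q (n ρ)) f = 0 := by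
    change perp (q (n ρ)) f = 0
    rw [perp_q]
    rcases hρ with h | h
    · rw [del_neg h]; rfl
    · exact del_eq_zero_of_lt hf h
  rw [h2, map_zero]

/-- The map `x ↦ x^⊥ f`, with values in power series with complex coefficients. -/
def perpEval (f : Gam) : Gam →+ MvPowerSeries ℕ ℂ :=
  toComplex.toAddMonoidHom.comp (perpAt f)

lemma perpEval_apply (f x : Gam) : perpEval f x = toComplex (perp x f) := rfl

lemma perp_tailProduct_one_eq_zero (hm : Odd m) {N : ℕ} {f : Gam} (hf : f ∈ degLE N) {b : ℤ}
    (hb : m * N < b) : perp (tailProduct m 0 b 1) f = 0 := by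
  refine toComplex_injective ?_
  rw [map_zero, ← perpEval_apply, map_tailProduct_one hm]
  refine finsum_mem_eq_zero_of_forall_eq_zero fun n hn => ?_
  obtain ⟨ρ, hρ⟩ : ∃ ρ, (N : ℤ) < n ρ := by
    by_contra! h
    have h1 := Finset.sum_le_card_nsmul Finset.univ n (N : ℤ) fun ρ _ => h ρ
    rw [show ∑ ρ, n ρ = b from hn, Finset.card_univ, ZMod.card, nsmul_eq_mul] at h1
    omega
  simp only
  rw [perpEval_apply, perp_prod_q_eq_zero hf (Or.inr hρ), map_zero, smul_zero]

lemma rootMonomial_neg_mul (n : ZMod m → ℤ) : rootMonomial id (-n) * rootMonomial id n = 1 := by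
  rw [← rootMonomial_add, neg_add_cancel, rootMonomial]
  simp

/-- The value of `T(b)(1)^⊥` at the conjugate roots of unity. -/
lemma perpEval_tailProduct_one (hm : Odd m) {N : ℕ} {f : Gam} (hf : f ∈ degLE N) (b : ℤ) :
    perpEval f (tailProduct m 0 b 1) =
      ∑ i ∈ Fintype.piFinset fun _ : ZMod m => Finset.Icc (0 : ℤ) N with ∑ ρ, i ρ = b,
        rootMonomial id (-i) • perpEval f (∏ ρ, q (i ρ)) := by
  have hneg : ∀ n : ZMod m → ℤ,
      rootMonomial (id ∘ Equiv.neg (ZMod m)) n = rootMonomial id (-n) := by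
    intro n
    rw [rootMonomial, rootMonomial]
    congr 1
    refine Finset.sum_congr rfl fun ρ _ => ?_
    simp
  rw [map_tailProduct_one hm, ← rootSum_perm (isSymm_prod q (perpEval f)) id (Equiv.neg (ZMod m)),
    rootSum]
  simp only [hneg]
  refine finsum_mem_eq_sum_of_inter_support_eq _ ?_
  ext n
  simp only [degSet, Set.mem_inter_iff, Set.mem_ofPred_eq, Finset.coe_filter, Fintype.mem_piFinset,
    Finset.mem_Icc, Function.mem_support]
  refine ⟨fun ⟨h1, h2⟩ => ⟨⟨fun ρ => ?_, h1⟩, h2⟩, fun ⟨⟨_, h1⟩, h2⟩ => ⟨h1, h2⟩⟩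
  by_contra h3
  refine h2 ?_
  rw [perpEval_apply, perp_prod_q_eq_zero hf (ρ := ρ) (by omega), map_zero, smul_zero]

lemma rootSum_sum {S ι : Type} [AddCommGroup S] [Module ℂ S] (a : ZMod m → ZMod m) (s : Finset ι)
    {g : ι → (ZMod m → ℤ) → S} (hg : ∀ i ∈ s, DegFinite (g i)) (d : ℤ) :
    rootSum a (fun n => ∑ i ∈ s, g i n) d = ∑ i ∈ s, rootSum a (g i) d := by
  classical
  have key : DegFinite (fun n => ∑ i ∈ s, g i n) ∧
      rootSum a (fun n => ∑ i ∈ s, g i n) d = ∑ i ∈ s, rootSum a (g i) d := by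
    induction s using Finset.induction_on with
    | empty =>
      refine ⟨fun d => ?_, ?_⟩
      · simp
      · simp [rootSum]
    | insert i s hi ih =>
      obtain ⟨h1, h2⟩ := ih fun j hj => hg j (Finset.mem_insert_of_mem hj)
      have h3 := hg i (Finset.mem_insert_self i s)
      have h4 : (fun n => ∑ j ∈ insert i s, g j n) = g i + fun n => ∑ j ∈ s, g j n := by
        funext n; rw [Finset.sum_insert hi]; rfl
      rw [h4, Finset.sum_insert hi, ← h2]
      exact ⟨h3.add h1, rootSum_add a h3 h1 d⟩
  exact key.2

lemma degFinite_prod_q {S : Type} [AddCommGroup S] [Module ℂ S] (φ : Gam →+ S) :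
    DegFinite fun n : ZMod m → ℤ => φ (∏ ρ, q (n ρ)) := by
  have := degFinite_delPart (m := m) φ ∅ 0
  simpa [delPart, del_zero] using this

/-- `T_d = ∑_b (-1)^b T_{d+b}(1) T_b(1)^⊥`. -/
lemma tailProduct_apply (hm : Odd m) {N : ℕ} {f : Gam} (hf : f ∈ degLE N) (d : ℤ) :
    tailProduct m 0 d f = ∑ b ∈ Finset.Icc (0 : ℤ) (m * N),
      (sgn b : Gam) * (tailProduct m 0 (d + b) 1 * perp (tailProduct m 0 b 1) f) := by
  refine toComplex_injective ?_
  set I := Fintype.piFinset fun _ : ZMod m => Finset.Icc (0 : ℤ) N with hI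
  have hs : IsSymm fun n : ZMod m → ℤ =>
      toComplex.toAddMonoidHom (normalProd (resList m 0) 1 n f) := by
    simp only [normalProd_eq_tensorApply_prod hm hf]
    exact isSymm_prod (tensorQ N) fun x => toComplex.toAddMonoidHom (tensorApply (perpAt f) x)
  have h1 := map_tailProduct_apply hm f toComplex.toAddMonoidHom hs d
  -- multiplication by the factor of the term with index `i` that does not depend on `n`
  set φ : (ZMod m → ℤ) → Gam →+ MvPowerSeries ℕ ℂ := fun i =>
    (AddMonoidHom.mulLeft (toComplex (sgn (∑ ρ, i ρ) * perp (∏ ρ, q (i ρ)) f))).comp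
      toComplex.toAddMonoidHom with hφ
  have h2 : (fun n => toComplex.toAddMonoidHom (normalProd (resList m 0) 1 n f)) =
      fun n : ZMod m → ℤ => ∑ i ∈ I, φ i (∏ ρ, q ((n + i) ρ)) := by
    funext n
    rw [normalProd_eq_sum hm hf, map_sum]
    refine Finset.sum_congr rfl fun i _ => ?_
    change toComplex _ = toComplex _ * toComplex _
    rw [← map_mul]
    congr 1
    simp only [Pi.add_apply]
    ring
  have h3 : ∀ i, rootSum id (fun n : ZMod m → ℤ => φ i (∏ ρ, q ((n + i) ρ))) d =
      rootMonomial id (-i) • φ i (tailProduct m 0 (d + ∑ ρ, i ρ) 1) := by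
    intro i
    rw [map_tailProduct_one hm, ← rootSum_comp_add id (degFinite_prod_q (φ i)) i d, smul_smul,
      rootMonomial_neg_mul, one_smul]
  rw [h2, rootSum_sum] at h1
  swap
  · intro i _
    exact (degFinite_prod_q (φ i)).comp_add i
  refine h1.trans ?_
  rw [Finset.sum_congr rfl fun i _ => h3 i, map_sum,
    ← Finset.sum_fiberwise_of_maps_to (s := I) (t := Finset.Icc (0 : ℤ) (m * N))
      (g := fun i => ∑ ρ, i ρ)]
  · refine Finset.sum_congr rfl fun b _ => ?_
    rw [map_mul, map_mul, ← perpEval_apply, perpEval_tailProduct_one hm hf, Finset.mul_sum,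
      Finset.mul_sum]
    refine Finset.sum_congr rfl fun i hi => ?_
    rw [(Finset.mem_filter.1 hi).2, perpEval_apply, mul_smul_comm, mul_smul_comm]
    congr 1
    change toComplex _ * toComplex _ = _
    rw [(Finset.mem_filter.1 hi).2, map_mul]
    ring
  · intro i hi
    rw [hI, Fintype.mem_piFinset] at hi
    simp only [Finset.mem_Icc] at hi ⊢
    refine ⟨Finset.sum_nonneg fun ρ _ => (hi ρ).1, ?_⟩
    have := Finset.sum_le_card_nsmul Finset.univ i (N : ℤ) fun ρ _ => (hi ρ).2
    rwa [Finset.card_univ, ZMod.card, nsmul_eq_mul] at this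

lemma termPhi_apply (hm : Odd m) (n : ℤ) (i : ℕ) (f : Gam) :
    termPhi m n i f = (-1) ^ i * (tailProduct m 0 (m * (n + i)) 1 *
      perp (tailProduct m 0 (m * i) 1) f) := by
  rw [termPhi, qPleth_eq hm, qPleth_eq hm]
  change (-1 : ℤ) ^ i • (tailProduct m 0 (m * (n + i)) 1 * perp (tailProduct m 0 (m * i) 1) f) = _
  rw [zsmul_eq_mul]
  push_cast
  rfl

lemma termPhi_eq_zero (hm : Odd m) (n : ℤ) {i N : ℕ} {f : Gam} (hf : f ∈ degLE N) (hi : N < i) :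
    termPhi m n i f = 0 := by
  have hpos : 0 < m := hm.pos
  rw [termPhi_apply hm, perp_tailProduct_one_eq_zero hm hf, mul_zero, mul_zero]
  exact_mod_cast Nat.mul_lt_mul_of_pos_left hi hpos

lemma locallyFinite_termPhi (hm : Odd m) (n : ℤ) : LocallyFinite (termPhi m n) := by
  intro f
  obtain ⟨N, hN⟩ := exists_mem_degLE f
  refine (Set.finite_Iic N).subset fun i hi => ?_
  by_contra h
  exact hi (termPhi_eq_zero hm n hN (not_le.1 h))

/-- Only multiples of `m` contribute to `tailProduct_apply`, by `tailProduct_eq_zero`. -/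
lemma opPhi_eq (hm : Odd m) (n : ℤ) : opPhi m n = tailProduct m 0 (m * n) := by
  have hpos : 0 < m := hm.pos
  refine LinearMap.ext fun f => ?_
  obtain ⟨N, hN⟩ := exists_mem_degLE f
  rw [opPhi, opSum_apply (locallyFinite_termPhi hm n), tailProduct_apply hm hN,
    finsum_eq_sum_of_support_subset (s := range (N + 1))]
  · set G : ℤ → Gam := fun b =>
      (sgn b : Gam) * (tailProduct m 0 (m * n + b) 1 * perp (tailProduct m 0 b 1) f) with hG
    have h1 : ∀ i ∈ range (N + 1), termPhi m n i f = G (m * i) := by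
      intro i _
      have h2 : sgn (m * i) = (-1) ^ i := by
        rw [← sgn_natCast]
        refine sgn_congr ?_
        have hm' : ¬Even (m : ℤ) := by
          rw [Int.not_even_iff_odd]; exact_mod_cast hm
        rw [Int.even_mul]
        tauto
      rw [termPhi_apply hm, hG]
      simp only
      rw [h2, mul_add]
      push_cast
      rfl
    rw [Finset.sum_congr rfl h1, ← Finset.sum_image (f := G) (g := fun i : ℕ => (m * i : ℤ))]
    · refine Finset.sum_subset ?_ ?_
      · intro b hb
        obtain ⟨i, hi, rfl⟩ := Finset.mem_image.1 hb
        rw [Finset.mem_range] at hi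
        rw [Finset.mem_Icc]
        refine ⟨by positivity, ?_⟩
        have : i ≤ N := by omega
        gcongr
      · intro b hb hb'
        have h2 : ¬(m : ℤ) ∣ b := by
          rintro ⟨k, rfl⟩
          rw [Finset.mem_Icc] at hb
          have hm0 : (0 : ℤ) < m := by exact_mod_cast hpos
          have h3 : 0 ≤ k := nonneg_of_mul_nonneg_right hb.1 hm0
          have h4 : k ≤ N := le_of_mul_le_mul_left hb.2 hm0
          refine hb' (Finset.mem_image.2 ⟨k.toNat, Finset.mem_range.2 (by omega), ?_⟩)
          rw [Int.toNat_of_nonneg h3]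
        rw [hG]
        simp only
        rw [tailProduct_eq_zero hm h2]
        have : perp ((0 : Module.End ℤ Gam) 1) = 0 := map_zero perpHom
        rw [this, LinearMap.zero_apply, mul_zero, mul_zero]
    · intro i _ j _ hij
      have hm0 : (m : ℤ) ≠ 0 := by exact_mod_cast hpos.ne'
      exact_mod_cast mul_left_cancel₀ hm0 hij
  · intro i hi
    rw [Finset.coe_range, Set.mem_Iio]
    by_contra h
    exact hi (termPhi_eq_zero hm n hN (by omega))

lemma phiSeries_eq (hm : Odd m) : phiSeries m = tailProduct m 0 := by
  funext d
  rw [phiSeries]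
  split_ifs with h
  · rw [opPhi_eq hm, Int.mul_ediv_cancel' h]
  · exact (tailProduct_eq_zero hm h).symm

end Coefficients

end SchurQ

end

open SchurQ in
theorem mainTheorem5 (m : ℕ) (hm : Odd m) :
    -- all the objects are well defined
    SchurQIsBasis ∧
    (∀ f : Gam, IsPerp f (perp f)) ∧
    (∀ n : ℤ, pleth m (q n : MvPowerSeries ℕ ℤ) ∈ GammaRing) ∧
    (∀ n : ℤ, LocallyFinite (termB n)) ∧
    (∀ n : ℤ, LocallyFinite (termPhi m n)) ∧
    (∀ c : ℕ, 1 ≤ c → c ≤ (m - 1) / 2 → ∀ d : ℤ, LocallyFinite (pairTerm m (2 * (c : ℤ)) d)) ∧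
    (∀ c : ℕ, 1 ≤ c → c ≤ (m - 1) / 2 → ∀ d : ℤ,
      LocallyFinite (mulTerm (pairFactor m (2 * (c : ℤ))) (tailProduct m c) d)) ∧
    -- the formula
    phiSeries m = tailProduct m 0 := by
  have : NeZero m := ⟨hm.pos.ne'⟩
  exact ⟨schurQIsBasis, isPerp_perp, pleth_q_mem hm, locallyFinite_termB, locallyFinite_termPhi hm,
    fun c _ _ d => locallyFinite_pairTerm m (2 * c) d,
    fun _ hc hc' d => locallyFinite_mulTerm hm hc hc' d, phiSeries_eq hm⟩
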